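/- Let $\Bbbk$ be an algebraically closed field of characteristic zero and let $n\ge 3$ be even. Let $Q$ be the cyclic quiver with vertices $e_i$ and arrows $\alpha_i\colon e_i\to e_{i+1}$ ($i\in\mathbb Z/n$), let $\overline Q$ be its double, with additional arrows $\alpha_i^*\colon e_{i+1}\to e_i$, and let $R=\Pi_{\widetilde A}=\Bbbk\overline Q/\bigl(\sum_i(\alpha_i\alpha_i^*-\alpha_i^*\alpha_i)\bigr)$ be the preprojective algebra (paths are composed from left to right), graded by path length. Let $D_n=\langle\rho,r\rangle\subset\operatorname{Aut}(R)$, where $\rho(e_i)=e_{i+1}$, $\rho(\alpha_i)=\alpha_{i+1}$, $\rho(\alpha_i^*)=\alpha_{i+1}^*$ and $r(e_i)=e_{-i}$, $r(\alpha_i)=\alpha_{-i-1}^*$, $r(\alpha_i^*)=\alpha_{-i-1}$, and let $W_n\subset D_n$ be the subgroup generated by all $\tau\in D_n$ with $\tau(e_i)=e_i$ for some $i$. Then: 1. The Auslander map $R\# W_n\to\operatorname{End}_{R^{W_n}}(R)$, $a\# g\mapsto(b\mapsto a\,g(b))$, where $R$ is regarded as a right $R^{W_n}$-module, is not an isomorphism.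 2. Let $A=\Bbbk Q'/(v_1u_1-u_1v_2,\;v_2u_2-u_2v_1)$, where $Q'$ is the quiver with vertices $1,2$, trivial paths $f_1,f_2$, arrows $u_1\colon1\to2$, $u_2\colon2\to1$ of degree $1$ and loops $v_1$ at $1$, $v_2$ at $2$ of degree $2$. There is an isomorphism of graded algebras $A\cong R^{W_n}$ with $f_1\mapsto\sum_{i\text{ even}}e_i$, $u_1\mapsto\sum_{i\text{ even}}(\alpha_i+\alpha_{i-1}^*)$, $v_1\mapsto\sum_{i\text{ even}}(\alpha_i\alpha_{i+1}+\alpha_{i-1}^*\alpha_{i-2}^*)$, and with $f_2,u_2,v_2$ mapping to the corresponding sums over odd $i$. 3. $A$ is a graded algebra that is twisted Calabi–Yau of dimension $2$: with $A^e=A\otimes_\Bbbk A^{op}$, the $A^e$-module $A$ has a finite resolution by finitely generated projective $A^e$-modules, $\operatorname{Ext}^i_{A^e}(A,A^e)=0$ for $i\ne2$, and $\operatorname{Ext}^2_{A^e}(A,A^e)\cong{}^1A^\mu$ as bimodules, where the automorphism $\mu$ exchanges $f_1$ with $f_2$, $u_1$ with $u_2$ and $v_1$ with $v_2$. 4. Write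 $s_i\in R^{W_n}$ for the sum of all $e_j$ with $j\equiv i$ mod $2$. Every $x\in R$ can be written in exactly one way as $x=\sum_i(e_ia_i+\alpha_ib_i)$ with $a_i\in s_iR^{W_n}$ and $b_i\in s_{i+1}R^{W_n}$; that is, $R=\bigoplus_i(e_iR^{W_n}\oplus\alpha_iR^{W_n})$ with $e_iR^{W_n}\cong s_iR^{W_n}$ and $\alpha_iR^{W_n}\cong s_{i+1}R^{W_n}$. In particular, $R$ is a free right $R^{W_n}$-module of rank $n$, with basis $\{e_i+e_{i+1},\ \alpha_i+\alpha_{i+1} : i\text{ even}\}$. 5. There is a nonzero right $R^{W_n}$-module endomorphism of $R$ that is homogeneous of degree $-1$. -/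

import Mathlib

open scoped TensorProduct

noncomputable section

/-! ### Path algebras -/

/-- The path algebra `kQ` of a quiver on the vertex set `V`: the vector space with basis the paths
of the quiver (the trivial paths included). -/
def PathAlgebra (k : Type*) (V : Type*) [Quiver V] [Semiring k] :=
  (Σ i j : V, Quiver.Path i j) →₀ k

namespace PathAlgebra

section Basic

variable (k : Type*) {V : Type*} [Field k] [Quiver V]

instance : AddCommGroup (PathAlgebra k V) :=
  inferInstanceAs (AddCommGroup ((Σ i j : V, Quiver.Path i j) →₀ k))

instance : Module k (PathAlgebra k V) :=
  inferInstanceAs (Module k ((Σ i j : V, Quiver.Path i j) →₀ k))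

/-- The basis element of `kQ` given by a path. -/
def ofPath {i j : V} (p : Quiver.Path i j) : PathAlgebra k V :=
  (Finsupp.single ⟨i, j, p⟩ 1 : (Σ i j : V, Quiver.Path i j) →₀ k)

/-- The trivial path at a vertex. -/
def vertex (i : V) : PathAlgebra k V := ofPath k (Quiver.Path.nil : Quiver.Path i i)

/-- The path of length one given by an arrow. -/
def arrow {i j : V} (a : i ⟶ j) : PathAlgebra k V := ofPath k a.toPath

open Classical in
/-- The product of two paths: first `p`, then `q`, when `p` ends where `q` starts, and `0`
otherwise. -/
def mulPath (p q : Σ i j : V, Quiver.Path i j) : PathAlgebra k V :=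
  if h : q.1 = p.2.1 then ofPath k (p.2.2.comp (q.2.2.cast h rfl)) else 0

/-- The bilinear extension of the product of paths. -/
def mulLin : PathAlgebra k V →ₗ[k] PathAlgebra k V →ₗ[k] PathAlgebra k V :=
  Finsupp.lsum k fun p => (LinearMap.toSpanSingleton k _
    (Finsupp.lsum k fun q => LinearMap.toSpanSingleton k _ (mulPath k p q)))

instance : Mul (PathAlgebra k V) := ⟨fun x y => mulLin k x y⟩

instance [Fintype V] : One (PathAlgebra k V) := ⟨∑ i, vertex k i⟩

variable {k}

theorem mul_eq (x y : PathAlgebra k V) : x * y = mulLin k x y := rfl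

theorem one_eq [Fintype V] : (1 : PathAlgebra k V) = ∑ i, vertex k i := rfl

theorem ofPath_mul_ofPath' {i j i' j' : V} (p : Quiver.Path i j) (q : Quiver.Path i' j') :
    ofPath k p * ofPath k q = mulPath k ⟨i, j, p⟩ ⟨i', j', q⟩ := by
  rw [mul_eq]
  unfold mulLin ofPath
  erw [Finsupp.lsum_single, LinearMap.toSpanSingleton_apply, one_smul, Finsupp.lsum_single,
    LinearMap.toSpanSingleton_apply, one_smul]

theorem ofPath_mul_ofPath {i j l : V} (p : Quiver.Path i j) (q : Quiver.Path j l) :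
    ofPath k p * ofPath k q = ofPath k (p.comp q) := by
  simp [ofPath_mul_ofPath', mulPath]

theorem ofPath_mul_ofPath_of_ne {i j i' j' : V} (p : Quiver.Path i j) (q : Quiver.Path i' j')
    (h : i' ≠ j) : ofPath k p * ofPath k q = 0 := by
  simp [ofPath_mul_ofPath', mulPath, h]

theorem linearMap_ext {M : Type*} [AddCommGroup M] [Module k M] {f g : PathAlgebra k V →ₗ[k] M}
    (h : ∀ (i j : V) (p : Quiver.Path i j), f (ofPath k p) = g (ofPath k p)) : f = g := by
  refine Finsupp.lhom_ext' fun ⟨i, j, p⟩ => LinearMap.ext_ring ?_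
  exact h i j p

theorem induction_on {C : PathAlgebra k V → Prop} (x : PathAlgebra k V)
    (h0 : C 0) (hp : ∀ (i j : V) (p : Quiver.Path i j), C (ofPath k p))
    (ha : ∀ x y, C x → C y → C (x + y)) (hs : ∀ (c : k) x, C x → C (c • x)) : C x := by
  refine Finsupp.induction_linear (motive := C) x h0 ha ?_
  rintro ⟨i, j, p⟩ c
  have := hs c _ (hp i j p)
  rwa [show (Finsupp.single ⟨i, j, p⟩ c : (Σ i j : V, Quiver.Path i j) →₀ k)
    = c • (Finsupp.single ⟨i, j, p⟩ 1 : (Σ i j : V, Quiver.Path i j) →₀ k) by simp]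

instance : NonUnitalNonAssocRing (PathAlgebra k V) where
  left_distrib x y z := by simp [mul_eq]
  right_distrib x y z := by simp [mul_eq]
  zero_mul x := by simp [mul_eq]
  mul_zero x := by simp [mul_eq]

instance : IsScalarTower k (PathAlgebra k V) (PathAlgebra k V) :=
  ⟨fun c x y => by simp [mul_eq]⟩

instance : SMulCommClass k (PathAlgebra k V) (PathAlgebra k V) :=
  ⟨fun c x y => by simp [mul_eq]⟩

protected theorem mul_assoc' (x y z : PathAlgebra k V) : x * y * z = x * (y * z) := by
  induction x using PathAlgebra.induction_on with
  | h0 => simp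
  | ha x x' hx hx' => simp only [add_mul, hx, hx']
  | hs c x hx => simp only [smul_mul_assoc, hx]
  | hp i j p =>
  induction y using PathAlgebra.induction_on with
  | h0 => simp
  | ha x x' hx hx' => simp only [add_mul, mul_add, hx, hx']
  | hs c x hx => simp only [smul_mul_assoc, mul_smul_comm, hx]
  | hp i' j' q =>
  induction z using PathAlgebra.induction_on with
  | h0 => simp
  | ha x x' hx hx' => simp only [mul_add, hx, hx']
  | hs c x hx => simp only [mul_smul_comm, hx]
  | hp i'' j'' r =>
  by_cases h : i' = j
  · subst h
    by_cases h' : i'' = j'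
    · subst h'
      simp only [ofPath_mul_ofPath, Quiver.Path.comp_assoc]
    · simp only [ofPath_mul_ofPath, ofPath_mul_ofPath_of_ne _ _ h', mul_zero]
  · by_cases h' : i'' = j'
    · subst h'
      simp only [ofPath_mul_ofPath, ofPath_mul_ofPath_of_ne _ _ h, zero_mul]
    · simp only [ofPath_mul_ofPath_of_ne _ _ h', ofPath_mul_ofPath_of_ne _ _ h, zero_mul, mul_zero]

theorem vertex_mul_vertex_self (i : V) : vertex k i * vertex k i = vertex k i :=
  ofPath_mul_ofPath _ _

theorem vertex_mul_vertex_of_ne {i j : V} (h : i ≠ j) : vertex k i * vertex k j = 0 :=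
  ofPath_mul_ofPath_of_ne _ _ h.symm

theorem vertex_mul_arrow {i j : V} (a : i ⟶ j) : vertex k i * arrow k a = arrow k a := by
  rw [vertex, arrow, ofPath_mul_ofPath, Quiver.Path.nil_comp]

theorem arrow_mul_vertex {i j : V} (a : i ⟶ j) : arrow k a * vertex k j = arrow k a := by
  rw [vertex, arrow, ofPath_mul_ofPath, Quiver.Path.comp_nil]

variable [Fintype V]

instance : Ring (PathAlgebra k V) where
  __ := (inferInstance : NonUnitalNonAssocRing (PathAlgebra k V))
  mul_assoc := PathAlgebra.mul_assoc'
  one_mul x := by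
    induction x using PathAlgebra.induction_on with
    | h0 => simp
    | ha x x' hx hx' => simp only [mul_add, hx, hx']
    | hs c x hx => simp only [mul_smul_comm, hx]
    | hp i j p =>
    rw [one_eq, Finset.sum_mul, Finset.sum_eq_single i]
    · simp [vertex, ofPath_mul_ofPath]
    · intro b _ hb
      exact ofPath_mul_ofPath_of_ne _ _ hb.symm
    · simp
  mul_one x := by
    induction x using PathAlgebra.induction_on with
    | h0 => simp
    | ha x x' hx hx' => simp only [add_mul, hx, hx']
    | hs c x hx => simp only [smul_mul_assoc, hx]
    | hp i j p =>
    rw [one_eq, Finset.mul_sum, Finset.sum_eq_single j]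
    · simp [vertex, ofPath_mul_ofPath]
    · intro b _ hb
      exact ofPath_mul_ofPath_of_ne _ _ hb
    · simp

instance : Algebra k (PathAlgebra k V) :=
  Algebra.ofModule (fun c x y => smul_mul_assoc c x y) (fun c x y => mul_smul_comm c x y)

end Basic

/-! #### The universal property of the path algebra -/

section Lift

variable {k V : Type*} [Field k] [Quiver V] [Fintype V]

/-- Images of the vertices and of the arrows under an algebra map out of `kQ`. -/
structure LiftData (V : Type*) [Quiver V] [Fintype V] (A : Type*) [Ring A] where
  e : V → A
  a : ∀ {i j : V}, (i ⟶ j) → A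
  e_mul_self : ∀ i, e i * e i = e i
  e_mul_of_ne : ∀ i j, i ≠ j → e i * e j = 0
  sum_e : ∑ i, e i = 1
  e_mul_a : ∀ {i j : V} (f : i ⟶ j), e i * a f = a f
  a_mul_e : ∀ {i j : V} (f : i ⟶ j), a f * e j = a f

variable {A : Type*} [Ring A] [Algebra k A] (D : LiftData V A)

/-- The image of a path. -/
def LiftData.path {i : V} : ∀ {j : V}, Quiver.Path i j → A
  | _, .nil => D.e i
  | _, .cons p f => LiftData.path p * D.a f

theorem LiftData.e_mul_path {i j : V} (p : Quiver.Path i j) : D.e i * D.path p = D.path p := by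
  induction p with
  | nil => exact D.e_mul_self i
  | cons p f ih => rw [LiftData.path, ← mul_assoc, ih]

theorem LiftData.path_mul_e {i j : V} (p : Quiver.Path i j) : D.path p * D.e j = D.path p := by
  cases p with
  | nil => exact D.e_mul_self i
  | cons p f => rw [LiftData.path, mul_assoc, D.a_mul_e]

theorem LiftData.path_comp {i j l : V} (p : Quiver.Path i j) (q : Quiver.Path j l) :
    D.path (p.comp q) = D.path p * D.path q := by
  induction q with
  | nil => exact (D.path_mul_e p).symm
  | cons q f ih => rw [Quiver.Path.comp_cons, LiftData.path, LiftData.path, ih, mul_assoc]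

variable (k) in
/-- The linear extension of `LiftData.path`. -/
def LiftData.lin : PathAlgebra k V →ₗ[k] A :=
  Finsupp.lsum k fun p => LinearMap.toSpanSingleton k _ (D.path p.2.2)

theorem LiftData.lin_ofPath {i j : V} (p : Quiver.Path i j) :
    D.lin k (ofPath k p) = D.path p := by
  unfold LiftData.lin ofPath
  erw [Finsupp.lsum_single, LinearMap.toSpanSingleton_apply, one_smul]

variable (k) in
/-- The algebra map out of `kQ` with prescribed values on vertices and arrows. -/
def lift : PathAlgebra k V →ₐ[k] A :=
  AlgHom.ofLinearMap (D.lin k)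
    (by
      simp only [one_eq, vertex, map_sum, LiftData.lin_ofPath, LiftData.path]
      exact D.sum_e)
    (by
      intro x y
      induction x using PathAlgebra.induction_on with
      | h0 => simp
      | ha x x' hx hx' => simp only [add_mul, map_add, hx, hx']
      | hs c x hx => simp only [smul_mul_assoc, map_smul, hx]
      | hp i j p =>
      induction y using PathAlgebra.induction_on with
      | h0 => simp
      | ha x x' hx hx' => simp only [mul_add, map_add, hx, hx']
      | hs c x hx => simp only [mul_smul_comm, map_smul, hx]
      | hp i' j' q =>
      by_cases h : i' = j
      · subst h
        simp only [ofPath_mul_ofPath, LiftData.lin_ofPath, LiftData.path_comp]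
      · rw [ofPath_mul_ofPath_of_ne _ _ h, map_zero, D.lin_ofPath, D.lin_ofPath,
          ← D.path_mul_e p, ← D.e_mul_path q, mul_assoc, ← mul_assoc (D.e j),
          D.e_mul_of_ne _ _ (Ne.symm h), zero_mul, mul_zero])

@[simp] theorem lift_vertex (i : V) : lift k D (vertex k i) = D.e i :=
  D.lin_ofPath _

@[simp] theorem lift_arrow {i j : V} (f : i ⟶ j) : lift k D (arrow k f) = D.a f :=
  (D.lin_ofPath _).trans (by
    simp only [Quiver.Hom.toPath, LiftData.path]; exact D.e_mul_a f)

theorem algHom_ext {f g : PathAlgebra k V →ₐ[k] A} (hv : ∀ i, f (vertex k i) = g (vertex k i))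
    (ha : ∀ (i j : V) (a : i ⟶ j), f (arrow k a) = g (arrow k a)) : f = g := by
  refine AlgHom.toLinearMap_injective (linearMap_ext fun i j p => ?_)
  induction p with
  | nil => exact hv i
  | cons p a ih =>
    have : ofPath k (p.cons a) = ofPath k p * arrow k a := by
      rw [arrow, ofPath_mul_ofPath]; rfl
    simp only [AlgHom.toLinearMap_apply] at ih ⊢
    rw [this, map_mul, map_mul, ih, ha]

end Lift

/-- The homogeneous piece of degree `d` of `kQ` when the arrows carry the degrees `w`. -/
def piece (k : Type*) {V : Type*} [Field k] [Quiver V]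
    (w : ∀ {i j : V}, (i ⟶ j) → ℕ) (d : ℕ) : Submodule k (PathAlgebra k V) :=
  Submodule.span k {x | ∃ (i j : V) (p : Quiver.Path i j), p.addWeight w = d ∧ x = ofPath k p}

end PathAlgebra

/-! ### Preprojective algebras -/

section Preprojective

variable (k : Type*) (V : Type*) [Field k] [Quiver V] [Fintype V]
  [∀ i j : V, Fintype (i ⟶ j)]

instance : Fintype (Quiver.Symmetrify V) := inferInstanceAs (Fintype V)

/-- The nonstar arrow of the double quiver given by an arrow `a` of `Q`. -/
def nonstarArrow {V : Type*} [Quiver V] [Fintype V] {i j : V} (a : i ⟶ j) :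
    PathAlgebra k (Quiver.Symmetrify V) :=
  PathAlgebra.arrow k (V := Quiver.Symmetrify V) (i := i) (j := j) (Sum.inl a)

/-- The star arrow `a^*` of the double quiver given by an arrow `a` of `Q`. -/
def starArrow {V : Type*} [Quiver V] [Fintype V] {i j : V} (a : i ⟶ j) :
    PathAlgebra k (Quiver.Symmetrify V) :=
  PathAlgebra.arrow k (V := Quiver.Symmetrify V) (i := j) (j := i) (Sum.inr a)

/-- The preprojective relation `Ω = ∑ a a^* - a^* a`, the sum over all arrows `a` of `Q`. -/
def preprojectiveRelation : PathAlgebra k (Quiver.Symmetrify V) :=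
  ∑ i : V, ∑ j : V, ∑ a : (i ⟶ j), (nonstarArrow k a * starArrow k a - starArrow k a * nonstarArrow k a)

/-- The relation `Ω = 0`. -/
inductive PreprojectiveRel : PathAlgebra k (Quiver.Symmetrify V) →
    PathAlgebra k (Quiver.Symmetrify V) → Prop
  | omega : PreprojectiveRel (preprojectiveRelation k V) 0

/-- The preprojective algebra: the path algebra of the double quiver modulo the two-sided ideal
generated by `Ω`. -/
def PreprojectiveAlgebra := RingQuot (PreprojectiveRel k V)

instance : Ring (PreprojectiveAlgebra k V) :=
  inferInstanceAs (Ring (RingQuot (PreprojectiveRel k V)))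

instance : Algebra k (PreprojectiveAlgebra k V) :=
  inferInstanceAs (Algebra k (RingQuot (PreprojectiveRel k V)))

/-- The quotient map. -/
def PreprojectiveAlgebra.mk :
    PathAlgebra k (Quiver.Symmetrify V) →ₐ[k] PreprojectiveAlgebra k V :=
  RingQuot.mkAlgHom k (PreprojectiveRel k V)

variable {k V} in
/-- The algebra map out of the preprojective algebra with prescribed values on vertices and
arrows. -/
def PreprojectiveAlgebra.lift {A : Type*} [Ring A] [Algebra k A]
    (D : PathAlgebra.LiftData (Quiver.Symmetrify V) A)
    (h : PathAlgebra.lift k D (preprojectiveRelation k V) = 0) :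
    PreprojectiveAlgebra k V →ₐ[k] A :=
  RingQuot.liftAlgHom k ⟨PathAlgebra.lift k D, by
    rintro _ _ ⟨⟩
    rw [h, map_zero]⟩

variable {k V} in
theorem PreprojectiveAlgebra.lift_mk {A : Type*} [Ring A] [Algebra k A]
    (D : PathAlgebra.LiftData (Quiver.Symmetrify V) A)
    (h : PathAlgebra.lift k D (preprojectiveRelation k V) = 0)
    (x : PathAlgebra k (Quiver.Symmetrify V)) :
    PreprojectiveAlgebra.lift D h (PreprojectiveAlgebra.mk k V x) = PathAlgebra.lift k D x :=
  RingQuot.liftAlgHom_mkAlgHom_apply _ _ _ _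

variable {k V} in
theorem PreprojectiveAlgebra.algHom_ext {A : Type*} [Ring A] [Algebra k A]
    {f g : PreprojectiveAlgebra k V →ₐ[k] A}
    (h : f.comp (PreprojectiveAlgebra.mk k V) = g.comp (PreprojectiveAlgebra.mk k V)) : f = g :=
  RingQuot.ringQuot_ext' k _ _ h

theorem PreprojectiveAlgebra.mk_relation :
    PreprojectiveAlgebra.mk k V (preprojectiveRelation k V) = 0 :=
  (RingQuot.mkAlgHom_rel k (PreprojectiveRel.omega)).trans (map_zero _)

/-- The homogeneous piece of degree `d`, for the grading by path length. -/
def PreprojectiveAlgebra.piece (d : ℕ) : Submodule k (PreprojectiveAlgebra k V) :=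
  (PathAlgebra.piece k (V := Quiver.Symmetrify V) (fun _ => 1) d).map
    (PreprojectiveAlgebra.mk k V).toLinearMap

end Preprojective

/-! ### The preprojective algebra of type `Ã` with `n` vertices -/

/-- The cyclically oriented quiver with vertices `ZMod n` and one arrow `i ⟶ i + 1` for each `i`. -/
abbrev CyclicQuiver (n : ℕ) := ZMod n

namespace CyclicQuiver

variable (n : ℕ)

instance : Quiver (CyclicQuiver n) := ⟨fun i j => PLift (j = i + 1)⟩
instance (i j : CyclicQuiver n) : Fintype (i ⟶ j) := inferInstanceAs (Fintype (PLift (j = i + 1)))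

/-- The arrow `i ⟶ i + 1`. -/
def arrow (i : CyclicQuiver n) : i ⟶ i + 1 := PLift.up rfl

variable [NeZero n]

/-- The vertices with even index (for `n` even this does not depend on representatives). -/
def evenVertices : Finset (CyclicQuiver n) :=
  Finset.univ.filter fun i => Even (i.val)

/-- The vertices with odd index. -/
def oddVertices : Finset (CyclicQuiver n) :=
  Finset.univ.filter fun i => Odd (i.val)

/-- The set of the vertices whose index has the parity of `i`. -/
def parityClass (i : CyclicQuiver n) : Finset (CyclicQuiver n) :=
  if Even (i.val) then evenVertices n else oddVertices n

end CyclicQuiver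

/-- The preprojective algebra `R` of type `Ã` on `n` vertices. -/
abbrev PiA (k : Type*) [Field k] (n : ℕ) [NeZero n] := PreprojectiveAlgebra k (CyclicQuiver n)

namespace PiA

variable (k : Type*) [Field k] {n : ℕ} [NeZero n]

/-- The idempotent `e_i`. -/
def e (i : CyclicQuiver n) : PiA k n :=
  PreprojectiveAlgebra.mk k _ (PathAlgebra.vertex k (V := Quiver.Symmetrify (CyclicQuiver n)) i)

/-- The nonstar arrow `α_i` from `e_i` to `e_{i+1}`. -/
def α (i : CyclicQuiver n) : PiA k n :=
  PreprojectiveAlgebra.mk k _ (nonstarArrow k (CyclicQuiver.arrow n i))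

/-- The star arrow `α_i^*` from `e_{i+1}` to `e_i`. -/
def αs (i : CyclicQuiver n) : PiA k n :=
  PreprojectiveAlgebra.mk k _ (starArrow k (CyclicQuiver.arrow n i))

theorem e_mul_self (i : CyclicQuiver n) : e k i * e k i = e k i :=
  ((PreprojectiveAlgebra.mk k _).map_mul _ _).symm.trans
    (congrArg _ (PathAlgebra.vertex_mul_vertex_self _))

theorem e_mul_of_ne {i j : CyclicQuiver n} (h : i ≠ j) : e k i * e k j = 0 :=
  (((PreprojectiveAlgebra.mk k (CyclicQuiver n)).map_mul _ _).symm.trans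
    (congrArg _ (PathAlgebra.vertex_mul_vertex_of_ne (V := Quiver.Symmetrify (CyclicQuiver n)) h))).trans
    (map_zero (PreprojectiveAlgebra.mk k (CyclicQuiver n)))

theorem sum_e : ∑ i : CyclicQuiver n, e k i = 1 :=
  (map_sum (PreprojectiveAlgebra.mk k (CyclicQuiver n)) _ _).symm.trans
    (map_one (PreprojectiveAlgebra.mk k (CyclicQuiver n)))

theorem e_mul_α (i : CyclicQuiver n) : e k i * α k i = α k i :=
  ((PreprojectiveAlgebra.mk k _).map_mul _ _).symm.trans
    (congrArg _ (PathAlgebra.vertex_mul_arrow _))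

theorem α_mul_e (i : CyclicQuiver n) : α k i * e k (i + 1) = α k i :=
  ((PreprojectiveAlgebra.mk k _).map_mul _ _).symm.trans
    (congrArg _ (PathAlgebra.arrow_mul_vertex _))

theorem e_mul_αs (i : CyclicQuiver n) : e k (i + 1) * αs k i = αs k i :=
  ((PreprojectiveAlgebra.mk k _).map_mul _ _).symm.trans
    (congrArg _ (PathAlgebra.vertex_mul_arrow _))

theorem αs_mul_e (i : CyclicQuiver n) : αs k i * e k i = αs k i :=
  ((PreprojectiveAlgebra.mk k _).map_mul _ _).symm.trans
    (congrArg _ (PathAlgebra.arrow_mul_vertex _))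

theorem sum_arrows {M : Type*} [AddCommMonoid M] (F : ∀ i j : CyclicQuiver n, (i ⟶ j) → M) :
    ∑ i, ∑ j, ∑ a, F i j a = ∑ i, F i (i + 1) (CyclicQuiver.arrow n i) := by
  refine Finset.sum_congr rfl fun i _ => ?_
  rw [Finset.sum_eq_single (i + 1)]
  · exact Fintype.sum_eq_single _ (fun a ha => (ha (Subsingleton.elim (α := PLift _) _ _)).elim)
  · intro j _ hj
    exact Finset.sum_eq_zero fun a _ => (hj a.down).elim
  · simp

theorem relation :
    ∑ i : CyclicQuiver n, (α k i * αs k i - αs k i * α k i) = 0 := by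
  have := PreprojectiveAlgebra.mk_relation k (CyclicQuiver n)
  rw [preprojectiveRelation, sum_arrows] at this
  simp only [map_sum, map_sub, map_mul] at this
  exact this

/-- Data for an algebra map `R → A` given by the images of the `e_i`, `α_i` and `α_i^*`. -/
def liftData {A : Type*} [Ring A] (E X Y : CyclicQuiver n → A)
    (h1 : ∀ i, E i * E i = E i) (h2 : ∀ i j, i ≠ j → E i * E j = 0) (h3 : ∑ i, E i = 1)
    (h4 : ∀ i, E i * X i = X i) (h5 : ∀ i, X i * E (i + 1) = X i)
    (h6 : ∀ i, E (i + 1) * Y i = Y i) (h7 : ∀ i, Y i * E i = Y i) :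
    PathAlgebra.LiftData (Quiver.Symmetrify (CyclicQuiver n)) A where
  e := E
  a {i j} f := Sum.elim (fun _ => X i) (fun _ => Y j) f
  e_mul_self := h1
  e_mul_of_ne := h2
  sum_e := h3
  e_mul_a {i j} f := by
    rcases f with f | f
    · exact h4 i
    · obtain rfl : i = ((show ZMod n from j) + 1 : ZMod n) := f.down
      exact h6 j
  a_mul_e {i j} f := by
    rcases f with f | f
    · obtain rfl : j = ((show ZMod n from i) + 1 : ZMod n) := f.down
      exact h5 i
    · exact h7 j

/-- The algebra map `R → A` with prescribed images of the `e_i`, `α_i` and `α_i^*`. -/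
def lift {A : Type*} [Ring A] [Algebra k A] (E X Y : CyclicQuiver n → A)
    (h1 : ∀ i, E i * E i = E i) (h2 : ∀ i j, i ≠ j → E i * E j = 0) (h3 : ∑ i, E i = 1)
    (h4 : ∀ i, E i * X i = X i) (h5 : ∀ i, X i * E (i + 1) = X i)
    (h6 : ∀ i, E (i + 1) * Y i = Y i) (h7 : ∀ i, Y i * E i = Y i)
    (h : ∑ i, (X i * Y i - Y i * X i) = 0) : PiA k n →ₐ[k] A :=
  PreprojectiveAlgebra.lift (liftData E X Y h1 h2 h3 h4 h5 h6 h7) (by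
    rw [preprojectiveRelation, sum_arrows]
    simp only [map_sum, map_sub, map_mul, nonstarArrow, starArrow]
    erw [← h]
    refine Finset.sum_congr rfl fun i _ => ?_
    erw [PathAlgebra.lift_arrow, PathAlgebra.lift_arrow]
    rfl)

section

variable {A : Type*} [Ring A] [Algebra k A] {E X Y : CyclicQuiver n → A}
    {h1 : ∀ i, E i * E i = E i} {h2 : ∀ i j, i ≠ j → E i * E j = 0} {h3 : ∑ i, E i = 1}
    {h4 : ∀ i, E i * X i = X i} {h5 : ∀ i, X i * E (i + 1) = X i}
    {h6 : ∀ i, E (i + 1) * Y i = Y i} {h7 : ∀ i, Y i * E i = Y i}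
    {h : ∑ i, (X i * Y i - Y i * X i) = 0}

@[simp] theorem lift_e (i : CyclicQuiver n) : lift k E X Y h1 h2 h3 h4 h5 h6 h7 h (e k i) = E i :=
  (PreprojectiveAlgebra.lift_mk _ _ _).trans (PathAlgebra.lift_vertex _ _)

@[simp] theorem lift_α (i : CyclicQuiver n) : lift k E X Y h1 h2 h3 h4 h5 h6 h7 h (α k i) = X i :=
  (PreprojectiveAlgebra.lift_mk _ _ _).trans (PathAlgebra.lift_arrow _ _)

@[simp] theorem lift_αs (i : CyclicQuiver n) :
    lift k E X Y h1 h2 h3 h4 h5 h6 h7 h (αs k i) = Y i :=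
  (PreprojectiveAlgebra.lift_mk _ _ _).trans (PathAlgebra.lift_arrow _ _)

end

variable {k} in
theorem algHom_ext {A : Type*} [Ring A] [Algebra k A] {f g : PiA k n →ₐ[k] A}
    (he : ∀ i, f (e k i) = g (e k i)) (hα : ∀ i, f (α k i) = g (α k i))
    (hαs : ∀ i, f (αs k i) = g (αs k i)) : f = g := by
  refine PreprojectiveAlgebra.algHom_ext (PathAlgebra.algHom_ext he ?_)
  rintro i j (f | f)
  · obtain rfl : j = ((show ZMod n from i) + 1 : ZMod n) := f.down
    exact hα i
  · obtain rfl : i = ((show ZMod n from j) + 1 : ZMod n) := f.down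
    exact hαs j

/-! #### The dihedral action -/

/-- The map `e_i ↦ e_{i+c}`, `α_i ↦ α_{i+c}`, `α_i^* ↦ α_{i+c}^*`. -/
def rotHom (c : CyclicQuiver n) : PiA k n →ₐ[k] PiA k n :=
  lift k (fun i => e k (i + c)) (fun i => α k (i + c)) (fun i => αs k (i + c))
    (fun i => e_mul_self k _) (fun i j h => e_mul_of_ne k (by simpa using h))
    ((Equiv.sum_comp (Equiv.addRight c) (e k)).trans (sum_e k))
    (fun i => e_mul_α k _)
    (fun i => by rw [add_right_comm]; exact α_mul_e k _)
    (fun i => by rw [add_right_comm]; exact e_mul_αs k _)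
    (fun i => αs_mul_e k _)
    ((Equiv.sum_comp (Equiv.addRight c) (fun i => α k i * αs k i - αs k i * α k i)).trans
      (relation k))

@[simp] theorem rotHom_e (c i : CyclicQuiver n) : rotHom k c (e k i) = e k (i + c) := lift_e k i
@[simp] theorem rotHom_α (c i : CyclicQuiver n) : rotHom k c (α k i) = α k (i + c) := lift_α k i
@[simp] theorem rotHom_αs (c i : CyclicQuiver n) : rotHom k c (αs k i) = αs k (i + c) :=
  lift_αs k i

/-- The map `e_i ↦ e_{-i}`, `α_i ↦ α_{-i-1}^*`, `α_i^* ↦ α_{-i-1}`. -/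
def reflHom : PiA k n →ₐ[k] PiA k n :=
  lift k (fun i => e k (-i)) (fun i => αs k (-i - 1)) (fun i => α k (-i - 1))
    (fun i => e_mul_self k _) (fun i j h => e_mul_of_ne k (by simpa using h))
    ((Equiv.sum_comp (Equiv.neg _) (e k)).trans (sum_e k))
    (fun i => by have := e_mul_αs k (-i - 1); rwa [sub_add_cancel] at this)
    (fun i => by rw [neg_add, ← sub_eq_add_neg]; exact αs_mul_e k _)
    (fun i => by rw [neg_add, ← sub_eq_add_neg]; exact e_mul_α k _)
    (fun i => by have := α_mul_e k (-i - 1); rwa [sub_add_cancel] at this)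
    (by
      have := (Equiv.sum_comp ((Equiv.neg (CyclicQuiver n)).trans (Equiv.subRight 1))
        (fun i => α k i * αs k i - αs k i * α k i)).trans (relation k)
      rw [← neg_eq_zero, ← Finset.sum_neg_distrib]
      simpa using this)

@[simp] theorem reflHom_e (i : CyclicQuiver n) : reflHom k (e k i) = e k (-i) := lift_e k i
@[simp] theorem reflHom_α (i : CyclicQuiver n) : reflHom k (α k i) = αs k (-i - 1) := lift_α k i
@[simp] theorem reflHom_αs (i : CyclicQuiver n) : reflHom k (αs k i) = α k (-i - 1) := lift_αs k i

variable (n)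

/-- The rotation `ρ`: `e_i ↦ e_{i+1}`, `α_i ↦ α_{i+1}`, `α_i^* ↦ α_{i+1}^*`. -/
def rho : PiA k n ≃ₐ[k] PiA k n :=
  AlgEquiv.ofAlgHom (rotHom k 1) (rotHom k (-1))
    (algHom_ext (by simp) (by simp) (by simp))
    (algHom_ext (by simp) (by simp) (by simp))

/-- The reflection `r`: `e_i ↦ e_{n-i}`, `α_i ↦ α_{n-i-1}^*`, `α_i^* ↦ α_{n-i-1}`. -/
def refl : PiA k n ≃ₐ[k] PiA k n :=
  AlgEquiv.ofAlgHom (reflHom k) (reflHom k)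
    (algHom_ext (by simp) (by simp) (by simp))
    (algHom_ext (by simp) (by simp) (by simp))

@[simp] theorem rho_e (i : CyclicQuiver n) : rho k n (e k i) = e k (i + 1) := rotHom_e k 1 i
@[simp] theorem rho_α (i : CyclicQuiver n) : rho k n (α k i) = α k (i + 1) := rotHom_α k 1 i
@[simp] theorem rho_αs (i : CyclicQuiver n) : rho k n (αs k i) = αs k (i + 1) := rotHom_αs k 1 i
@[simp] theorem refl_e (i : CyclicQuiver n) : refl k n (e k i) = e k (-i) := reflHom_e k i
@[simp] theorem refl_α (i : CyclicQuiver n) : refl k n (α k i) = αs k (-i - 1) := reflHom_α k i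
@[simp] theorem refl_αs (i : CyclicQuiver n) : refl k n (αs k i) = α k (-i - 1) := reflHom_αs k i

/-- The dihedral group `D_n = ⟨ρ, r⟩`, as a group of automorphisms of `R`. -/
def dihedral : Subgroup (PiA k n ≃ₐ[k] PiA k n) := Subgroup.closure {rho k n, refl k n}

/-- The subgroup `W_n` generated by the elements of `D_n` that fix a vertex. -/
def W : Subgroup (PiA k n ≃ₐ[k] PiA k n) :=
  Subgroup.closure {τ | τ ∈ dihedral k n ∧ ∃ i : CyclicQuiver n, τ (e k i) = e k i}

end PiA

/-! ### The Auslander map -/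

section Auslander

variable (k R : Type*) [Field k] [Ring R] [Algebra k R] (G : Subgroup (R ≃ₐ[k] R))

/-- The fixed ring `R^G`. -/
abbrev fixedRing : Subalgebra k R := FixedPoints.subalgebra k R G

/-- `End_{R^G} R`, the endomorphisms of `R` as a right `R^G`-module. A right `R^G`-module is a left
module over the opposite ring of `R^G`, here a subalgebra of `Rᵐᵒᵖ`. -/
abbrev RightEnd := Module.End (fixedRing k R G).op R

/-- Left multiplication by an element of `R`. -/
def leftMul : R →ₐ[k] RightEnd k R G where
  toFun a :=
    { toFun := fun b => a * b
      map_add' := fun x y => mul_add a x y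
      map_smul' := fun s x => (mul_assoc a x _).symm }
  map_one' := by ext; simp
  map_mul' a b := by ext; simp [mul_assoc]
  map_zero' := by ext; simp
  map_add' a b := by ext; simp [add_mul]
  commutes' c := by ext; simp [Algebra.algebraMap_eq_smul_one]

/-- The action of an element of `G`. -/
def actEnd : G →* RightEnd k R G where
  toFun g :=
    { toFun := fun b => g • b
      map_add' := fun x y => smul_add g x y
      map_smul' := fun s x => by
        have hs : g • (MulOpposite.unop (s : Rᵐᵒᵖ)) = MulOpposite.unop (s : Rᵐᵒᵖ) := s.2 g
        change g • (x * MulOpposite.unop (s : Rᵐᵒᵖ)) = (g • x) * MulOpposite.unop (s : Rᵐᵒᵖ)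
        rw [smul_mul', hs] }
  map_one' := by ext; simp
  map_mul' a b := by ext; simp [mul_smul]

/-- The Auslander map `R # G → End_{R^G} R`, `a # g ↦ (b ↦ a g(b))`. -/
def auslanderMap : SkewMonoidAlgebra R G →ₐ[k] RightEnd k R G :=
  SkewMonoidAlgebra.liftNCAlgHom (leftMul k R G) (actEnd k R G) (by
    intro x y
    ext b
    exact (smul_mul' y x b).symm)

theorem auslanderMap_single (a : R) (g : G) (b : R) :
    auslanderMap k R G (SkewMonoidAlgebra.single g a) b = a * (g : R ≃ₐ[k] R) b := by
  exact congrArg (fun f : RightEnd k R G => f b) (SkewMonoidAlgebra.liftNC_single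
    ((leftMul k R G : R →+* RightEnd k R G) : R →+ RightEnd k R G) (actEnd k R G) g a)

end Auslander

/-! ### Twisted Calabi–Yau algebras -/

section CalabiYau

open CategoryTheory

universe u

variable (k A : Type u) [Field k] [Ring A] [Algebra k A]

/-- `A` as a module over its enveloping algebra: `(a ⊗ b) • x = a x b`. -/
def diagonalBimodule : ModuleCat.{u} (A ⊗[k] Aᵐᵒᵖ) :=
  letI := instModuleTensorProductMop k A
  ModuleCat.of (A ⊗[k] Aᵐᵒᵖ) A

/-- The enveloping algebra as a left module over itself. -/
def envelopingModule : ModuleCat.{u} (A ⊗[k] Aᵐᵒᵖ) := ModuleCat.of (A ⊗[k] Aᵐᵒᵖ) (A ⊗[k] Aᵐᵒᵖ)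

/-- Right multiplication by `w`, an endomorphism of the left module `A ⊗ Aᵐᵒᵖ`. -/
def rightMulEnveloping (w : A ⊗[k] Aᵐᵒᵖ) : envelopingModule k A ⟶ envelopingModule k A :=
  ModuleCat.ofHom (LinearMap.toSpanSingleton (A ⊗[k] Aᵐᵒᵖ) (A ⊗[k] Aᵐᵒᵖ) w)

/-- `A` is homologically smooth: it has a resolution of finite length by finitely generated
projective modules over its enveloping algebra. -/
def IsHomologicallySmooth : Prop :=
  ∃ P : ProjectiveResolution (diagonalBimodule k A),
    (∀ i, Module.Finite (A ⊗[k] Aᵐᵒᵖ) (P.complex.X i)) ∧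
      ∃ N, ∀ i, N < i → Limits.IsZero (P.complex.X i)

/-- `A` is twisted Calabi–Yau of dimension `d` with Nakayama automorphism `μ`: it is homologically
smooth, `Ext^i(A, A ⊗ Aᵐᵒᵖ) = 0` for `i ≠ d`, and `Ext^d(A, A ⊗ Aᵐᵒᵖ)` is isomorphic, as a
bimodule, to `A` with the right action twisted by `μ`. (The bimodule structure `b · ξ · a` on `Ext`
comes from right multiplication by `a ⊗ b` on `A ⊗ Aᵐᵒᵖ`.) -/
def IsTwistedCalabiYau (d : ℕ) (μ : A ≃ₐ[k] A) : Prop :=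
  IsHomologicallySmooth k A ∧
  (∀ i, i ≠ d → Subsingleton (Abelian.Ext (diagonalBimodule k A) (envelopingModule k A) i)) ∧
  ∃ φ : Abelian.Ext (diagonalBimodule k A) (envelopingModule k A) d ≃+ A,
    ∀ (ξ : Abelian.Ext (diagonalBimodule k A) (envelopingModule k A) d) (a b : A),
      φ (ξ.comp (Abelian.Ext.mk₀ (rightMulEnveloping k A (a ⊗ₜ MulOpposite.op b))) (add_zero d)) =
        b * φ ξ * μ a

end CalabiYau

/-! ### The two-vertex algebra `kQ/(v₁u₁ - u₁v₂, v₂u₂ - u₂v₁)` -/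

/-- The two vertices. -/
inductive TwoVertex
  | one
  | two

instance : Fintype TwoVertex :=
  ⟨⟨{TwoVertex.one, TwoVertex.two}, by simp⟩, by rintro (_ | _) <;> simp⟩

/-- The arrows `u₁ : 1 → 2`, `u₂ : 2 → 1` and the loops `v₁`, `v₂` at `1` and `2`. -/
inductive TwoVertexArrow : TwoVertex → TwoVertex → Type
  | u₁ : TwoVertexArrow .one .two
  | u₂ : TwoVertexArrow .two .one
  | v₁ : TwoVertexArrow .one .one
  | v₂ : TwoVertexArrow .two .two

instance : Quiver TwoVertex := ⟨TwoVertexArrow⟩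

/-- The degrees of the arrows: `1` for `u₁`, `u₂` and `2` for `v₁`, `v₂`. -/
def TwoVertexArrow.degree : ∀ {i j : TwoVertex}, (i ⟶ j) → ℕ
  | _, _, .u₁ => 1
  | _, _, .u₂ => 1
  | _, _, .v₁ => 2
  | _, _, .v₂ => 2

section TwoVertexAlgebra

variable (k : Type*) [Field k]

/-- The arrow `u₁ : 1 → 2` in the path algebra. -/
def pathU₁ : PathAlgebra k TwoVertex := PathAlgebra.arrow k (i := .one) (j := .two) .u₁
/-- The arrow `u₂ : 2 → 1` in the path algebra. -/
def pathU₂ : PathAlgebra k TwoVertex := PathAlgebra.arrow k (i := .two) (j := .one) .u₂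
/-- The loop `v₁` at `1` in the path algebra. -/
def pathV₁ : PathAlgebra k TwoVertex := PathAlgebra.arrow k (i := .one) (j := .one) .v₁
/-- The loop `v₂` at `2` in the path algebra. -/
def pathV₂ : PathAlgebra k TwoVertex := PathAlgebra.arrow k (i := .two) (j := .two) .v₂

/-- The two defining relations. -/
inductive TwoVertexRel : PathAlgebra k TwoVertex → PathAlgebra k TwoVertex → Prop
  | rel₁ : TwoVertexRel (pathV₁ k * pathU₁ k - pathU₁ k * pathV₂ k) 0
  | rel₂ : TwoVertexRel (pathV₂ k * pathU₂ k - pathU₂ k * pathV₁ k) 0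

/-- The quotient of the path algebra by the two-sided ideal generated by
`v₁u₁ - u₁v₂` and `v₂u₂ - u₂v₁`. -/
def TwoVertexAlgebra := RingQuot (TwoVertexRel k)

namespace TwoVertexAlgebra

instance : Ring (TwoVertexAlgebra k) := inferInstanceAs (Ring (RingQuot (TwoVertexRel k)))

instance : Algebra k (TwoVertexAlgebra k) :=
  inferInstanceAs (Algebra k (RingQuot (TwoVertexRel k)))

/-- The quotient map. -/
def mk : PathAlgebra k TwoVertex →ₐ[k] TwoVertexAlgebra k := RingQuot.mkAlgHom k (TwoVertexRel k)

/-- The trivial path at the vertex `1`. -/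
def f₁ : TwoVertexAlgebra k := mk k (PathAlgebra.vertex k .one)
/-- The trivial path at the vertex `2`. -/
def f₂ : TwoVertexAlgebra k := mk k (PathAlgebra.vertex k .two)
/-- The class of `u₁`. -/
def u₁ : TwoVertexAlgebra k := mk k (pathU₁ k)
/-- The class of `u₂`. -/
def u₂ : TwoVertexAlgebra k := mk k (pathU₂ k)
/-- The class of `v₁`. -/
def v₁ : TwoVertexAlgebra k := mk k (pathV₁ k)
/-- The class of `v₂`. -/
def v₂ : TwoVertexAlgebra k := mk k (pathV₂ k)

/-- The homogeneous piece of degree `d`, where the `u`'s have degree `1` and the `v`'s degree `2`. -/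
def piece (d : ℕ) : Submodule k (TwoVertexAlgebra k) :=
  (PathAlgebra.piece k (V := TwoVertex) TwoVertexArrow.degree d).map (mk k).toLinearMap

end TwoVertexAlgebra

end TwoVertexAlgebra

/-! ### Orbit sums -/

namespace PiA

variable (k : Type*) [Field k] {n : ℕ} [NeZero n]

/-- The sum of the trivial paths that start in `S`. -/
def sumZero (S : Finset (CyclicQuiver n)) : PiA k n := ∑ i ∈ S, e k i

/-- The sum of the arrows of the double quiver that start in `S`. -/
def sumOne (S : Finset (CyclicQuiver n)) : PiA k n := ∑ i ∈ S, (α k i + αs k (i - 1))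

/-- The sum of the paths `α_i α_{i+1}` and `α_{i-1}^* α_{i-2}^*` that start in `S`. -/
def sumTwo (S : Finset (CyclicQuiver n)) : PiA k n :=
  ∑ i ∈ S, (α k i * α k (i + 1) + αs k (i - 1) * αs k (i - 2))

end PiA

end

/-! Put `x = ∑ α_i` and `y = ∑ α_i^*`. The preprojective relation says exactly that `x` and `y`
commute, so `R` is a sum of copies `e_i k[x, y]`, with `e_i x = x e_{i+1}` and `e_i y = y e_{i-1}`.
An element of `R` is therefore a tuple of polynomials indexed by the vertices. Independence of the
monomials comes from an explicit action on such tuples (`PBWData`). The same device handles the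
two-vertex algebra `A`, with variables `u = u₁ + u₂` and `v = v₁ + v₂`, and its enveloping algebra,
with four commuting variables and four idempotents.

In coordinates a rotation shifts the vertices, and the reflection `r` sends `i` to `-i` and
exchanges the variables. Since `W_n` is generated by the reflections `ρ^{2j} r`, the fixed elements
are the tuples of symmetric polynomials of period two (`mem_fixedRing_iff`). These are pairs of
symmetric polynomials, and symmetric polynomials are freely generated by the power sums `x + y` and
`x² + y²`, the images of `u` and `v`; this gives `A ≅ R^{W_n}`. The splitting of `k[x, y]` into
symmetric polynomials and `x` times symmetric polynomials, applied at every vertex, gives the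
decomposition of `R` and its basis over the fixed ring.

The map that kills the basis elements `e_i + e_{i+1}` and sends `α_i + α_{i+1}` to `e_i + e_{i+1}`
has degree `-1`. The group acts by graded automorphisms and `R` lives in nonnegative degrees, so the
image of the Auslander map never lowers degrees; hence the Auslander map is not surjective.

For the Calabi–Yau property let `D = u ⊗ 1 - 1 ⊗ u` and `F = v ⊗ 1 - 1 ⊗ v`, and let `ε` and `ε'` be
the idempotents `envDiag` and `envAnti`, whose sum is `1`. Right multiplication by `D` and `F` is,
in coordinates, multiplication by a regular sequence, so there is a Koszul resolution `0 → A^e ε' →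
A^e → A^e ε → A → 0`. The middle term is `A^e ε' ⊕ A^e ε` because `D` interchanges the two
idempotents while `F` preserves them. The antiautomorphism `a ⊗ b ↦ b ⊗ μ(a)` maps `D` and `F` to
their negatives and exchanges `ε` with `ε'`. It thus carries the dual complex to the resolution, up
to signs, which makes the complex self-dual and introduces the twist by `μ`. -/

noncomputable section

/-! ### Projective resolutions of length two and the Ext groups they compute -/

section LengthTwo

open CategoryTheory Limits ZeroObject

universe w v u

variable {C : Type u} [Category.{v} C] [Abelian C]

/-- A resolution `0 ⟶ P₂ ⟶ P₁ ⟶ P₀ ⟶ Z ⟶ 0` of an object by projective objects. -/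
structure LengthTwoResolution (Z : C) where
  P₀ : C
  P₁ : C
  P₂ : C
  d₁ : P₁ ⟶ P₀
  d₂ : P₂ ⟶ P₁
  π : P₀ ⟶ Z
  zero₁ : d₂ ≫ d₁ = 0
  zero₀ : d₁ ≫ π = 0
  mono : Mono d₂
  exact₁ : (ShortComplex.mk d₂ d₁ zero₁).Exact
  exact₀ : (ShortComplex.mk d₁ π zero₀).Exact
  epi : Epi π
  proj₀ : Projective P₀
  proj₁ : Projective P₁
  proj₂ : Projective P₂

namespace LengthTwoResolution

variable {Z : C} (Q : LengthTwoResolution Z)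

/-- The terms of the resolution, continued by zero. -/
def obj : ℕ → C
  | 0 => Q.P₀
  | 1 => Q.P₁
  | 2 => Q.P₂
  | _ + 3 => 0

/-- The differentials of the resolution, continued by zero. -/
def diff : ∀ i : ℕ, Q.obj (i + 1) ⟶ Q.obj i
  | 0 => Q.d₁
  | 1 => Q.d₂
  | _ + 2 => 0

theorem diff_comp_diff : ∀ i : ℕ, Q.diff (i + 1) ≫ Q.diff i = 0
  | 0 => Q.zero₁
  | _ + 1 => zero_comp

/-- The resolution as a chain complex. -/
def complex : ChainComplex C ℕ := ChainComplex.of Q.obj Q.diff Q.diff_comp_diff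

theorem complex_d (i : ℕ) : Q.complex.d (i + 1) i = Q.diff i := ChainComplex.of_d ..

theorem complex_exactAt_succ (i : ℕ) : Q.complex.ExactAt (i + 1) := by
  rw [HomologicalComplex.exactAt_iff' _ (i + 1 + 1) (i + 1) i (by simp) (by simp)]
  have h : (ShortComplex.mk (Q.diff (i + 1)) (Q.diff i) (Q.diff_comp_diff i)).Exact := by
    match i with
    | 0 => exact Q.exact₁
    -- At the last nonzero term the incoming differential is zero, so exactness amounts to `d₂`
    -- being a monomorphism.
    | 1 => exact (ShortComplex.exact_iff_mono _ rfl).2 Q.mono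
    | i + 2 => exact ShortComplex.exact_of_isZero_X₂ _ (isZero_zero C)
  refine (ShortComplex.exact_iff_of_iso ?_).2 h
  exact ShortComplex.isoMk (Iso.refl _) (Iso.refl _) (Iso.refl _)
    (((Category.id_comp _).trans (Q.complex_d _).symm).trans (Category.comp_id _).symm)
    (((Category.id_comp _).trans (Q.complex_d _).symm).trans (Category.comp_id _).symm)

/-- The resolution as a projective resolution. -/
def toProjectiveResolution : ProjectiveResolution Z where
  complex := Q.complex
  projective n := by
    match n with
    | 0 => exact Q.proj₀
    | 1 => exact Q.proj₁
    | 2 => exact Q.proj₂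
    | n + 3 => exact (isZero_zero C).projective
  π := (ChainComplex.toSingle₀Equiv _ _).symm ⟨Q.π, by
    rw [complex_d]; exact Q.zero₀⟩
  quasiIso := ⟨fun n => by
    cases n
    · rw [ChainComplex.quasiIsoAt₀_iff, ShortComplex.quasiIso_iff_of_zeros']
      · refine (ShortComplex.exact_and_epi_g_iff_of_iso ?_).2 ⟨Q.exact₀, Q.epi⟩
        refine ShortComplex.isoMk (Iso.refl _) (Iso.refl _) (Iso.refl _) ?_ ?_
        · exact ((Category.id_comp _).trans (Q.complex_d 0).symm).trans (Category.comp_id _).symm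
        · refine (Category.id_comp _).trans (Eq.trans ?_ (Category.comp_id _).symm)
          exact (ChainComplex.toSingle₀Equiv_symm_apply_f_zero (C := Q.complex) Q.π _).symm
      all_goals rfl
    · rw [quasiIsoAt_iff_exactAt']
      · apply complex_exactAt_succ
      · apply ChainComplex.exactAt_succ_single_obj⟩

theorem isZero_complex_X (i : ℕ) (hi : 2 < i) :
    IsZero (Q.toProjectiveResolution.complex.X i) := by
  obtain ⟨j, rfl⟩ := Nat.exists_eq_add_of_lt hi
  rw [show 2 + j + 1 = j + 3 by omega]
  exact isZero_zero C

variable [HasExt.{w} C] {Y : C}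

open Abelian

theorem subsingleton_ext_of_gt (Q : LengthTwoResolution Z) (i : ℕ) (hi : 2 < i) :
    Subsingleton (Ext Z Y i) := by
  refine subsingleton_of_forall_eq 0 fun ξ => ?_
  obtain ⟨f, hf, rfl⟩ := Q.toProjectiveResolution.extMk_surjective ξ (i + 1) rfl
  obtain rfl : f = 0 := (Q.isZero_complex_X i hi).eq_of_src _ _
  exact Q.toProjectiveResolution.extMk_zero _ _

/-- In degree zero there are no coboundaries, so vanishing is the injectivity of precomposition with
`d₁`. -/
theorem subsingleton_ext_zero (h : ∀ f : Q.P₀ ⟶ Y, Q.d₁ ≫ f = 0 → f = 0) :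
    Subsingleton (Ext Z Y 0) := by
  refine subsingleton_of_forall_eq 0 fun ξ => ?_
  obtain ⟨f, hf, rfl⟩ := Q.toProjectiveResolution.extMk_surjective ξ 1 rfl
  obtain rfl : f = 0 := h f ((congrArg (· ≫ f) (Q.complex_d 0).symm).trans hf)
  exact Q.toProjectiveResolution.extMk_zero _ _

theorem subsingleton_ext_one
    (h : ∀ f : Q.P₁ ⟶ Y, Q.d₂ ≫ f = 0 → ∃ g : Q.P₀ ⟶ Y, Q.d₁ ≫ g = f) :
    Subsingleton (Ext Z Y 1) := by
  refine subsingleton_of_forall_eq 0 fun ξ => ?_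
  obtain ⟨f, hf, rfl⟩ := Q.toProjectiveResolution.extMk_surjective ξ 2 rfl
  obtain ⟨g, hg⟩ := h f ((congrArg (· ≫ f) (Q.complex_d 1).symm).trans hf)
  refine (Q.toProjectiveResolution.extMk_eq_zero_iff f 2 rfl hf 0 rfl).2 ⟨g, ?_⟩
  rw [← hg]
  exact congrArg (· ≫ g) (Q.complex_d 0)

/-- The class in `Ext²` of a morphism from the last term. -/
def extTwo (f : Q.P₂ ⟶ Y) : Ext Z Y 2 :=
  Q.toProjectiveResolution.extMk (n := 2) f 3 rfl
    -- The cocycle condition is automatic because the next term of the complex is zero.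
    ((Q.isZero_complex_X 3 (by norm_num)).eq_of_src _ _)

theorem extTwo_surjective (ξ : Ext Z Y 2) : ∃ f : Q.P₂ ⟶ Y, Q.extTwo f = ξ := by
  obtain ⟨f, hf, rfl⟩ := Q.toProjectiveResolution.extMk_surjective ξ 3 rfl
  exact ⟨f, rfl⟩

theorem extTwo_sub (f g : Q.P₂ ⟶ Y) : Q.extTwo (f - g) = Q.extTwo f - Q.extTwo g :=
  (Q.toProjectiveResolution.sub_extMk (n := 2) f g 3 rfl _ _).symm

theorem extTwo_add (f g : Q.P₂ ⟶ Y) : Q.extTwo (f + g) = Q.extTwo f + Q.extTwo g :=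
  (Q.toProjectiveResolution.add_extMk (n := 2) f g 3 rfl _ _).symm

theorem extTwo_eq_zero_iff (f : Q.P₂ ⟶ Y) :
    Q.extTwo f = 0 ↔ ∃ g : Q.P₁ ⟶ Y, Q.d₂ ≫ g = f := by
  refine (Q.toProjectiveResolution.extMk_eq_zero_iff (n := 2) f 3 rfl _ 1 rfl).trans ?_
  refine exists_congr fun g => ?_
  rw [← show Q.complex.d 2 1 ≫ g = Q.d₂ ≫ g from congrArg (· ≫ g) (Q.complex_d 1)]
  rfl

theorem extTwo_comp_mk₀ (f : Q.P₂ ⟶ Y) {Y' : C} (g : Y ⟶ Y') :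
    (Q.extTwo f).comp (Ext.mk₀ g) (add_zero 2) = Q.extTwo (f ≫ g) :=
  Q.toProjectiveResolution.extMk_comp_mk₀ (n := 2) f 3 rfl _ g

/-- `Ext²` computed as the cokernel of `Hom(P₁, Y) → Hom(P₂, Y)`. -/
theorem exists_ext_two_equiv {M : Type*} [AddCommGroup M] (φ : (Q.P₂ ⟶ Y) →+ M)
    (hsurj : Function.Surjective φ)
    (hker : ∀ f, φ f = 0 ↔ ∃ g : Q.P₁ ⟶ Y, Q.d₂ ≫ g = f) :
    ∃ ψ : Ext Z Y 2 ≃+ M, ∀ f, ψ (Q.extTwo f) = φ f := by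
  -- The section `s` need not be additive, but `φ ∘ s` is, because `φ` and `extTwo` have the same
  -- fibres.
  choose s hs using Q.extTwo_surjective (Y := Y)
  have key : ∀ f g : Q.P₂ ⟶ Y, Q.extTwo f = Q.extTwo g ↔ φ f = φ g := fun f g => by
    rw [← sub_eq_zero, ← extTwo_sub, extTwo_eq_zero_iff, ← hker, map_sub, sub_eq_zero]
  have hψ : ∀ f, φ (s (Q.extTwo f)) = φ f := fun f => (key _ _).1 (hs _)
  let ψ : Ext Z Y 2 →+ M := AddMonoidHom.mk' (fun ξ => φ (s ξ)) fun ξ η => by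
    rw [← map_add]
    exact (key _ _).1 (by rw [extTwo_add, hs, hs, hs])
  refine ⟨AddEquiv.ofBijective ψ ⟨fun ξ η h => ?_, fun m => ?_⟩, hψ⟩
  · rw [← hs ξ, ← hs η]
    exact (key _ _).2 h
  · obtain ⟨f, rfl⟩ := hsurj m
    exact ⟨Q.extTwo f, hψ f⟩

end LengthTwoResolution

end LengthTwo

/-! ### Algebras with a basis of monomials -/

section ModelOperators

variable (k : Type*) {V T : Type*} [Field k] [CommRing T] [Algebra k T]

/-- The operator on `V → T` that permutes the vertices by `τ` and multiplies by `p`. -/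
def shiftOp (p : T) (τ : Equiv.Perm V) : Module.End k (V → T) :=
  LinearMap.pi fun i => LinearMap.mulLeft k p ∘ₗ LinearMap.proj (τ i)

theorem shiftOp_apply (p : T) (τ : Equiv.Perm V) (w : V → T) (i : V) :
    shiftOp k p τ w i = p * w (τ i) := rfl

theorem shiftOp_mul_shiftOp (p q : T) (τ τ' : Equiv.Perm V) (h : Commute τ τ') :
    shiftOp k p τ * shiftOp k q τ' = shiftOp k q τ' * shiftOp k p τ := by
  ext w j : 2
  simp only [Module.End.mul_apply, shiftOp_apply]
  rw [← Equiv.Perm.mul_apply, ← Equiv.Perm.mul_apply, h.eq]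
  ring

variable [DecidableEq V]

/-- The projection of `V → T` to the functions supported at `i`. -/
def projOp (T : Type*) [CommRing T] [Algebra k T] (i : V) : Module.End k (V → T) :=
  LinearMap.single k _ i ∘ₗ LinearMap.proj i

theorem projOp_apply (i : V) (w : V → T) : projOp k T i w = Pi.single i (w i) := rfl

theorem projOp_mul_self (i : V) : projOp k T i * projOp k T i = projOp k T i := by
  ext w : 1
  rw [Module.End.mul_apply, projOp_apply, projOp_apply, Pi.single_eq_same]

theorem projOp_mul_of_ne (i j : V) (h : i ≠ j) : projOp k T i * projOp k T j = 0 := by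
  ext w : 1
  rw [Module.End.mul_apply, projOp_apply, projOp_apply, Pi.single_eq_of_ne h, Pi.single_zero]
  rfl

theorem sum_projOp [Fintype V] : ∑ i : V, projOp k T i = 1 := by
  refine LinearMap.ext fun w => ?_
  rw [LinearMap.sum_apply]
  exact Finset.univ_sum_single w

theorem projOp_mul_shiftOp (i : V) (p : T) (τ : Equiv.Perm V) :
    projOp k T i * shiftOp k p τ = shiftOp k p τ * projOp k T (τ i) := by
  ext w j : 2
  simp only [Module.End.mul_apply, projOp_apply, shiftOp_apply, Pi.single_apply,
    τ.injective.eq_iff]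
  split_ifs <;> simp

end ModelOperators

open MvPolynomial in
/-- An algebra `R` with a complete family of orthogonal idempotents `e i` and commuting elements
`x j` that generate it, subject to `e i * x j = x j * e (σ j i)`, together with the action on
`V → k[X_j]` that shows that these relations suffice. -/
structure PBWData (k R V ι : Type*) [Field k] [Ring R] [Algebra k R] [Fintype V]
    [DecidableEq V] where
  e : V → R
  x : ι → R
  σ : ι → Equiv.Perm V
  e_mul_self : ∀ i, e i * e i = e i
  e_mul_of_ne : ∀ i j, i ≠ j → e i * e j = 0
  sum_e : ∑ i, e i = 1
  x_comm : ∀ i j, x i * x j = x j * x i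
  e_mul_x : ∀ i j, e i * x j = x j * e (σ j i)
  adjoin_eq_top : Algebra.adjoin k (Set.range e ∪ Set.range x) = ⊤
  act : R →ₐ[k] Module.End k (V → MvPolynomial ι k)
  act_e : ∀ i w, act (e i) w = Pi.single i (w i)
  act_x : ∀ j w i, act (x j) w i = X j * w (σ j i)

namespace PBWData

open MvPolynomial

variable {k R V ι : Type*} [Field k] [Ring R] [Algebra k R] [Fintype V] [DecidableEq V]
  (P : PBWData k R V ι)

open scoped IsMulCommutative in
/-- Evaluation of polynomials at the commuting elements `x j`. -/
def ev : MvPolynomial ι k →ₐ[k] R :=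
  -- Evaluation of polynomials needs a commutative target, so it takes place in the subalgebra
  -- generated by the `x j` and is then included in `R`.
  haveI : IsMulCommutative (Algebra.adjoin k (Set.range P.x)) :=
    Algebra.isMulCommutative_adjoin k (by
    rintro _ ⟨i, rfl⟩ _ ⟨j, rfl⟩
    exact P.x_comm i j)
  (Algebra.adjoin k (Set.range P.x)).val.comp
    (aeval fun j => (⟨P.x j, Algebra.subset_adjoin ⟨j, rfl⟩⟩ : Algebra.adjoin k (Set.range P.x)))

open scoped IsMulCommutative in
@[simp] theorem ev_X (j : ι) : P.ev (X j) = P.x j := by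
  simp [ev]

theorem act_x_apply (j : ι) (w : V → MvPolynomial ι k) :
    P.act (P.x j) w = fun i => X j * w (P.σ j i) :=
  funext fun i => P.act_x j w i

/-- A constant tuple does not see the permutation of the vertices, so on it the `x j` act as plain
multiplication by the variables. -/
theorem act_ev (p c : MvPolynomial ι k) : P.act (P.ev p) (fun _ => c) = fun _ => p * c := by
  induction p using MvPolynomial.induction_on generalizing c with
  | C a =>
    rw [← algebraMap_eq, AlgHom.commutes, AlgHom.commutes, Module.algebraMap_end_apply]
    funext i
    simp [Algebra.smul_def]
  | add p q hp hq =>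
    rw [map_add, map_add, LinearMap.add_apply, hp, hq]
    funext i
    simp [add_mul]
  | mul_X p j hp =>
    rw [map_mul, map_mul, Module.End.mul_apply, ev_X, act_x_apply, hp]
    funext i
    ring

/-- The coordinates of an element of `R`. -/
def coord : R →ₗ[k] V → MvPolynomial ι k :=
  (LinearMap.applyₗ (fun _ => 1)).comp P.act.toLinearMap

theorem coord_apply (r : R) : P.coord r = P.act r fun _ => 1 := rfl

/-- The element of `R` with given coordinates. -/
def ofCoord : (V → MvPolynomial ι k) →ₗ[k] R where
  toFun w := ∑ i, P.e i * P.ev (w i)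
  map_add' w w' := by simp [mul_add, Finset.sum_add_distrib]
  map_smul' c w := by simp [Finset.smul_sum]

theorem ofCoord_apply (w : V → MvPolynomial ι k) : P.ofCoord w = ∑ i, P.e i * P.ev (w i) := rfl

theorem ofCoord_single (i : V) (p : MvPolynomial ι k) :
    P.ofCoord (Pi.single i p) = P.e i * P.ev p := by
  rw [ofCoord_apply, Finset.sum_eq_single i]
  · simp
  · intro j _ hj
    simp [Pi.single_eq_of_ne hj]
  · simp

theorem coord_mul (r s : R) : P.coord (r * s) = P.act r (P.coord s) := by
  simp [coord_apply]

theorem coord_ev (p : MvPolynomial ι k) : P.coord (P.ev p) = fun _ => p := by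
  simp [coord_apply, act_ev]

theorem coord_e_mul (i : V) (r : R) : P.coord (P.e i * r) = Pi.single i (P.coord r i) := by
  rw [coord_mul, act_e]

theorem coord_x_mul (j : ι) (r : R) (i : V) :
    P.coord (P.x j * r) i = X j * P.coord r (P.σ j i) := by
  rw [coord_mul, act_x]

/-- This is the independence half of the normal form: the action on the constant tuple `1` recovers
all the coefficients. -/
theorem coord_ofCoord (w : V → MvPolynomial ι k) : P.coord (P.ofCoord w) = w := by
  simp only [ofCoord_apply, map_sum, coord_e_mul, coord_ev]
  exact Finset.univ_sum_single w

theorem x_mul_e (j : ι) (i : V) : P.x j * P.e i = P.e ((P.σ j).symm i) * P.x j := by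
  rw [P.e_mul_x, Equiv.apply_symm_apply]

/-- The spanning half of the normal form: the sums of the `e i * ev p` contain `1` and are stable
under left multiplication by the generators, since `x j` moves past an idempotent at the cost of a
permutation. -/
theorem ofCoord_surjective : Function.Surjective P.ofCoord := by
  have hred : ∀ r, (∀ i p, r * (P.e i * P.ev p) ∈ LinearMap.range P.ofCoord) →
      ∀ s ∈ LinearMap.range P.ofCoord, r * s ∈ LinearMap.range P.ofCoord := by
    rintro r h _ ⟨w, rfl⟩
    rw [ofCoord_apply, Finset.mul_sum]
    exact Submodule.sum_mem _ fun i _ => h _ _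
  have hgen : ∀ r ∈ Algebra.adjoin k (Set.range P.e ∪ Set.range P.x),
      ∀ s ∈ LinearMap.range P.ofCoord, r * s ∈ LinearMap.range P.ofCoord := by
    intro r hr
    induction hr using Algebra.adjoin_induction with
    | mem r hr =>
      refine hred _ fun i p => ?_
      obtain ⟨j, rfl⟩ | ⟨j, rfl⟩ := hr
      · by_cases h : j = i
        · subst h
          rw [← mul_assoc, P.e_mul_self]
          exact ⟨_, P.ofCoord_single _ _⟩
        · rw [← mul_assoc, P.e_mul_of_ne _ _ h, zero_mul]
          exact Submodule.zero_mem _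
      · rw [← mul_assoc, x_mul_e, mul_assoc, ← ev_X, ← map_mul]
        exact ⟨_, P.ofCoord_single _ _⟩
    | algebraMap c =>
      intro s hs
      rw [← Algebra.smul_def]
      exact Submodule.smul_mem _ _ hs
    | add r r' _ _ hr hr' =>
      intro s hs
      rw [add_mul]
      exact Submodule.add_mem _ (hr s hs) (hr' s hs)
    | mul r r' _ _ hr hr' =>
      intro s hs
      rw [mul_assoc]
      exact hr _ (hr' s hs)
  intro r
  rw [← mul_one r]
  refine hgen r (P.adjoin_eq_top ▸ Algebra.mem_top) 1 ⟨fun _ => 1, ?_⟩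
  simp [ofCoord_apply, P.sum_e]

theorem ofCoord_coord (r : R) : P.ofCoord (P.coord r) = r := by
  obtain ⟨w, rfl⟩ := P.ofCoord_surjective r
  rw [coord_ofCoord]

theorem coord_injective : Function.Injective P.coord :=
  Function.LeftInverse.injective P.ofCoord_coord

theorem coord_e (i : V) : P.coord (P.e i) = Pi.single i 1 := by
  rw [← mul_one (P.e i), coord_e_mul, coord_apply, map_one]
  rfl

/-- A polynomial on the right never has to pass an idempotent, so it multiplies each coordinate
without moving the vertices, in contrast to `coord_x_mul`. This reduces regularity questions in `R`
to polynomial rings. -/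
theorem coord_mul_ev (r : R) (q : MvPolynomial ι k) (i : V) :
    P.coord (r * P.ev q) i = P.coord r i * q := by
  obtain ⟨w, rfl⟩ := P.ofCoord_surjective r
  have : P.ofCoord w * P.ev q = P.ofCoord fun i => w i * q := by
    simp [ofCoord_apply, Finset.sum_mul, mul_assoc]
  rw [this, coord_ofCoord, coord_ofCoord]

variable {P} in
/-- Induction on elements of the form `e i * ev p`. -/
theorem induction_on {motive : R → Prop} (r : R) (h : ∀ i p, motive (P.e i * P.ev p))
    (h0 : motive 0) (hadd : ∀ r s, motive r → motive s → motive (r + s)) : motive r := by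
  rw [← P.ofCoord_coord r, ofCoord_apply]
  exact Finset.sum_induction _ _ hadd h0 fun i _ => h _ _

end PBWData

/-! ### Generation and degrees in path algebras -/

namespace PathAlgebra

variable {k V : Type*} [Field k] [Quiver V]

theorem ofPath_cons {i j l : V} (p : Quiver.Path i j) (a : j ⟶ l) :
    ofPath k (p.cons a) = ofPath k p * arrow k a := by
  rw [arrow, ofPath_mul_ofPath]
  rfl

theorem ofPath_mem_piece (w : ∀ {i j : V}, (i ⟶ j) → ℕ) {i j : V} (p : Quiver.Path i j) :
    ofPath k p ∈ piece k w (p.addWeight w) :=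
  Submodule.subset_span ⟨i, j, p, rfl, rfl⟩

theorem vertex_mem_piece (w : ∀ {i j : V}, (i ⟶ j) → ℕ) (i : V) : vertex k i ∈ piece k w 0 :=
  Submodule.subset_span ⟨i, i, .nil, by simp, rfl⟩

theorem arrow_mem_piece (w : ∀ {i j : V}, (i ⟶ j) → ℕ) {i j : V} (a : i ⟶ j) :
    arrow k a ∈ piece k w (w a) :=
  Submodule.subset_span ⟨i, j, a.toPath, by simp [Quiver.Hom.toPath], rfl⟩

theorem mul_mem_piece (w : ∀ {i j : V}, (i ⟶ j) → ℕ) {a b : ℕ} {x y : PathAlgebra k V}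
    (hx : x ∈ piece k w a) (hy : y ∈ piece k w b) : x * y ∈ piece k w (a + b) := by
  induction hx using Submodule.span_induction with
  | zero => rw [zero_mul]; exact Submodule.zero_mem _
  | add x x' _ _ h h' => rw [add_mul]; exact Submodule.add_mem _ h h'
  | smul c x _ h => rw [smul_mul_assoc]; exact Submodule.smul_mem _ _ h
  | mem x hx =>
  obtain ⟨i, j, p, rfl, rfl⟩ := hx
  induction hy using Submodule.span_induction with
  | zero => rw [mul_zero]; exact Submodule.zero_mem _
  | add x x' _ _ h h' => rw [mul_add]; exact Submodule.add_mem _ h h'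
  | smul c x _ h => rw [mul_smul_comm]; exact Submodule.smul_mem _ _ h
  | mem y hy =>
  obtain ⟨i', j', q, rfl, rfl⟩ := hy
  by_cases h : i' = j
  · subst h
    rw [ofPath_mul_ofPath, ← Quiver.Path.addWeight_comp]
    exact ofPath_mem_piece w _
  · rw [ofPath_mul_ofPath_of_ne _ _ h]
    exact Submodule.zero_mem _

variable [Fintype V]

theorem map_mem_of_forall {A : Type*} [Ring A] [Algebra k A] (F : PathAlgebra k V →ₐ[k] A)
    (S : Subalgebra k A) (hv : ∀ i, F (vertex k i) ∈ S)
    (ha : ∀ (i j : V) (a : i ⟶ j), F (arrow k a) ∈ S) (x : PathAlgebra k V) : F x ∈ S := by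
  induction x using PathAlgebra.induction_on with
  | h0 => rw [map_zero]; exact S.zero_mem
  | ha x y hx hy => rw [map_add]; exact S.add_mem hx hy
  | hs c x hx => rw [map_smul]; exact S.smul_mem hx c
  | hp i j p =>
    induction p with
    | nil => exact hv i
    | cons p a ih => rw [ofPath_cons, map_mul]; exact S.mul_mem ih (ha _ _ a)

/-- If vertices preserve degrees and arrows raise them by their weight, then elements of degree
`d` raise degrees by `d`. -/
theorem map_apply_mem_of_mem_piece (w : ∀ {i j : V}, (i ⟶ j) → ℕ) {M : Type*} [AddCommGroup M]
    [Module k M] (F : PathAlgebra k V →ₐ[k] Module.End k M) (𝓜 : ℕ → Submodule k M)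
    (hv : ∀ i d, ∀ m ∈ 𝓜 d, F (vertex k i) m ∈ 𝓜 d)
    (ha : ∀ (i j : V) (a : i ⟶ j), ∀ d, ∀ m ∈ 𝓜 d, F (arrow k a) m ∈ 𝓜 (w a + d))
    {a d : ℕ} {x : PathAlgebra k V} (hx : x ∈ piece k w a) {m : M} (hm : m ∈ 𝓜 d) :
    F x m ∈ 𝓜 (a + d) := by
  induction hx using Submodule.span_induction with
  | zero => rw [map_zero]; exact Submodule.zero_mem _
  | add x x' _ _ h h' => rw [map_add]; exact Submodule.add_mem _ h h'
  | smul c x _ h => rw [map_smul]; exact Submodule.smul_mem _ _ h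
  | mem x hx =>
  obtain ⟨i, j, p, rfl, rfl⟩ := hx
  -- The last arrow of a path acts first, so the vector and its degree have to vary in the
  -- induction.
  induction p generalizing m d with
  | nil => rw [Quiver.Path.addWeight_nil, zero_add]; exact hv i d m hm
  | cons p a ih =>
    rw [ofPath_cons, map_mul, Module.End.mul_apply, Quiver.Path.addWeight_cons, add_assoc]
    exact ih (ha _ _ a d m hm)

end PathAlgebra

/-! ### The two-vertex algebra -/

instance : DecidableEq TwoVertex
  | .one, .one => isTrue rfl
  | .one, .two => isFalse nofun
  | .two, .one => isFalse nofun
  | .two, .two => isTrue rfl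

namespace TwoVertex

/-- The exchange of the two vertices. -/
def swap : Equiv.Perm TwoVertex where
  toFun | .one => .two | .two => .one
  invFun | .one => .two | .two => .one
  left_inv := by rintro (_ | _) <;> rfl
  right_inv := by rintro (_ | _) <;> rfl

@[simp] theorem swap_one : swap .one = .two := rfl
@[simp] theorem swap_two : swap .two = .one := rfl
@[simp] theorem swap_swap (i : TwoVertex) : swap (swap i) = i := by cases i <;> rfl

theorem eq_swap_iff (i j : TwoVertex) : j = swap i ↔ swap j = i := by
  cases i <;> cases j <;> decide

theorem sum_eq {M : Type*} [AddCommMonoid M] (f : TwoVertex → M) :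
    ∑ i, f i = f .one + f .two := by
  rw [show (Finset.univ : Finset TwoVertex) = {.one, .two} from rfl,
    Finset.sum_pair (by decide)]

end TwoVertex

namespace TwoVertexAlgebra

variable (k : Type*) [Field k]

/-- The idempotents of the two-vertex algebra. -/
def f (i : TwoVertex) : TwoVertexAlgebra k := mk k (PathAlgebra.vertex k i)

/-- The sum `u₁ + u₂`. -/
def u : TwoVertexAlgebra k := u₁ k + u₂ k

/-- The sum `v₁ + v₂`. -/
def v : TwoVertexAlgebra k := v₁ k + v₂ k

theorem f_mul_self (i : TwoVertex) : f k i * f k i = f k i := by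
  rw [f, ← map_mul, PathAlgebra.vertex_mul_vertex_self]

theorem f_mul_of_ne (i j : TwoVertex) (h : i ≠ j) : f k i * f k j = 0 := by
  rw [f, f, ← map_mul, PathAlgebra.vertex_mul_vertex_of_ne h, map_zero]

theorem sum_f : ∑ i, f k i = 1 := by
  simp only [f, ← map_sum]
  exact map_one (mk k)

theorem f₁_mul_u₁ : f k .one * u₁ k = u₁ k := by
  rw [f, u₁, ← map_mul, pathU₁, PathAlgebra.vertex_mul_arrow]
theorem f₂_mul_u₂ : f k .two * u₂ k = u₂ k := by
  rw [f, u₂, ← map_mul, pathU₂, PathAlgebra.vertex_mul_arrow]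
theorem f₁_mul_v₁ : f k .one * v₁ k = v₁ k := by
  rw [f, v₁, ← map_mul, pathV₁, PathAlgebra.vertex_mul_arrow]
theorem f₂_mul_v₂ : f k .two * v₂ k = v₂ k := by
  rw [f, v₂, ← map_mul, pathV₂, PathAlgebra.vertex_mul_arrow]
theorem u₁_mul_f₂ : u₁ k * f k .two = u₁ k := by
  rw [f, u₁, ← map_mul, pathU₁, PathAlgebra.arrow_mul_vertex]
theorem u₂_mul_f₁ : u₂ k * f k .one = u₂ k := by
  rw [f, u₂, ← map_mul, pathU₂, PathAlgebra.arrow_mul_vertex]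
theorem v₁_mul_f₁ : v₁ k * f k .one = v₁ k := by
  rw [f, v₁, ← map_mul, pathV₁, PathAlgebra.arrow_mul_vertex]
theorem v₂_mul_f₂ : v₂ k * f k .two = v₂ k := by
  rw [f, v₂, ← map_mul, pathV₂, PathAlgebra.arrow_mul_vertex]

theorem v₁_mul_u₁ : v₁ k * u₁ k = u₁ k * v₂ k := by
  have h : mk k _ = mk k _ := RingQuot.mkAlgHom_rel k (TwoVertexRel.rel₁ (k := k))
  rw [map_zero, map_sub, map_mul, map_mul, sub_eq_zero] at h
  exact h

theorem v₂_mul_u₂ : v₂ k * u₂ k = u₂ k * v₁ k := by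
  have h : mk k _ = mk k _ := RingQuot.mkAlgHom_rel k (TwoVertexRel.rel₂ (k := k))
  rw [map_zero, map_sub, map_mul, map_mul, sub_eq_zero] at h
  exact h

variable {k} in
theorem mul_eq_zero_of_mul_f {a b : TwoVertexAlgebra k} {i j : TwoVertex} (h : i ≠ j)
    (ha : a * f k i = a) (hb : f k j * b = b) : a * b = 0 := by
  rw [← ha, ← hb, mul_assoc, ← mul_assoc (f k i), f_mul_of_ne k i j h, zero_mul, mul_zero]

theorem f_mul_u (i : TwoVertex) : f k i * u k = u k * f k (TwoVertex.swap i) := by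
  cases i
  · rw [u, mul_add, f₁_mul_u₁, TwoVertex.swap_one, add_mul, u₁_mul_f₂,
      mul_eq_zero_of_mul_f (i := .one) (j := .two) nofun (f_mul_self k _) (f₂_mul_u₂ k),
      mul_eq_zero_of_mul_f (i := .one) (j := .two) nofun (u₂_mul_f₁ k) (f_mul_self k _)]
  · rw [u, mul_add, f₂_mul_u₂, TwoVertex.swap_two, add_mul, u₂_mul_f₁,
      mul_eq_zero_of_mul_f (i := .two) (j := .one) nofun (f_mul_self k _) (f₁_mul_u₁ k),
      mul_eq_zero_of_mul_f (i := .two) (j := .one) nofun (u₁_mul_f₂ k) (f_mul_self k _)]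

theorem f_mul_v (i : TwoVertex) : f k i * v k = v k * f k i := by
  cases i
  · rw [v, mul_add, f₁_mul_v₁, add_mul, v₁_mul_f₁,
      mul_eq_zero_of_mul_f (i := .one) (j := .two) nofun (f_mul_self k _) (f₂_mul_v₂ k),
      mul_eq_zero_of_mul_f (i := .two) (j := .one) nofun (v₂_mul_f₂ k) (f_mul_self k _)]
  · rw [v, mul_add, f₂_mul_v₂, add_mul, v₂_mul_f₂,
      mul_eq_zero_of_mul_f (i := .two) (j := .one) nofun (f_mul_self k _) (f₁_mul_v₁ k),
      mul_eq_zero_of_mul_f (i := .one) (j := .two) nofun (v₁_mul_f₁ k) (f_mul_self k _)]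

/-- The two defining relations together are the commutation of `u` and `v`; the remaining products
vanish because their endpoints do not match. -/
theorem u_mul_v : u k * v k = v k * u k := by
  rw [u, v, add_mul, mul_add, mul_add, add_mul, mul_add, mul_add, v₁_mul_u₁, v₂_mul_u₂,
    mul_eq_zero_of_mul_f (by decide) (u₁_mul_f₂ k) (f₁_mul_v₁ k),
    mul_eq_zero_of_mul_f (by decide) (u₂_mul_f₁ k) (f₂_mul_v₂ k),
    mul_eq_zero_of_mul_f (by decide) (v₁_mul_f₁ k) (f₂_mul_u₂ k),
    mul_eq_zero_of_mul_f (by decide) (v₂_mul_f₂ k) (f₁_mul_u₁ k)]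
  simp only [zero_add, add_zero]

theorem f_one_mul_u : f k .one * u k = u₁ k := by
  rw [u, mul_add, f₁_mul_u₁,
    mul_eq_zero_of_mul_f (i := .one) (j := .two) nofun (f_mul_self k _) (f₂_mul_u₂ k), add_zero]

theorem f_two_mul_u : f k .two * u k = u₂ k := by
  rw [u, mul_add, f₂_mul_u₂,
    mul_eq_zero_of_mul_f (i := .two) (j := .one) nofun (f_mul_self k _) (f₁_mul_u₁ k), zero_add]

theorem f_one_mul_v : f k .one * v k = v₁ k := by
  rw [v, mul_add, f₁_mul_v₁,
    mul_eq_zero_of_mul_f (i := .one) (j := .two) nofun (f_mul_self k _) (f₂_mul_v₂ k), add_zero]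

theorem f_two_mul_v : f k .two * v k = v₂ k := by
  rw [v, mul_add, f₂_mul_v₂,
    mul_eq_zero_of_mul_f (i := .two) (j := .one) nofun (f_mul_self k _) (f₁_mul_v₁ k), zero_add]

theorem adjoin_eq_top :
    Algebra.adjoin k (Set.range (f k) ∪ Set.range ![u k, v k]) = ⊤ := by
  rw [eq_top_iff]
  rintro x -
  obtain ⟨x, rfl⟩ := RingQuot.mkAlgHom_surjective k (TwoVertexRel k) x
  have hf : ∀ i, f k i ∈ Algebra.adjoin k (Set.range (f k) ∪ Set.range ![u k, v k]) :=
    fun i => Algebra.subset_adjoin (.inl ⟨i, rfl⟩)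
  have hu : u k ∈ Algebra.adjoin k (Set.range (f k) ∪ Set.range ![u k, v k]) :=
    Algebra.subset_adjoin (.inr ⟨0, rfl⟩)
  have hv : v k ∈ Algebra.adjoin k (Set.range (f k) ∪ Set.range ![u k, v k]) :=
    Algebra.subset_adjoin (.inr ⟨1, rfl⟩)
  refine PathAlgebra.map_mem_of_forall (mk k) _ hf ?_ x
  rintro _ _ (_ | _ | _ | _)
  · have := mul_mem (hf .one) hu
    rw [f_one_mul_u] at this
    exact this
  · have := mul_mem (hf .two) hu
    rw [f_two_mul_u] at this
    exact this
  · have := mul_mem (hf .one) hv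
    rw [f_one_mul_v] at this
    exact this
  · have := mul_mem (hf .two) hv
    rw [f_two_mul_v] at this
    exact this

section Lift

variable {k} {B : Type*} [Ring B] [Algebra k B] (E : TwoVertex → B) (U V : B)
  (h1 : ∀ i, E i * E i = E i) (h2 : ∀ i j, i ≠ j → E i * E j = 0) (h3 : ∑ i, E i = 1)
  (h4 : ∀ i, E i * U = U * E (TwoVertex.swap i)) (h5 : ∀ i, E i * V = V * E i)
  (h6 : U * V = V * U)

/-- The image of an arrow under the map that sends `f i` to `E i`, `u` to `U` and `v` to `V`. -/
def liftArrow : ∀ {i j : TwoVertex}, (i ⟶ j) → B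
  | _, _, .u₁ => E .one * U
  | _, _, .u₂ => E .two * U
  | _, _, .v₁ => E .one * V
  | _, _, .v₂ => E .two * V

/-- Data for an algebra map that sends `f i` to `E i`, `u` to `U` and `v` to `V`. -/
def liftData : PathAlgebra.LiftData TwoVertex B where
  e := E
  a := liftArrow E U V
  e_mul_self := h1
  e_mul_of_ne := h2
  sum_e := h3
  e_mul_a := by
    rintro _ _ (_ | _ | _ | _) <;> exact (mul_assoc _ _ _).symm.trans (congrArg (· * _) (h1 _))
  a_mul_e := by
    rintro _ _ (_ | _ | _ | _)
    · change E .one * U * E .two = E .one * U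
      rw [h4, mul_assoc]; exact congrArg _ (h1 _)
    · change E .two * U * E .one = E .two * U
      rw [h4, mul_assoc]; exact congrArg _ (h1 _)
    · change E .one * V * E .one = E .one * V
      rw [h5, mul_assoc, h1]
    · change E .two * V * E .two = E .two * V
      rw [h5, mul_assoc, h1]

/-- The algebra map that sends `f i` to `E i`, `u` to `U` and `v` to `V`. -/
def lift : TwoVertexAlgebra k →ₐ[k] B :=
  RingQuot.liftAlgHom k ⟨PathAlgebra.lift k (liftData E U V h1 h2 h3 h4 h5), by
    -- Both defining relations are this identity, one at each vertex: the commutation of `U` and `V`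
    -- cut down by an idempotent.
    have key : ∀ i, E i * V * (E i * U) = E i * U * (E (TwoVertex.swap i) * V) := fun i => by
      rw [← mul_assoc (E i * U), mul_assoc (E i) U, ← h4, h5, mul_assoc V, ← mul_assoc (E i) (E i),
        h1, ← mul_assoc V, ← h5, mul_assoc, ← h6, ← mul_assoc, mul_assoc]
    rintro _ _ (_ | _)
    · rw [map_zero, map_sub, map_mul, map_mul, sub_eq_zero, pathU₁, pathV₁, pathV₂]
      simp only [PathAlgebra.lift_arrow]
      exact key .one
    · rw [map_zero, map_sub, map_mul, map_mul, sub_eq_zero, pathU₂, pathV₁, pathV₂]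
      simp only [PathAlgebra.lift_arrow]
      exact key .two⟩

theorem lift_mk (x : PathAlgebra k TwoVertex) :
    lift E U V h1 h2 h3 h4 h5 h6 (mk k x)
      = PathAlgebra.lift k (liftData E U V h1 h2 h3 h4 h5) x :=
  RingQuot.liftAlgHom_mkAlgHom_apply _ _ _ _

@[simp] theorem lift_f (i : TwoVertex) : lift E U V h1 h2 h3 h4 h5 h6 (f k i) = E i :=
  (lift_mk ..).trans (PathAlgebra.lift_vertex _ _)

@[simp] theorem lift_u : lift E U V h1 h2 h3 h4 h5 h6 (u k) = U := by
  have hs := h3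
  rw [TwoVertex.sum_eq] at hs
  rw [u, map_add, u₁, u₂, lift_mk, lift_mk, pathU₁, pathU₂, PathAlgebra.lift_arrow,
    PathAlgebra.lift_arrow]
  change E .one * U + E .two * U = U
  rw [← add_mul, hs, one_mul]

@[simp] theorem lift_v : lift E U V h1 h2 h3 h4 h5 h6 (v k) = V := by
  have hs := h3
  rw [TwoVertex.sum_eq] at hs
  rw [v, map_add, v₁, v₂, lift_mk, lift_mk, pathV₁, pathV₂, PathAlgebra.lift_arrow,
    PathAlgebra.lift_arrow]
  change E .one * V + E .two * V = V
  rw [← add_mul, hs, one_mul]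

variable {E U V} in
theorem algHom_ext {F G : TwoVertexAlgebra k →ₐ[k] B} (hf : ∀ i, F (f k i) = G (f k i))
    (hu : F (u k) = G (u k)) (hv : F (v k) = G (v k)) : F = G := by
  refine AlgHom.ext_of_adjoin_eq_top (adjoin_eq_top k) ?_
  rintro _ (⟨i, rfl⟩ | ⟨i, rfl⟩)
  · exact hf i
  · fin_cases i
    · exact hu
    · exact hv

end Lift

open MvPolynomial

/-- The standard monomials of the two-vertex algebra. -/
def pbw : PBWData k (TwoVertexAlgebra k) TwoVertex (Fin 2) where
  e := f k
  x := ![u k, v k]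
  σ := ![TwoVertex.swap, 1]
  e_mul_self := f_mul_self k
  e_mul_of_ne := f_mul_of_ne k
  sum_e := sum_f k
  x_comm i j := by
    fin_cases i <;> fin_cases j
    · rfl
    · exact u_mul_v k
    · exact (u_mul_v k).symm
    · rfl
  e_mul_x i j := by
    fin_cases j
    · exact f_mul_u k i
    · exact f_mul_v k i
  adjoin_eq_top := adjoin_eq_top k
  act := lift (projOp k _) (shiftOp k (X 0) TwoVertex.swap) (shiftOp k (X 1) 1)
    (projOp_mul_self k) (projOp_mul_of_ne k) (sum_projOp k)
    (fun i => projOp_mul_shiftOp k i _ _) (fun i => projOp_mul_shiftOp k i _ _)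
    (shiftOp_mul_shiftOp k _ _ _ _ (Commute.one_right _))
  act_e i w :=
    congrArg (fun F : Module.End k (TwoVertex → MvPolynomial (Fin 2) k) => F w) (lift_f ..)
  act_x j w i := by
    fin_cases j
    · exact congrArg (fun F : Module.End k (TwoVertex → MvPolynomial (Fin 2) k) => F w i)
        (lift_u ..)
    · exact congrArg (fun F : Module.End k (TwoVertex → MvPolynomial (Fin 2) k) => F w i)
        (lift_v ..)

end TwoVertexAlgebra

/-! ### The enveloping algebra of the two-vertex algebra -/

section MaskOperators

variable (k : Type*) {V T : Type*} [Field k] [CommRing T] [Algebra k T]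

/-- Pointwise multiplication by the indicator function of a set. -/
def maskOp (T : Type*) [CommRing T] [Algebra k T] (s : V → Prop) [DecidablePred s] :
    Module.End k (V → T) :=
  LinearMap.pi fun i => if s i then LinearMap.proj i else 0

variable (s t : V → Prop) [DecidablePred s] [DecidablePred t]

theorem maskOp_apply (w : V → T) (i : V) : maskOp k T s w i = if s i then w i else 0 := by
  rw [maskOp, LinearMap.pi_apply]
  split_ifs <;> rfl

theorem maskOp_mul_self : maskOp k T s * maskOp k T s = maskOp k T s := by
  refine LinearMap.ext fun w => funext fun i => ?_
  simp only [Module.End.mul_apply, maskOp_apply]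
  split_ifs <;> rfl

theorem maskOp_mul_of_disjoint (h : ∀ i, s i → ¬ t i) : maskOp k T s * maskOp k T t = 0 := by
  refine LinearMap.ext fun w => funext fun i => ?_
  simp only [Module.End.mul_apply, maskOp_apply]
  split_ifs with h1 h2
  · exact (h i h1 h2).elim
  · rfl
  · rfl

theorem maskOp_mul_shiftOp (p : T) (τ : Equiv.Perm V) (h : ∀ i, s i ↔ t (τ i)) :
    maskOp k T s * shiftOp k p τ = shiftOp k p τ * maskOp k T t := by
  refine LinearMap.ext fun w => funext fun i => ?_
  simp only [Module.End.mul_apply, maskOp_apply, shiftOp_apply, h]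
  split_ifs <;> simp

theorem maskOp_mul_comm : maskOp k T s * maskOp k T t = maskOp k T t * maskOp k T s := by
  refine LinearMap.ext fun w => funext fun i => ?_
  simp only [Module.End.mul_apply, maskOp_apply]
  split_ifs <;> rfl

end MaskOperators

namespace TwoVertexAlgebra

open MvPolynomial MulOpposite

variable (k : Type*) [Field k]

/-- The polynomial ring of the enveloping algebra. -/
abbrev EnvPoly := MvPolynomial (Fin 2 ⊕ Fin 2) k

/-- The exchange of the two vertices in the first factor. -/
def swapLeft : Equiv.Perm (TwoVertex × TwoVertex) := Equiv.prodCongr TwoVertex.swap 1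

/-- The exchange of the two vertices in the second factor. -/
def swapRight : Equiv.Perm (TwoVertex × TwoVertex) := Equiv.prodCongr 1 TwoVertex.swap

theorem swapLeft_commute_swapRight : Commute swapLeft swapRight := by
  ext ⟨i, j⟩ <;> rfl

theorem sum_maskOp (T : Type*) [CommRing T] [Algebra k T] (p : TwoVertex × TwoVertex → TwoVertex) :
    ∑ i, maskOp k T (fun q => p q = i) = 1 := by
  refine LinearMap.ext fun w => funext fun i => ?_
  simp [LinearMap.sum_apply, maskOp_apply]

/-- The action of the left factor of the enveloping algebra. -/
def envLeft : TwoVertexAlgebra k →ₐ[k] Module.End k (TwoVertex × TwoVertex → EnvPoly k) :=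
  lift (fun i => maskOp k (EnvPoly k) (fun q => q.1 = i)) (shiftOp k (X (.inl 0)) swapLeft)
    (shiftOp k (X (.inl 1)) 1)
    (fun i => maskOp_mul_self k _)
    (fun i j h => maskOp_mul_of_disjoint k _ _ (by rintro q rfl; exact h))
    (sum_maskOp k _ _)
    (fun i => maskOp_mul_shiftOp k _ _ _ _ fun q => TwoVertex.swap.apply_eq_iff_eq.symm)
    (fun i => maskOp_mul_shiftOp k _ _ _ _ fun q => Iff.rfl)
    (shiftOp_mul_shiftOp k _ _ _ _ (Commute.one_right _))

/-- The action of the right factor of the enveloping algebra. -/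
def envRight : (TwoVertexAlgebra k)ᵐᵒᵖ →ₐ[k] Module.End k (TwoVertex × TwoVertex → EnvPoly k) :=
  -- A map out of the opposite algebra is a map out of the algebra into the opposite of the
  -- endomorphisms, where the universal property applies.
  AlgHom.opComm <|
  lift (fun i => op (maskOp k (EnvPoly k) (fun q => q.2 = i)))
    (op (shiftOp k (X (.inr 0)) swapRight)) (op (shiftOp k (X (.inr 1)) 1))
    (fun i => congrArg op (maskOp_mul_self k _))
    (fun i j h => congrArg op (maskOp_mul_of_disjoint k _ _ (by rintro q rfl; exact h.symm)))
    (by rw [← Finset.op_sum, sum_maskOp, op_one])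
    (fun i => by
      rw [← op_mul, ← op_mul, maskOp_mul_shiftOp k (fun q : TwoVertex × TwoVertex => q.2 = TwoVertex.swap i)
        (fun q => q.2 = i)]
      rintro ⟨a, b⟩
      exact TwoVertex.eq_swap_iff i b)
    (fun i => congrArg op (maskOp_mul_shiftOp k _ _ _ _ fun q => Iff.rfl).symm)
    (congrArg op (shiftOp_mul_shiftOp k _ _ _ _ (Commute.one_left _)))

theorem envLeft_f (i : TwoVertex) :
    envLeft k (f k i) = maskOp k (EnvPoly k) (fun q => q.1 = i) := lift_f ..
theorem envLeft_u : envLeft k (u k) = shiftOp k (X (.inl 0)) swapLeft := lift_u ..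
theorem envLeft_v : envLeft k (v k) = shiftOp k (X (.inl 1)) 1 := lift_v ..
theorem envRight_f (i : TwoVertex) :
    envRight k (op (f k i)) = maskOp k (EnvPoly k) (fun q => q.2 = i) :=
  congrArg unop (lift_f ..)
theorem envRight_u : envRight k (op (u k)) = shiftOp k (X (.inr 0)) swapRight :=
  congrArg unop (lift_u ..)
theorem envRight_v : envRight k (op (v k)) = shiftOp k (X (.inr 1)) 1 := congrArg unop (lift_v ..)

variable {k} in
theorem mem_of_generators (S : Subalgebra k (TwoVertexAlgebra k)) (hf : ∀ i, f k i ∈ S)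
    (hu : u k ∈ S) (hv : v k ∈ S) (a : TwoVertexAlgebra k) : a ∈ S := by
  have h : Algebra.adjoin k (Set.range (f k) ∪ Set.range ![u k, v k]) ≤ S := by
    refine Algebra.adjoin_le ?_
    rintro _ (⟨i, rfl⟩ | ⟨i, rfl⟩)
    · exact hf i
    · fin_cases i
      · exact hu
      · exact hv
  exact h (adjoin_eq_top k ▸ Algebra.mem_top)

variable {k} in
-- The elements whose image commutes with `b` form a subalgebra, the preimage of a centralizer.
theorem commute_of_generators {B : Type*} [Ring B] [Algebra k B] (F : TwoVertexAlgebra k →ₐ[k] B)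
    (b : B) (hf : ∀ i, Commute (F (f k i)) b) (hu : Commute (F (u k)) b)
    (hv : Commute (F (v k)) b) (a : TwoVertexAlgebra k) : Commute (F a) b :=
  (Subalgebra.mem_centralizer_iff k).1 (mem_of_generators
    ((Subalgebra.centralizer k {b}).comap F)
    (fun i => (Subalgebra.mem_centralizer_iff k).2 (by rintro _ rfl; exact (hf i).symm))
    ((Subalgebra.mem_centralizer_iff k).2 (by rintro _ rfl; exact hu.symm))
    ((Subalgebra.mem_centralizer_iff k).2 (by rintro _ rfl; exact hv.symm)) a) b rfl |>.symm

/-- The two actions use different components of the pair of vertices and disjoint sets of variables.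
On generators this is a comparison of masks and shifts, and it extends to a model of the tensor
product. -/
theorem envLeft_commute_envRight (a : TwoVertexAlgebra k) (b : (TwoVertexAlgebra k)ᵐᵒᵖ) :
    Commute (envLeft k a) (envRight k b) := by
  have key : ∀ c : Module.End k (TwoVertex × TwoVertex → EnvPoly k),
      (∀ i, Commute c (envRight k (op (f k i)))) → Commute c (envRight k (op (u k))) →
      Commute c (envRight k (op (v k))) → ∀ b, Commute c (envRight k (op b)) := by
    intro c h1 h2 h3 b
    have := commute_of_generators (AlgHom.opComm.symm (envRight k)) (op c)
      (fun i => (commute_op.2 (h1 i).symm)) (commute_op.2 h2.symm) (commute_op.2 h3.symm) b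
    exact (commute_op.1 this).symm
  refine commute_of_generators _ _ (fun i => ?_) ?_ ?_ a
  · rw [envLeft_f]
    refine key _ (fun j => ?_) ?_ ?_ b.unop
    · rw [envRight_f]; exact maskOp_mul_comm k _ _
    · rw [envRight_u]; exact maskOp_mul_shiftOp k _ _ _ _ fun q => Iff.rfl
    · rw [envRight_v]; exact maskOp_mul_shiftOp k _ _ _ _ fun q => Iff.rfl
  · rw [envLeft_u]
    refine key _ (fun j => ?_) ?_ ?_ b.unop
    · rw [envRight_f]; exact (maskOp_mul_shiftOp k _ _ _ _ fun q => Iff.rfl).symm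
    · rw [envRight_u]; exact shiftOp_mul_shiftOp k _ _ _ _ swapLeft_commute_swapRight
    · rw [envRight_v]; exact shiftOp_mul_shiftOp k _ _ _ _ (Commute.one_right _)
  · rw [envLeft_v]
    refine key _ (fun j => ?_) ?_ ?_ b.unop
    · rw [envRight_f]; exact (maskOp_mul_shiftOp k _ _ _ _ fun q => Iff.rfl).symm
    · rw [envRight_u]; exact shiftOp_mul_shiftOp k _ _ _ _ (Commute.one_left _)
    · rw [envRight_v]; exact shiftOp_mul_shiftOp k _ _ _ _ (Commute.one_left _)

/-- The enveloping algebra of the two-vertex algebra. -/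
abbrev Env := TwoVertexAlgebra k ⊗[k] (TwoVertexAlgebra k)ᵐᵒᵖ

/-- The idempotents of the enveloping algebra. -/
def envE (q : TwoVertex × TwoVertex) : Env k := f k q.1 ⊗ₜ op (f k q.2)

/-- The generators `u ⊗ 1`, `v ⊗ 1`, `1 ⊗ u` and `1 ⊗ v` of the enveloping algebra. -/
def envX : Fin 2 ⊕ Fin 2 → Env k :=
  Sum.elim ![u k ⊗ₜ 1, v k ⊗ₜ 1] ![1 ⊗ₜ op (u k), 1 ⊗ₜ op (v k)]

theorem envX_comm (i j : Fin 2 ⊕ Fin 2) : envX k i * envX k j = envX k j * envX k i := by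
  have h := u_mul_v k
  rcases i with i | i <;> rcases j with j | j <;> fin_cases i <;> fin_cases j <;>
    simp [envX, Algebra.TensorProduct.tmul_mul_tmul, h, ← op_mul]

/-- The permutation of the idempotents that a generator of the enveloping algebra induces. -/
def envPerm : Fin 2 ⊕ Fin 2 → Equiv.Perm (TwoVertex × TwoVertex) :=
  Sum.elim ![swapLeft, 1] ![swapRight, 1]

theorem envE_mul_envX (q : TwoVertex × TwoVertex) (j : Fin 2 ⊕ Fin 2) :
    envE k q * envX k j = envX k j * envE k (envPerm j q) := by
  rcases j with j | j <;> fin_cases j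
  · change f k q.1 ⊗ₜ op (f k q.2) * u k ⊗ₜ 1 = u k ⊗ₜ 1 * f k (TwoVertex.swap q.1) ⊗ₜ op (f k q.2)
    simp only [Algebra.TensorProduct.tmul_mul_tmul, f_mul_u, one_mul, mul_one]
  · change f k q.1 ⊗ₜ op (f k q.2) * v k ⊗ₜ 1 = v k ⊗ₜ 1 * f k q.1 ⊗ₜ op (f k q.2)
    simp only [Algebra.TensorProduct.tmul_mul_tmul, f_mul_v, one_mul, mul_one]
  · change f k q.1 ⊗ₜ op (f k q.2) * 1 ⊗ₜ op (u k)
      = 1 ⊗ₜ op (u k) * f k q.1 ⊗ₜ op (f k (TwoVertex.swap q.2))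
    simp only [Algebra.TensorProduct.tmul_mul_tmul, ← op_mul, f_mul_u, one_mul, mul_one,
      TwoVertex.swap_swap]
  · change f k q.1 ⊗ₜ op (f k q.2) * 1 ⊗ₜ op (v k) = 1 ⊗ₜ op (v k) * f k q.1 ⊗ₜ op (f k q.2)
    simp only [Algebra.TensorProduct.tmul_mul_tmul, ← op_mul, f_mul_v, one_mul, mul_one]

theorem env_adjoin_eq_top : Algebra.adjoin k (Set.range (envE k) ∪ Set.range (envX k)) = ⊤ := by
  set S := Algebra.adjoin k (Set.range (envE k) ∪ Set.range (envX k)) with hS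
  have hE : ∀ q, envE k q ∈ S := fun q => Algebra.subset_adjoin (.inl ⟨q, rfl⟩)
  have hX : ∀ j, envX k j ∈ S := fun j => Algebra.subset_adjoin (.inr ⟨j, rfl⟩)
  have hsum := sum_f k
  have h1 : ∀ a : TwoVertexAlgebra k, a ⊗ₜ 1 ∈ S := fun a =>
    mem_of_generators (S.comap Algebra.TensorProduct.includeLeft) (fun i => by
      change f k i ⊗ₜ 1 ∈ S
      -- Expanding `1` as the sum of the vertices turns `f i ⊗ 1` into a sum of the idempotents `f i
      -- ⊗ f j`.
      rw [← op_one, ← hsum, Finset.op_sum, TensorProduct.tmul_sum]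
      exact Subalgebra.sum_mem _ fun j _ => hE (i, j)) (hX (.inl 0)) (hX (.inl 1)) a
  have h2 : ∀ a : TwoVertexAlgebra k, 1 ⊗ₜ op a ∈ S := fun a => by
    have := mem_of_generators (k := k) ((S.op).comap
        (AlgHom.opComm.symm (Algebra.TensorProduct.includeRight :
          (TwoVertexAlgebra k)ᵐᵒᵖ →ₐ[k] Env k))) (fun i => by
      change 1 ⊗ₜ op (f k i) ∈ S
      rw [← hsum, TensorProduct.sum_tmul]
      exact Subalgebra.sum_mem _ fun j _ => hE (j, i)) (hX (.inr 0)) (hX (.inr 1)) a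
    exact this
  rw [eq_top_iff]
  rintro x -
  induction x using TensorProduct.induction_on with
  | zero => exact S.zero_mem
  | add x y hx hy => exact S.add_mem hx hy
  | tmul a b =>
    have := S.mul_mem (h1 a) (h2 b.unop)
    rwa [Algebra.TensorProduct.tmul_mul_tmul, mul_one, one_mul, op_unop] at this

/-- The action of the enveloping algebra on tuples of polynomials. -/
def envAct : Env k →ₐ[k] Module.End k (TwoVertex × TwoVertex → EnvPoly k) :=
  Algebra.TensorProduct.lift (envLeft k) (envRight k) (envLeft_commute_envRight k)

theorem envAct_envX (j : Fin 2 ⊕ Fin 2) : envAct k (envX k j) = shiftOp k (X j) (envPerm j) := by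
  have hl : ∀ a, envAct k (a ⊗ₜ 1) = envLeft k a := fun a => by
    rw [envAct, Algebra.TensorProduct.lift_tmul, map_one, mul_one]
  have hr : ∀ a, envAct k (1 ⊗ₜ a) = envRight k a := fun a => by
    rw [envAct, Algebra.TensorProduct.lift_tmul, map_one, one_mul]
  rcases j with j | j <;> fin_cases j
  · exact (hl _).trans (envLeft_u k)
  · exact (hl _).trans (envLeft_v k)
  · exact (hr _).trans (envRight_u k)
  · exact (hr _).trans (envRight_v k)

/-- The standard monomials of the enveloping algebra. -/
def envPbw : PBWData k (Env k) (TwoVertex × TwoVertex) (Fin 2 ⊕ Fin 2) where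
  e := envE k
  x := envX k
  σ := envPerm
  e_mul_self q := by
    rw [envE, Algebra.TensorProduct.tmul_mul_tmul, f_mul_self, ← op_mul, f_mul_self]
  e_mul_of_ne q q' h := by
    rw [envE, envE, Algebra.TensorProduct.tmul_mul_tmul, ← op_mul]
    by_cases h1 : q.1 = q'.1
    · rw [f_mul_of_ne k q'.2 q.2 fun h2 => h (Prod.ext h1 h2.symm), op_zero, TensorProduct.tmul_zero]
    · rw [f_mul_of_ne k _ _ h1, TensorProduct.zero_tmul]
  sum_e := by
    rw [Fintype.sum_prod_type]
    simp only [envE, ← TensorProduct.tmul_sum, ← Finset.op_sum, sum_f, ← TensorProduct.sum_tmul]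
    rfl
  x_comm := envX_comm k
  e_mul_x := envE_mul_envX k
  adjoin_eq_top := env_adjoin_eq_top k
  act := envAct k
  act_e q w := by
    rw [envE, envAct, Algebra.TensorProduct.lift_tmul, envLeft_f, envRight_f]
    funext p
    obtain ⟨p1, p2⟩ := p
    obtain ⟨q1, q2⟩ := q
    simp only [Module.End.mul_apply, maskOp_apply, Pi.single_apply, Prod.mk.injEq]
    by_cases h1 : p1 = q1 <;> by_cases h2 : p2 = q2 <;> simp [h1, h2]
  act_x j w q := by
    rw [envAct_envX, shiftOp_apply]

end TwoVertexAlgebra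

/-! ### Differences of variables as a regular sequence -/

namespace MvPolynomial

/-- Two algebra maps that agree on the variables modulo `d` agree modulo `d`. -/
theorem dvd_sub_of_forall_X {k ι B : Type*} [CommRing k] [CommRing B] [Algebra k B]
    (φ ψ : MvPolynomial ι k →ₐ[k] B) (d : B) (h : ∀ i, d ∣ φ (X i) - ψ (X i))
    (p : MvPolynomial ι k) : d ∣ φ p - ψ p := by
  have key : (Ideal.Quotient.mkₐ k (Ideal.span {d})).comp φ
      = (Ideal.Quotient.mkₐ k (Ideal.span {d})).comp ψ :=
    algHom_ext fun i => Ideal.Quotient.eq.2 (Ideal.mem_span_singleton.2 (h i))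
  exact Ideal.mem_span_singleton.1 (Ideal.Quotient.eq.1 (DFunLike.congr_fun key p))

/-- The differences of two disjoint pairs of variables form a regular sequence. -/
theorem X_sub_X_dvd_of_mul_eq_mul {k ι : Type*} [Field k] [DecidableEq ι] {a b c d : ι}
    (hab : a ≠ b) (hac : a ≠ c) (had : a ≠ d) (hcd : c ≠ d) {p q : MvPolynomial ι k}
    (h : p * (X c - X d) = q * (X b - X a)) : X b - X a ∣ p := by
  -- The substitution of `X b` for `X a` kills the right-hand side of `h` and fixes the nonzero
  -- factor `X c - X d`, so it kills `p`. Since it is the identity modulo `X b - X a`, that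
  -- difference divides `p`.
  let φ : MvPolynomial ι k →ₐ[k] MvPolynomial ι k := aeval (Function.update X a (X b))
  have hX : ∀ i, i ≠ a → φ (X i) = X i := fun i hi => by
    simp [φ, Function.update_of_ne hi]
  have ha : φ (X a) = X b := by simp [φ]
  have hne : (X c - X d : MvPolynomial ι k) ≠ 0 := sub_ne_zero.2 fun h => hcd (X_injective h)
  have h0 : φ p = 0 := by
    have := congrArg φ h
    rw [map_mul, map_mul, map_sub, map_sub, hX c hac.symm, hX d had.symm, hX b hab.symm, ha,
      sub_self, mul_zero] at this
    exact (mul_eq_zero.1 this).resolve_right hne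
  have := dvd_sub_of_forall_X (AlgHom.id k _) φ (X b - X a) (fun i => by
    by_cases hi : i = a
    · subst hi
      rw [ha, AlgHom.id_apply, ← neg_sub, neg_dvd]
    · rw [hX i hi, AlgHom.id_apply, sub_self]
      exact dvd_zero _) p
  rwa [h0, sub_zero] at this

end MvPolynomial

/-! ### The Koszul elements of the enveloping algebra and exactness of their complex -/

namespace TwoVertexAlgebra

open MvPolynomial MulOpposite

variable (k : Type*) [Field k]

/-- The element `u ⊗ 1 - 1 ⊗ u` of the enveloping algebra. -/
def envD : Env k := envX k (.inl 0) - envX k (.inr 0)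

/-- The element `v ⊗ 1 - 1 ⊗ v` of the enveloping algebra. -/
def envF : Env k := envX k (.inl 1) - envX k (.inr 1)

/-- The idempotent `f₁ ⊗ f₁ + f₂ ⊗ f₂` of the enveloping algebra. -/
def envDiag : Env k := envE k (.one, .one) + envE k (.two, .two)

/-- The idempotent `f₁ ⊗ f₂ + f₂ ⊗ f₁` of the enveloping algebra. -/
def envAnti : Env k := envE k (.one, .two) + envE k (.two, .one)

theorem envD_eq : envD k = u k ⊗ₜ 1 - 1 ⊗ₜ op (u k) := rfl
theorem envF_eq : envF k = v k ⊗ₜ 1 - 1 ⊗ₜ op (v k) := rfl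

theorem envDiag_add_envAnti : envDiag k + envAnti k = 1 := by
  have := (envPbw k).sum_e
  rw [Fintype.sum_prod_type, TwoVertex.sum_eq, TwoVertex.sum_eq, TwoVertex.sum_eq] at this
  rw [← this]
  change _ = envE k (.one, .one) + envE k (.one, .two)
    + (envE k (.two, .one) + envE k (.two, .two))
  rw [envDiag, envAnti]
  abel

theorem envDiag_mul_envAnti : envDiag k * envAnti k = 0 := by
  have h := (envPbw k).e_mul_of_ne
  change ∀ i j, i ≠ j → envE k i * envE k j = 0 at h
  rw [envDiag, envAnti, add_mul, mul_add, mul_add, h _ _ (by decide), h _ _ (by decide),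
    h _ _ (by decide), h _ _ (by decide)]
  simp

theorem envAnti_mul_envDiag : envAnti k * envDiag k = 0 := by
  have h := (envPbw k).e_mul_of_ne
  change ∀ i j, i ≠ j → envE k i * envE k j = 0 at h
  rw [envDiag, envAnti, add_mul, mul_add, mul_add, h _ _ (by decide), h _ _ (by decide),
    h _ _ (by decide), h _ _ (by decide)]
  simp

theorem envDiag_mul_self : envDiag k * envDiag k = envDiag k := by
  have := congrArg (envDiag k * ·) (envDiag_add_envAnti k)
  simpa [mul_add, envDiag_mul_envAnti] using this

theorem envAnti_mul_self : envAnti k * envAnti k = envAnti k := by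
  have := congrArg (envAnti k * ·) (envDiag_add_envAnti k)
  simpa [mul_add, envAnti_mul_envDiag] using this

theorem envD_mul_envF : envD k * envF k = envF k * envD k := by
  simp only [envD, envF, sub_mul, mul_sub, envX_comm k (.inl 0), envX_comm k (.inr 0)]
  abel

/-- Each of `u ⊗ 1` and `1 ⊗ u` changes the vertex in one factor only, so `envD` interchanges the
two idempotents, whereas `envF` commutes with both. This is why the resolution starts with `envDiag`
and ends with `envAnti`. -/
theorem envD_mul_envDiag : envD k * envDiag k = envAnti k * envD k := by
  have h := envE_mul_envX k
  simp only [envAnti, envD, envDiag, add_mul, mul_sub, h]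
  change _ = envX k (.inl 0) * envE k (.two, .two) + envX k (.inl 0) * envE k (.one, .one)
    - (envX k (.inr 0) * envE k (.one, .one) + envX k (.inr 0) * envE k (.two, .two))
  simp only [sub_mul, mul_add]
  abel

theorem envD_mul_envAnti : envD k * envAnti k = envDiag k * envD k := by
  have h := envE_mul_envX k
  simp only [envAnti, envD, envDiag, add_mul, mul_sub, h]
  change _ = envX k (.inl 0) * envE k (.two, .one) + envX k (.inl 0) * envE k (.one, .two)
    - (envX k (.inr 0) * envE k (.one, .two) + envX k (.inr 0) * envE k (.two, .one))
  simp only [sub_mul, mul_add]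
  abel

theorem envF_mul_envDiag : envF k * envDiag k = envDiag k * envF k := by
  have h := envE_mul_envX k
  simp only [envF, envDiag, add_mul, mul_sub, h]
  change _ = envX k (.inl 1) * envE k (.one, .one) + envX k (.inl 1) * envE k (.two, .two)
    - (envX k (.inr 1) * envE k (.one, .one) + envX k (.inr 1) * envE k (.two, .two))
  simp only [sub_mul, mul_add]
  abel

theorem envF_mul_envAnti : envF k * envAnti k = envAnti k * envF k := by
  have h := envE_mul_envX k
  simp only [envF, envAnti, add_mul, mul_sub, h]
  change _ = envX k (.inl 1) * envE k (.one, .two) + envX k (.inl 1) * envE k (.two, .one)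
    - (envX k (.inr 1) * envE k (.one, .two) + envX k (.inr 1) * envE k (.two, .one))
  simp only [sub_mul, mul_add]
  abel

/-! #### Regularity -/

theorem coord_mul_envD (x : Env k) (i : TwoVertex × TwoVertex) :
    (envPbw k).coord (x * envD k) i = (envPbw k).coord x i * (X (.inl 0) - X (.inr 0)) := by
  rw [← PBWData.coord_mul_ev, map_sub, PBWData.ev_X, PBWData.ev_X]
  rfl

theorem coord_mul_envF (x : Env k) (i : TwoVertex × TwoVertex) :
    (envPbw k).coord (x * envF k) i = (envPbw k).coord x i * (X (.inl 1) - X (.inr 1)) := by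
  rw [← PBWData.coord_mul_ev, map_sub, PBWData.ev_X, PBWData.ev_X]
  rfl

variable {k}

theorem eq_zero_of_mul_envD {x : Env k} (h : x * envD k = 0) : x = 0 := by
  refine (envPbw k).coord_injective (funext fun i => ?_)
  have := coord_mul_envD k x i
  rw [h, map_zero, Pi.zero_apply, eq_comm, mul_eq_zero] at this
  rw [map_zero]
  exact this.resolve_right (sub_ne_zero.2 fun h => by simpa using X_injective h)

/-- Koszul exactness for a regular sequence: in each coordinate the polynomial statement makes `x`
divisible by the difference that represents `envD`. The formula for `y` follows by cancelling
`envD`. -/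
theorem exists_of_mul_envF_eq {x y : Env k} (h : x * envF k = y * envD k) :
    ∃ z, x = z * envD k ∧ y = z * envF k := by
  have key : ∀ i, X (.inl 0) - X (.inr 0) ∣ (envPbw k).coord x i := fun i => by
    refine X_sub_X_dvd_of_mul_eq_mul (c := .inl 1) (d := .inr 1) (by simp) (by simp) (by simp)
      (by simp) (q := (envPbw k).coord y i) ?_
    rw [← coord_mul_envF, ← coord_mul_envD, h]
  choose w hw using key
  have hx : x = (envPbw k).ofCoord w * envD k := by
    refine (envPbw k).coord_injective (funext fun i => ?_)
    rw [coord_mul_envD, PBWData.coord_ofCoord, hw, mul_comm]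
  refine ⟨_, hx, ?_⟩
  rw [← sub_eq_zero]
  apply eq_zero_of_mul_envD
  rw [sub_mul, ← h, mul_assoc, ← envD_mul_envF, ← mul_assoc, ← hx, sub_self]

/-! #### The multiplication map -/

variable (k) in
/-- The multiplication map `a ⊗ b ↦ a * b`. -/
def envMul : Env k →ₗ[k] TwoVertexAlgebra k :=
  LinearMap.mul' k _ ∘ₗ TensorProduct.map LinearMap.id (opLinearEquiv k).symm.toLinearMap

theorem envMul_tmul (a b : TwoVertexAlgebra k) : envMul k (a ⊗ₜ op b) = a * b := rfl

theorem envMul_tmul_mul (a b : TwoVertexAlgebra k) (x : Env k) :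
    envMul k ((a ⊗ₜ op b) * x) = a * envMul k x * b := by
  induction x using TensorProduct.induction_on with
  | zero => simp
  | add x y hx hy => simp only [mul_add, map_add, hx, hy, add_mul]
  | tmul c d =>
    obtain ⟨d, rfl⟩ := op_surjective d
    rw [Algebra.TensorProduct.tmul_mul_tmul, ← op_mul, envMul_tmul, envMul_tmul]
    simp only [mul_assoc]

theorem envMul_mul_eq_zero (x : Env k) {y : Env k} (hy : ∀ a b : TwoVertexAlgebra k,
    a * envMul k y * b = 0) : envMul k (x * y) = 0 := by
  induction x using TensorProduct.induction_on with
  | zero => simp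
  | add x y hx hy => simp only [add_mul, map_add, hx, hy, add_zero]
  | tmul c d =>
    obtain ⟨d, rfl⟩ := op_surjective d
    rw [envMul_tmul_mul, hy]

theorem envMul_envDiag : envMul k (envDiag k) = 1 := by
  rw [envDiag, map_add, envE, envE, envMul_tmul, envMul_tmul, f_mul_self, f_mul_self, ← sum_f k,
    TwoVertex.sum_eq]

theorem envMul_envD_mul_envDiag : envMul k (envD k * envDiag k) = 0 := by
  rw [envD_eq, sub_mul, map_sub, ← op_one, envMul_tmul_mul, envMul_tmul_mul, envMul_envDiag]
  simp

theorem envMul_envF_mul_envDiag : envMul k (envF k * envDiag k) = 0 := by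
  rw [envF_eq, sub_mul, map_sub, ← op_one, envMul_tmul_mul, envMul_tmul_mul, envMul_envDiag]
  simp

theorem envMul_mul_envDiag_eq_zero (x : Env k) :
    envMul k (x * ((envD k + envF k) * envDiag k)) = 0 := by
  refine envMul_mul_eq_zero x fun a b => ?_
  rw [add_mul, map_add, envMul_envD_mul_envDiag, envMul_envF_mul_envDiag]
  simp

theorem tmul_mul_envD (a b : TwoVertexAlgebra k) :
    (a ⊗ₜ op b) * envD k = (a * u k) ⊗ₜ op b - a ⊗ₜ op (u k * b) := by
  rw [envD_eq, mul_sub, Algebra.TensorProduct.tmul_mul_tmul, Algebra.TensorProduct.tmul_mul_tmul,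
    mul_one, mul_one, ← op_mul]

theorem tmul_mul_envF (a b : TwoVertexAlgebra k) :
    (a ⊗ₜ op b) * envF k = (a * v k) ⊗ₜ op b - a ⊗ₜ op (v k * b) := by
  rw [envF_eq, mul_sub, Algebra.TensorProduct.tmul_mul_tmul, Algebra.TensorProduct.tmul_mul_tmul,
    mul_one, mul_one, ← op_mul]

/-- Modulo the left ideal generated by `envD` and `envF`, every element of the enveloping algebra
is a sum of elements `a ⊗ f i`. -/
theorem exists_env_normal_form (r : Env k) : ∃ (a b : Env k) (c : TwoVertex → TwoVertexAlgebra k),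
    r = a * envD k + b * envF k + ∑ i, c i ⊗ₜ op (f k i) := by
  let P : Env k → Prop := fun r => ∃ (a b : Env k) (c : TwoVertex → TwoVertexAlgebra k),
    r = a * envD k + b * envF k + ∑ i, c i ⊗ₜ op (f k i)
  have h0 : P 0 := ⟨0, 0, 0, by simp⟩
  have hadd : ∀ r s, P r → P s → P (r + s) := by
    rintro _ _ ⟨a, b, c, rfl⟩ ⟨a', b', c', rfl⟩
    refine ⟨a + a', b + b', c + c', ?_⟩
    simp only [add_mul, Pi.add_apply, TensorProduct.add_tmul, Finset.sum_add_distrib]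
    abel
  have hD : ∀ r a, P r → P (r - a * envD k) := by
    rintro _ x ⟨a, b, c, rfl⟩
    refine ⟨a - x, b, c, ?_⟩
    rw [sub_mul]
    abel
  have hF : ∀ r a, P r → P (r - a * envF k) := by
    rintro _ x ⟨a, b, c, rfl⟩
    refine ⟨a, b - x, c, ?_⟩
    rw [sub_mul]
    abel
  -- The variables of the second factor are moved to the first one by one: `a ⊗ (u * b)` equals `(a
  -- * u) ⊗ b` modulo `envD`, and likewise for `v` modulo `envF`.
  have hf : ∀ (p : MvPolynomial (Fin 2) k) (i : TwoVertex) (a : TwoVertexAlgebra k),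
      P (a ⊗ₜ op (f k i * (pbw k).ev p)) := by
    intro p
    induction p using MvPolynomial.induction_on with
    | C c =>
      intro i a
      refine ⟨0, 0, Pi.single i (c • a), ?_⟩
      rw [Finset.sum_eq_single i (fun j _ hj => by rw [Pi.single_eq_of_ne hj,
        TensorProduct.zero_tmul]) (by simp), Pi.single_eq_same, ← algebraMap_eq, AlgHom.commutes,
        ← Algebra.commutes, ← Algebra.smul_def, op_smul, TensorProduct.tmul_smul,
        TensorProduct.smul_tmul']
      simp
    | add p q hp hq =>
      intro i a
      rw [map_add, mul_add, op_add, TensorProduct.tmul_add]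
      exact hadd _ _ (hp i a) (hq i a)
    | mul_X p j hp =>
      intro i a
      rw [mul_comm, map_mul, PBWData.ev_X, ← mul_assoc,
        show f k i * (pbw k).x j = (pbw k).x j * f k ((pbw k).σ j i) from (pbw k).e_mul_x i j,
        mul_assoc]
      fin_cases j
      · have := hD _ (a ⊗ₜ op (f k (TwoVertex.swap i) * (pbw k).ev p)) (hp (TwoVertex.swap i) (a * u k))
        rw [tmul_mul_envD, sub_sub_cancel] at this
        exact this
      · have := hF _ (a ⊗ₜ op (f k i * (pbw k).ev p)) (hp i (a * v k))
        rw [tmul_mul_envF, sub_sub_cancel] at this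
        exact this
  change P r
  induction r using TensorProduct.induction_on with
  | zero => exact h0
  | add x y hx hy => exact hadd _ _ hx hy
  | tmul a b =>
    obtain ⟨b, rfl⟩ := op_surjective b
    induction b using PBWData.induction_on (P := pbw k) with
    | h i p => exact hf p i a
    | h0 => rw [op_zero, TensorProduct.tmul_zero]; exact h0
    | hadd r s hr hs => rw [op_add, TensorProduct.tmul_add]; exact hadd _ _ hr hs

theorem tmul_mul_envDiag (a : TwoVertexAlgebra k) (i : TwoVertex) :
    (a ⊗ₜ op (f k i)) * envDiag k = (a * f k i) ⊗ₜ op (f k i) := by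
  have h12 := f_mul_of_ne k .one .two (by decide)
  have h21 := f_mul_of_ne k .two .one (by decide)
  cases i <;>
    simp [envDiag, envE, mul_add, Algebra.TensorProduct.tmul_mul_tmul, ← op_mul, f_mul_self, h12, h21]

/-- Exactness at the first term. After cutting by `envDiag`, the remainder of the normal form is a
sum of elements `(c i * f i) ⊗ f i`. The multiplication map sends it to `∑ c i * f i`, whose
summands are separated by the idempotents, so they all vanish. -/
theorem exists_of_envMul_eq_zero {r : Env k} (hr : r * envDiag k = r) (h : envMul k r = 0) :
    ∃ w, w * ((envD k + envF k) * envDiag k) = r := by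
  obtain ⟨a, b, c, hc⟩ := exists_env_normal_form r
  have hr' : r = a * (envD k * envDiag k) + b * (envF k * envDiag k)
      + ∑ i, (c i * f k i) ⊗ₜ op (f k i) := by
    conv_lhs => rw [← hr, hc]
    simp only [add_mul, Finset.sum_mul, tmul_mul_envDiag, mul_assoc]
  have hsum : ∑ i, c i * f k i = 0 := by
    rw [hr', map_add, map_add, envMul_mul_eq_zero a (by simp [envMul_envD_mul_envDiag]),
      envMul_mul_eq_zero b (by simp [envMul_envF_mul_envDiag]), map_sum] at h
    simpa [envMul_tmul, mul_assoc, f_mul_self] using h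
  have hci : ∀ i, c i * f k i = 0 := fun i => by
    have := congrArg (· * f k i) hsum
    simp only [Finset.sum_mul, zero_mul, mul_assoc] at this
    rw [Finset.sum_eq_single i (fun j _ hj => by rw [f_mul_of_ne k j i hj, mul_zero])
      (by simp), f_mul_self] at this
    exact this
  simp only [hci, TensorProduct.zero_tmul, Finset.sum_const_zero, add_zero] at hr'
  -- The `envAnti` part of the middle term sees only `envD` and the `envDiag` part only `envF`, so
  -- the cross terms drop out.
  refine ⟨a * envAnti k + b * envDiag k, ?_⟩
  have h1 : envAnti k * (envD k * envDiag k) = envD k * envDiag k := by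
    rw [envD_mul_envDiag, ← mul_assoc, envAnti_mul_self]
  have h2 : envAnti k * (envF k * envDiag k) = 0 := by
    rw [envF_mul_envDiag, ← mul_assoc, envAnti_mul_envDiag, zero_mul]
  have h3 : envDiag k * (envD k * envDiag k) = 0 := by
    rw [envD_mul_envDiag, ← mul_assoc, envDiag_mul_envAnti, zero_mul]
  have h4 : envDiag k * (envF k * envDiag k) = envF k * envDiag k := by
    rw [envF_mul_envDiag, ← mul_assoc, envDiag_mul_self]
  simp only [hr', add_mul, mul_assoc, mul_add, h1, h2, h3, h4, mul_zero, add_zero, zero_add]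

/-- Exactness at the middle term. Splitting `w` by the two idempotents turns the hypothesis into `w
ε' D = -w ε F`, and the Koszul lemma yields `z` with `w ε' = z F` and `-w ε = z D`. Cutting `z` down
by `ε'` does not disturb these equations. -/
theorem exists_of_mul_eq_zero {w : Env k} (h : w * ((envD k + envF k) * envDiag k) = 0) :
    ∃ z, z * envAnti k = z ∧ z * (envF k - envD k) = w := by
  have h1 : w * envAnti k * envD k = (0 - w * envDiag k) * envF k := by
    rw [mul_assoc, ← envD_mul_envDiag, sub_mul, zero_mul, mul_assoc, ← envF_mul_envDiag,
      eq_sub_iff_add_eq, ← mul_add, ← add_mul, h]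
  obtain ⟨z, hz1, hz2⟩ := exists_of_mul_envF_eq h1.symm
  refine ⟨z * envAnti k, by rw [mul_assoc, envAnti_mul_self], ?_⟩
  have h2 : z * envAnti k * envF k = w * envAnti k := by
    rw [mul_assoc, ← envF_mul_envAnti, ← mul_assoc, ← hz2, mul_assoc, envAnti_mul_self]
  have h3 : z * envAnti k * envD k = 0 - w * envDiag k := by
    rw [mul_assoc, ← envD_mul_envDiag, ← mul_assoc, ← hz1, sub_mul, mul_assoc, envDiag_mul_self,
      zero_mul]
  rw [mul_sub, h2, h3, ← sub_add, sub_zero, ← mul_add, add_comm (envAnti k), envDiag_add_envAnti,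
    mul_one]

/-- Injectivity at the last term: `z F` lies in the `envAnti` part and `z D` in the `envDiag` part,
so their equality makes both vanish, and `envD` can be cancelled. -/
theorem eq_zero_of_mul_sub_eq_zero {z : Env k} (hz : z * envAnti k = z)
    (h : z * (envF k - envD k) = 0) : z = 0 := by
  apply eq_zero_of_mul_envD
  have h1 : z * envF k = z * envD k := by rwa [mul_sub, sub_eq_zero] at h
  have h2 := congrArg (· * envAnti k) h1
  simp only [mul_assoc, envF_mul_envAnti, envD_mul_envAnti] at h2
  have h3 : z * envDiag k = 0 := by rw [← hz, mul_assoc, envAnti_mul_envDiag, mul_zero]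
  rw [← mul_assoc, hz, ← mul_assoc, h3, zero_mul, h1] at h2
  exact h2

end TwoVertexAlgebra

/-! ### The exchange automorphism and the dual complex -/

namespace TwoVertexAlgebra

open MulOpposite

section Automorphism

variable (k : Type*) [Field k]

/-- The algebra map that exchanges the two vertices. -/
def exchangeHom : TwoVertexAlgebra k →ₐ[k] TwoVertexAlgebra k :=
  lift (fun i => f k (TwoVertex.swap i)) (u k) (v k) (fun _ => f_mul_self k _)
    (fun _ _ h => f_mul_of_ne k _ _ fun h' => h (TwoVertex.swap.injective h'))
    ((Equiv.sum_comp TwoVertex.swap (f k)).trans (sum_f k))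
    (fun _ => f_mul_u k _) (fun _ => f_mul_v k _) (u_mul_v k)

@[simp] theorem exchangeHom_f (i : TwoVertex) :
    exchangeHom k (f k i) = f k (TwoVertex.swap i) := lift_f ..
@[simp] theorem exchangeHom_u : exchangeHom k (u k) = u k := lift_u ..
@[simp] theorem exchangeHom_v : exchangeHom k (v k) = v k := lift_v ..

theorem exchangeHom_comp_self : (exchangeHom k).comp (exchangeHom k) = AlgHom.id k _ :=
  algHom_ext (by simp) (by simp) (by simp)

/-- The automorphism that exchanges the two vertices. -/
def exchange : TwoVertexAlgebra k ≃ₐ[k] TwoVertexAlgebra k :=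
  AlgEquiv.ofAlgHom (exchangeHom k) (exchangeHom k) (exchangeHom_comp_self k)
    (exchangeHom_comp_self k)

theorem exchange_f (i : TwoVertex) : exchange k (f k i) = f k (TwoVertex.swap i) :=
  exchangeHom_f k i
theorem exchange_u : exchange k (u k) = u k := exchangeHom_u k
theorem exchange_v : exchange k (v k) = v k := exchangeHom_v k

theorem exchange_u₁ : exchange k (u₁ k) = u₂ k := by
  rw [← f_one_mul_u, map_mul, exchange_f, exchange_u, TwoVertex.swap_one, f_two_mul_u]
theorem exchange_u₂ : exchange k (u₂ k) = u₁ k := by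
  rw [← f_two_mul_u, map_mul, exchange_f, exchange_u, TwoVertex.swap_two, f_one_mul_u]
theorem exchange_v₁ : exchange k (v₁ k) = v₂ k := by
  rw [← f_one_mul_v, map_mul, exchange_f, exchange_v, TwoVertex.swap_one, f_two_mul_v]
theorem exchange_v₂ : exchange k (v₂ k) = v₁ k := by
  rw [← f_two_mul_v, map_mul, exchange_f, exchange_v, TwoVertex.swap_two, f_one_mul_v]

/-- The antiautomorphism `a ⊗ b ↦ b ⊗ μ a` of the enveloping algebra. -/
def envFlip : Env k →ₗ[k] Env k :=
  TensorProduct.lift (LinearMap.mk₂ k (fun a b => unop b ⊗ₜ op (exchange k a))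
    (fun a a' b => by simp [TensorProduct.tmul_add])
    (fun c a b => by simp) (fun a b b' => by simp [TensorProduct.add_tmul])
    (fun c a b => by simp [TensorProduct.smul_tmul']))

/-- The inverse `a ⊗ b ↦ μ b ⊗ a` of `envFlip`. -/
def envUnflip : Env k →ₗ[k] Env k :=
  TensorProduct.lift (LinearMap.mk₂ k (fun a b => exchange k (unop b) ⊗ₜ op a)
    (fun a a' b => by simp [TensorProduct.tmul_add])
    (fun c a b => by simp) (fun a b b' => by simp [TensorProduct.add_tmul])
    (fun c a b => by simp [TensorProduct.smul_tmul']))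

variable {k}

theorem envFlip_tmul (a b : TwoVertexAlgebra k) :
    envFlip k (a ⊗ₜ op b) = b ⊗ₜ op (exchange k a) := rfl

theorem envUnflip_tmul (a b : TwoVertexAlgebra k) :
    envUnflip k (a ⊗ₜ op b) = exchange k b ⊗ₜ op a := rfl

theorem exchange_exchange (a : TwoVertexAlgebra k) : exchange k (exchange k a) = a :=
  (exchange k).left_inv a

theorem envUnflip_envFlip (x : Env k) : envUnflip k (envFlip k x) = x := by
  induction x using TensorProduct.induction_on with
  | zero => simp
  | add x y hx hy => simp only [map_add, hx, hy]
  | tmul a b =>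
    obtain ⟨b, rfl⟩ := op_surjective b
    rw [envFlip_tmul, envUnflip_tmul, exchange_exchange]

theorem envFlip_envUnflip (x : Env k) : envFlip k (envUnflip k x) = x := by
  induction x using TensorProduct.induction_on with
  | zero => simp
  | add x y hx hy => simp only [map_add, hx, hy]
  | tmul a b =>
    obtain ⟨b, rfl⟩ := op_surjective b
    rw [envUnflip_tmul, envFlip_tmul, exchange_exchange]

theorem envFlip_injective : Function.Injective (envFlip k) :=
  Function.LeftInverse.injective envUnflip_envFlip

theorem envFlip_mul (x y : Env k) : envFlip k (x * y) = envFlip k y * envFlip k x := by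
  induction x using TensorProduct.induction_on with
  | zero => simp
  | add x x' hx hx' => simp only [map_add, add_mul, mul_add, hx, hx']
  | tmul a b =>
    induction y using TensorProduct.induction_on with
    | zero => simp
    | add x x' hx hx' => simp only [map_add, add_mul, mul_add, hx, hx']
    | tmul c d =>
      obtain ⟨b, rfl⟩ := op_surjective b
      obtain ⟨d, rfl⟩ := op_surjective d
      rw [Algebra.TensorProduct.tmul_mul_tmul, ← op_mul, envFlip_tmul, envFlip_tmul, envFlip_tmul,
        Algebra.TensorProduct.tmul_mul_tmul, ← op_mul, map_mul]

theorem envFlip_envD : envFlip k (envD k) = 0 - envD k := by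
  rw [envD_eq, map_sub, ← op_one, envFlip_tmul, envFlip_tmul, exchange_u, map_one, op_one]
  abel

theorem envFlip_envF : envFlip k (envF k) = 0 - envF k := by
  rw [envF_eq, map_sub, ← op_one, envFlip_tmul, envFlip_tmul, exchange_v, map_one, op_one]
  abel

/-- Applying the exchange to one factor is what interchanges the two idempotents, and with them the
two ends of the resolution. -/
theorem envFlip_envDiag : envFlip k (envDiag k) = envAnti k := by
  rw [envDiag, envAnti, envE, envE, envE, envE, map_add, envFlip_tmul, envFlip_tmul, exchange_f,
    exchange_f]
  rfl

theorem envFlip_envAnti : envFlip k (envAnti k) = envDiag k := by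
  rw [envDiag, envAnti, envE, envE, envE, envE, map_add, envFlip_tmul, envFlip_tmul, exchange_f,
    exchange_f]
  exact add_comm _ _

/-! #### Exactness of the dual complex -/

/-- The flip turns this into injectivity at the last term of the resolution, up to a sign: `z (F +
D) = 0` with `z` in the `envAnti` part. As before, the two summands lie in complementary parts. -/
theorem eq_zero_of_mul_left_eq_zero {w : Env k} (hw : envDiag k * w = w)
    (h : (envD k + envF k) * w = 0) : w = 0 := by
  apply envFlip_injective
  rw [map_zero]
  have h1 := congrArg (envFlip k) hw
  have h2 := congrArg (envFlip k) h
  rw [envFlip_mul, envFlip_envDiag] at h1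
  rw [envFlip_mul, map_add, envFlip_envD, envFlip_envF, map_zero] at h2
  set z := envFlip k w
  apply eq_zero_of_mul_envD
  have h3 : z * envF k + z * envD k = 0 := by
    have : z * envF k + z * envD k = 0 - z * (0 - envD k + (0 - envF k)) := by
      simp only [mul_add, mul_sub, mul_zero]
      abel
    rw [this, h2, sub_zero]
  have h4 := congrArg (· * envDiag k) h3
  have h5 : z * envDiag k = 0 := by rw [← h1, mul_assoc, envAnti_mul_envDiag, mul_zero]
  simp only [zero_mul, add_mul, mul_assoc, envF_mul_envDiag, envD_mul_envDiag] at h4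
  rwa [← mul_assoc, h5, zero_mul, zero_add, ← mul_assoc, h1] at h4

/-- The flip of exactness at the middle term of the resolution, again up to a sign. -/
theorem exists_of_mul_left_eq_zero {a : Env k} (h : envAnti k * ((envF k - envD k) * a) = 0) :
    ∃ w, envDiag k * w = w ∧ (envD k + envF k) * w = a := by
  have h1 := congrArg (envFlip k) h
  rw [envFlip_mul, envFlip_mul, envFlip_envAnti, map_sub, envFlip_envD, envFlip_envF, map_zero,
    mul_assoc] at h1
  set b := envFlip k a with hb
  -- The flipped hypothesis is `b (D - F) ε = 0`. The factor `ε - ε'` corrects the sign, since `(ε -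
  -- ε') (D + F) ε = (F - D) ε`.
  have h2 : b * (envDiag k - envAnti k) * ((envD k + envF k) * envDiag k) = 0 := by
    have : (envDiag k - envAnti k) * ((envD k + envF k) * envDiag k)
        + (0 - envF k - (0 - envD k)) * envDiag k = 0 := by
      simp only [add_mul, sub_mul, mul_add, envF_mul_envDiag, envD_mul_envDiag, ← mul_assoc,
        envDiag_mul_envAnti, envAnti_mul_envDiag, envDiag_mul_self, envAnti_mul_self, zero_mul]
      abel
    have h3 := congrArg (b * ·) this
    simp only [mul_add b, h1, add_zero, mul_zero] at h3
    rw [mul_assoc, h3]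
  obtain ⟨z, hz, hzb⟩ := exists_of_mul_eq_zero h2
  have hzd : z * envDiag k = 0 := by rw [← hz, mul_assoc, envAnti_mul_envDiag, mul_zero]
  have h3 := congrArg (· * envDiag k) hzb
  have h4 := congrArg (· * envAnti k) hzb
  simp only [mul_assoc, sub_mul, envF_mul_envDiag, envD_mul_envDiag, envDiag_mul_self,
    envAnti_mul_envDiag, sub_zero] at h3
  simp only [mul_assoc, sub_mul, envF_mul_envAnti, envD_mul_envAnti, envDiag_mul_envAnti,
    envAnti_mul_self] at h4
  rw [mul_sub, ← mul_assoc, hzd, ← mul_assoc, hz, zero_mul] at h3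
  rw [mul_sub, ← mul_assoc, hz, ← mul_assoc, hzd, zero_mul, sub_zero, mul_sub, mul_zero] at h4
  refine ⟨envUnflip k z, envFlip_injective ?_, envFlip_injective ?_⟩
  · rw [envFlip_mul, envFlip_envUnflip, envFlip_envDiag, hz]
  · rw [envFlip_mul, envFlip_envUnflip, map_add, envFlip_envD, envFlip_envF, ← hb, mul_add, mul_sub,
      mul_sub, mul_zero, h3, h4, ← sub_add, sub_zero, zero_add, ← mul_add, envDiag_add_envAnti,
      mul_one]

/-- After the flip this is exactness of the resolution at its first term. It identifies the cokernel
of the last dual differential with the two-vertex algebra. -/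
theorem envMul_envFlip_eq_zero_iff {y : Env k} (hy : envAnti k * y = y) :
    envMul k (envFlip k y) = 0 ↔ ∃ a, envAnti k * ((envF k - envD k) * a) = y := by
  have key : ∀ a, envFlip k (envAnti k * ((envF k - envD k) * a))
      = envFlip k a * (envD k * envDiag k - envF k * envDiag k) := fun a => by
    rw [envFlip_mul, envFlip_mul, envFlip_envAnti, map_sub, envFlip_envD, envFlip_envF, mul_assoc,
      ← sub_mul]
    congr 2
    abel
  constructor
  · intro h
    have h1 : envFlip k y * envDiag k = envFlip k y := by
      conv_rhs => rw [← hy, envFlip_mul, envFlip_envAnti]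
    obtain ⟨b, hb⟩ := exists_of_envMul_eq_zero h1 h
    -- The sign correction here is `(ε' - ε) (D - F) ε = (D + F) ε`.
    refine ⟨envUnflip k (b * (envAnti k - envDiag k)), envFlip_injective ?_⟩
    rw [key, envFlip_envUnflip, ← hb, mul_assoc]
    congr 1
    simp only [add_mul, sub_mul, mul_sub, envF_mul_envDiag, envD_mul_envDiag, ← mul_assoc,
      envDiag_mul_envAnti, envAnti_mul_envDiag, envDiag_mul_self, envAnti_mul_self, zero_mul]
    abel
  · rintro ⟨a, rfl⟩
    rw [key]
    refine envMul_mul_eq_zero _ fun a b => ?_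
    rw [map_sub, envMul_envD_mul_envDiag, envMul_envF_mul_envDiag]
    simp

/-- The origin of the Nakayama automorphism: the flip turns right multiplication by `a ⊗ b` into
left multiplication by `b ⊗ μ(a)`. -/
theorem envMul_envFlip_mul_tmul (y : Env k) (a b : TwoVertexAlgebra k) :
    envMul k (envFlip k (y * (a ⊗ₜ op b))) = b * envMul k (envFlip k y) * exchange k a := by
  rw [envFlip_mul, envFlip_tmul, envMul_tmul_mul]

theorem envMul_envFlip_envAnti_mul (b : TwoVertexAlgebra k) :
    envMul k (envFlip k (envAnti k * (1 ⊗ₜ op b))) = b := by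
  rw [envMul_envFlip_mul_tmul, envFlip_envAnti, envMul_envDiag, map_one, mul_one, mul_one]

end Automorphism

end TwoVertexAlgebra

/-! ### Left ideals generated by an idempotent -/

section IdempotentIdeal

variable {S : Type*} [Ring S]

/-- The left ideal of the elements that an idempotent fixes from the right. -/
def idempotentIdeal (ε : S) : Submodule S S where
  carrier := {x | x * ε = x}
  add_mem' {x y} hx hy := by
    change (x + y) * ε = x + y
    rw [add_mul, show x * ε = x from hx, show y * ε = y from hy]
  zero_mem' := zero_mul ε
  smul_mem' c x hx := by
    change c * x * ε = c * x
    rw [mul_assoc, show x * ε = x from hx]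

theorem mem_idempotentIdeal {ε x : S} : x ∈ idempotentIdeal ε ↔ x * ε = x := Iff.rfl

/-- Right multiplication by an element that an idempotent fixes from the right. -/
def mulRightIdempotentIdeal (ε y : S) (hy : y * ε = y) : S →ₗ[S] idempotentIdeal ε :=
  (LinearMap.toSpanSingleton S S y).codRestrict _ fun x => by
    rw [mem_idempotentIdeal, LinearMap.toSpanSingleton_apply, smul_eq_mul, mul_assoc, hy]

theorem coe_mulRightIdempotentIdeal (ε y : S) (hy : y * ε = y) (x : S) :
    (mulRightIdempotentIdeal ε y hy x : S) = x * y := rfl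

variable {ε : S} (hε : ε * ε = ε)

theorem mulRightIdempotentIdeal_comp_subtype :
    mulRightIdempotentIdeal ε ε hε ∘ₗ (idempotentIdeal ε).subtype = LinearMap.id :=
  LinearMap.ext fun x => Subtype.ext x.2

theorem idempotentIdeal_projective (hε : ε * ε = ε) :
    Module.Projective S (idempotentIdeal ε) :=
  Module.Projective.of_split _ _ (mulRightIdempotentIdeal_comp_subtype hε)

theorem idempotentIdeal_finite (hε : ε * ε = ε) : Module.Finite S (idempotentIdeal ε) :=
  Module.Finite.of_surjective (mulRightIdempotentIdeal ε ε hε) fun x => ⟨x, Subtype.ext x.2⟩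

/-- The generator of the left ideal. -/
def idempotentIdealGen : idempotentIdeal ε := ⟨ε, hε⟩

theorem eq_smul_idempotentIdealGen (x : idempotentIdeal ε) :
    x = (x : S) • idempotentIdealGen hε := Subtype.ext x.2.symm

/-- The linear map out of the left ideal that sends the generator `ε` to an element `y` with
`ε * y = y`. -/
def idempotentIdealLift (ε y : S) : idempotentIdeal ε →ₗ[S] S :=
  LinearMap.toSpanSingleton S S y ∘ₗ (idempotentIdeal ε).subtype

theorem linearMap_idempotentIdeal_apply {M : Type*} [AddCommGroup M] [Module S M]
    (g : idempotentIdeal ε →ₗ[S] M) (x : idempotentIdeal ε) :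
    g x = (x : S) • g (idempotentIdealGen hε) := by
  conv_lhs => rw [eq_smul_idempotentIdealGen hε x, map_smul]

/-- A map out of the left ideal is determined by the value at `ε`; together with this constraint on
the value, it identifies the dual of the left ideal `S ε` with the right ideal `ε S`. -/
theorem mul_linearMap_idempotentIdealGen (g : idempotentIdeal ε →ₗ[S] S) :
    ε * g (idempotentIdealGen hε) = g (idempotentIdealGen hε) :=
  (linearMap_idempotentIdeal_apply hε g (idempotentIdealGen hε)).symm

end IdempotentIdeal

/-! ### The bimodule resolution and the twisted Calabi–Yau property -/

namespace TwoVertexAlgebra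

open CategoryTheory MulOpposite

universe u

variable (k : Type u) [Field k]

theorem envMul_mul (x y : Env k) :
    letI := instModuleTensorProductMop k (TwoVertexAlgebra k)
    envMul k (x * y) = x • envMul k y := by
  let := instModuleTensorProductMop k (TwoVertexAlgebra k)
  induction x using TensorProduct.induction_on with
  | zero => rw [zero_mul, map_zero]; exact (zero_smul (Env k) (envMul k y)).symm
  | add x y hx hy => rw [add_mul, map_add, hx, hy]; exact (add_smul x y _).symm
  | tmul b c =>
    obtain ⟨c, rfl⟩ := op_surjective c
    rw [envMul_tmul_mul, TensorProduct.Algebra.smul_def, mul_assoc]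
    rfl

/-- The augmentation of the resolution, the restriction of the multiplication map. -/
def augmentation :
    ModuleCat.of (Env k) (idempotentIdeal (envDiag k)) ⟶ diagonalBimodule k (TwoVertexAlgebra k) :=
  letI := instModuleTensorProductMop k (TwoVertexAlgebra k)
  ModuleCat.ofHom (X := idempotentIdeal (envDiag k)) (Y := TwoVertexAlgebra k)
    { toFun := fun x => envMul k (x : Env k)
      map_add' := fun x y => map_add (envMul k) (x : Env k) y
      map_smul' := fun c x => envMul_mul k c x }

/-- The first differential of the resolution. -/
def diffOne :
    ModuleCat.of (Env k) (Env k) ⟶ ModuleCat.of (Env k) (idempotentIdeal (envDiag k)) :=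
  ModuleCat.ofHom (mulRightIdempotentIdeal (envDiag k) ((envD k + envF k) * envDiag k)
    (by rw [mul_assoc, envDiag_mul_self]))

/-- The second differential of the resolution. -/
def diffTwo :
    ModuleCat.of (Env k) (idempotentIdeal (envAnti k)) ⟶ ModuleCat.of (Env k) (Env k) :=
  ModuleCat.ofHom (idempotentIdealLift (envAnti k) (envF k - envD k))

/-- As `D` and `F` commute, the product of the two middle factors is `F² - D²`. Both squares commute
with `ε`, because `D` interchanges the idempotents, and `ε' ε = 0`. -/
theorem sub_mul_add_mul_envDiag :
    envAnti k * ((envF k - envD k) * ((envD k + envF k) * envDiag k)) = 0 := by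
  have h1 : (envF k - envD k) * (envD k + envF k) = envF k * envF k - envD k * envD k := by
    simp only [sub_mul, mul_add, envD_mul_envF]
    abel
  rw [← mul_assoc (envF k - envD k), h1, sub_mul, mul_assoc, mul_assoc, envF_mul_envDiag,
    envD_mul_envDiag, ← mul_assoc (envF k), ← mul_assoc (envD k), envF_mul_envDiag, envD_mul_envAnti,
    mul_sub, ← mul_assoc, ← mul_assoc, ← mul_assoc, ← mul_assoc, envAnti_mul_envDiag]
  simp

/-- The projective bimodule resolution of the two-vertex algebra. -/
def resolution : LengthTwoResolution (diagonalBimodule k (TwoVertexAlgebra k)) where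
  P₀ := ModuleCat.of (Env k) (idempotentIdeal (envDiag k))
  P₁ := ModuleCat.of (Env k) (Env k)
  P₂ := ModuleCat.of (Env k) (idempotentIdeal (envAnti k))
  d₁ := diffOne k
  d₂ := diffTwo k
  π := augmentation k
  zero₁ := by
    refine ModuleCat.hom_ext (LinearMap.ext fun x => Subtype.ext ?_)
    change (x : Env k) * (envF k - envD k) * ((envD k + envF k) * envDiag k) = 0
    rw [← show (x : Env k) * envAnti k = x from x.2, mul_assoc, mul_assoc, sub_mul_add_mul_envDiag,
      mul_zero]
  zero₀ := by
    refine ModuleCat.hom_ext (LinearMap.ext fun x => ?_)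
    exact envMul_mul_envDiag_eq_zero (x : Env k)
  mono := by
    rw [ModuleCat.mono_iff_ker_eq_bot, LinearMap.ker_eq_bot']
    intro x hx
    exact Subtype.ext (eq_zero_of_mul_sub_eq_zero x.2 hx)
  exact₁ := by
    rw [ShortComplex.moduleCat_exact_iff]
    intro x hx
    obtain ⟨z, hz, h⟩ := exists_of_mul_eq_zero (congrArg Subtype.val hx)
    exact ⟨⟨z, hz⟩, h⟩
  exact₀ := by
    rw [ShortComplex.moduleCat_exact_iff]
    intro x hx
    obtain ⟨w, hw⟩ := exists_of_envMul_eq_zero x.2 hx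
    exact ⟨w, Subtype.ext hw⟩
  epi := by
    rw [ModuleCat.epi_iff_surjective]
    intro (a : TwoVertexAlgebra k)
    refine ⟨⟨a ⊗ₜ 1 * envDiag k, ?_⟩, ?_⟩
    · rw [mem_idempotentIdeal, mul_assoc, envDiag_mul_self]
    · change envMul k (a ⊗ₜ op 1 * envDiag k) = a
      rw [envMul_tmul_mul, envMul_envDiag, mul_one, mul_one]
  proj₀ := by
    have := idempotentIdeal_projective (envDiag_mul_self k)
    exact (IsProjective.iff_projective _).1 this
  proj₁ := (IsProjective.iff_projective _).1 inferInstance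
  proj₂ := by
    have := idempotentIdeal_projective (envAnti_mul_self k)
    exact (IsProjective.iff_projective _).1 this

theorem isHomologicallySmooth : IsHomologicallySmooth k (TwoVertexAlgebra k) := by
  refine ⟨(resolution k).toProjectiveResolution, fun i => ?_, 2, (resolution k).isZero_complex_X⟩
  match i with
  | 0 => exact idempotentIdeal_finite (envDiag_mul_self k)
  | 1 => exact Module.Finite.self (Env k)
  | 2 => exact idempotentIdeal_finite (envAnti_mul_self k)
  | i + 3 =>
    have := ModuleCat.subsingleton_of_isZero ((resolution k).isZero_complex_X (i + 3) (by omega))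
    infer_instance

/-- The value of a morphism from the last term of the resolution, as an element of the two-vertex
algebra. -/
def evalTwo : ((resolution k).P₂ ⟶ envelopingModule k (TwoVertexAlgebra k)) →+
    TwoVertexAlgebra k :=
  AddMonoidHom.mk' (fun g => envMul k (envFlip k
    ((g.hom : idempotentIdeal (envAnti k) →ₗ[Env k] Env k)
      (idempotentIdealGen (envAnti_mul_self k)))))
    fun _ _ => ((envMul k).comp (envFlip k)).map_add _ _

/-- Dualizing the resolution into the enveloping algebra gives `ε A^e → A^e → ε' A^e` with left
multiplications as differentials. This is exact except at the right end, where `evalTwo` identifies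
the cokernel with `A`, and the flip carries the bimodule action to the one twisted by the exchange.
-/
theorem isTwistedCalabiYau :
    IsTwistedCalabiYau k (TwoVertexAlgebra k) 2 (exchange k) := by
  refine ⟨isHomologicallySmooth k, fun i hi => ?_, ?_⟩
  · match i with
    | 0 =>
      refine (resolution k).subsingleton_ext_zero fun g hg => ?_
      let g' : idempotentIdeal (envDiag k) →ₗ[Env k] Env k := g.hom
      have h0 : g' (idempotentIdealGen (envDiag_mul_self k)) = 0 := by
        refine eq_zero_of_mul_left_eq_zero (mul_linearMap_idempotentIdealGen _ g') ?_
        have h1 : g' (mulRightIdempotentIdeal _ ((envD k + envF k) * envDiag k)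
            (by rw [mul_assoc, envDiag_mul_self]) 1) = 0 :=
          congrArg (fun m : ModuleCat.of (Env k) (Env k) ⟶ envelopingModule k _ => m.hom (1 : Env k)) hg
        rw [linearMap_idempotentIdeal_apply (envDiag_mul_self k), coe_mulRightIdempotentIdeal, one_mul,
          smul_eq_mul, mul_assoc, mul_linearMap_idempotentIdealGen] at h1
        exact h1
      refine ModuleCat.hom_ext (LinearMap.ext fun x => ?_)
      refine (linearMap_idempotentIdeal_apply (envDiag_mul_self k) g' x).trans ?_
      rw [h0, smul_zero]
      rfl
    | 1 =>
      refine (resolution k).subsingleton_ext_one fun g hg => ?_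
      let g' : Env k →ₗ[Env k] Env k := g.hom
      have hg' : ∀ x, g' x = x * g' 1 := fun x => by
        rw [← smul_eq_mul, ← map_smul, smul_eq_mul, mul_one]
      have h1 : g' (envAnti k * (envF k - envD k)) = 0 :=
        congrArg (fun m : (resolution k).P₂ ⟶ envelopingModule k _ =>
          m.hom (idempotentIdealGen (envAnti_mul_self k))) hg
      rw [hg', mul_assoc] at h1
      obtain ⟨w, hw, hw'⟩ := exists_of_mul_left_eq_zero h1
      refine ⟨ModuleCat.ofHom (idempotentIdealLift (envDiag k) w), ?_⟩
      refine ModuleCat.hom_ext (LinearMap.ext fun (x : Env k) => ?_)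
      change x * ((envD k + envF k) * envDiag k) * w = g' x
      rw [hg', mul_assoc, mul_assoc, hw, hw']
    | 2 => exact (hi rfl).elim
    | i + 3 => exact (resolution k).subsingleton_ext_of_gt _ (by omega)
  · have hsurj : Function.Surjective (evalTwo k) := by
      intro b
      refine ⟨ModuleCat.ofHom (idempotentIdealLift (envAnti k) (envAnti k * (1 ⊗ₜ op b))), ?_⟩
      change envMul k (envFlip k (envAnti k * (envAnti k * (1 ⊗ₜ op b)))) = b
      rw [← mul_assoc, envAnti_mul_self, envMul_envFlip_envAnti_mul]
    have hker : ∀ g, evalTwo k g = 0 ↔ ∃ h, (resolution k).d₂ ≫ h = g := by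
      intro g
      let g' : idempotentIdeal (envAnti k) →ₗ[Env k] Env k := g.hom
      refine (envMul_envFlip_eq_zero_iff (mul_linearMap_idempotentIdealGen _ g')).trans ?_
      constructor
      · rintro ⟨a, ha⟩
        refine ⟨ModuleCat.ofHom (LinearMap.toSpanSingleton (Env k) (Env k) a), ?_⟩
        refine ModuleCat.hom_ext (LinearMap.ext fun (x : idempotentIdeal (envAnti k)) => ?_)
        refine Eq.trans ?_ (linearMap_idempotentIdeal_apply (envAnti_mul_self k) g' x).symm
        rw [← ha]
        change (x : Env k) * (envF k - envD k) * a = x * _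
        rw [← mul_assoc, show (x : Env k) * envAnti k = x from x.2, mul_assoc]
      · rintro ⟨h, rfl⟩
        let h' : Env k →ₗ[Env k] Env k := h.hom
        refine ⟨h' 1, ?_⟩
        change _ = h' (envAnti k * (envF k - envD k))
        rw [← mul_assoc, ← smul_eq_mul, ← map_smul, smul_eq_mul, mul_one]
    obtain ⟨φ, hφ⟩ := (resolution k).exists_ext_two_equiv (evalTwo k) hsurj hker
    refine ⟨φ, fun ξ a b => ?_⟩
    obtain ⟨g, rfl⟩ := (resolution k).extTwo_surjective ξ
    rw [LengthTwoResolution.extTwo_comp_mk₀, hφ, hφ]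
    exact envMul_envFlip_mul_tmul _ a b

end TwoVertexAlgebra

/-! ### Standard monomials of the preprojective algebra -/

namespace PiA

open MvPolynomial

section Operators

variable (k : Type*) [Field k] {n : ℕ}

/-- The operator of `x`. -/
def opX : Module.End k (CyclicQuiver n → MvPolynomial (Fin 2) k) :=
  shiftOp k (X 0) (Equiv.addRight 1)

/-- The operator of `y`. -/
def opY : Module.End k (CyclicQuiver n → MvPolynomial (Fin 2) k) :=
  shiftOp k (X 1) (Equiv.subRight 1)

theorem opX_mul_opY : opX k (n := n) * opY k = opY k * opX k :=
  shiftOp_mul_shiftOp k _ _ _ _ (Equiv.ext fun i => by simp)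

theorem projOp_mul_opX (i : CyclicQuiver n) :
    projOp k _ i * opX k = opX k * projOp k _ (i + 1) := projOp_mul_shiftOp k i _ _

theorem projOp_mul_opY (i : CyclicQuiver n) :
    projOp k _ (i + 1) * opY k = opY k * projOp k _ i := by
  have := projOp_mul_shiftOp k (i + 1) (X 1 : MvPolynomial (Fin 2) k) (Equiv.subRight 1)
  rwa [Equiv.subRight_apply, add_sub_cancel_right] at this

end Operators

variable (k : Type*) [Field k] {n : ℕ} [NeZero n]

variable (n) in
/-- The sum of the arrows `α_i`. -/
def x : PiA k n := ∑ i, α k i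

variable (n) in
/-- The sum of the arrows `α_i^*`. -/
def y : PiA k n := ∑ i, αs k i

theorem e_mul_x (i : CyclicQuiver n) : e k i * x k n = α k i := by
  rw [x, Finset.mul_sum, Finset.sum_eq_single i _ (by simp), e_mul_α]
  intro j _ hj
  rw [← e_mul_α, ← mul_assoc, e_mul_of_ne k hj.symm, zero_mul]

theorem x_mul_e (i : CyclicQuiver n) : x k n * e k (i + 1) = α k i := by
  rw [x, Finset.sum_mul, Finset.sum_eq_single i _ (by simp), α_mul_e]
  intro j _ hj
  rw [← α_mul_e, mul_assoc, e_mul_of_ne k (fun h => hj (add_right_cancel h)), mul_zero]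

theorem e_mul_y (i : CyclicQuiver n) : e k (i + 1) * y k n = αs k i := by
  rw [y, Finset.mul_sum, Finset.sum_eq_single i _ (by simp), e_mul_αs]
  intro j _ hj
  rw [← e_mul_αs, ← mul_assoc, e_mul_of_ne k (fun h => hj (add_right_cancel h).symm), zero_mul]

theorem y_mul_e (i : CyclicQuiver n) : y k n * e k i = αs k i := by
  rw [y, Finset.sum_mul, Finset.sum_eq_single i _ (by simp), αs_mul_e]
  intro j _ hj
  rw [← αs_mul_e, mul_assoc, e_mul_of_ne k hj, mul_zero]

/-- Products of arrows with unmatched endpoints vanish, so the single relation `Ω = 0` is the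
vanishing of the commutator of `x` and `y`. -/
theorem x_mul_y : x k n * y k n = y k n * x k n := by
  have h1 : x k n * y k n = ∑ i, α k i * αs k i := by
    conv_lhs => rw [x, Finset.sum_mul]
    exact Finset.sum_congr rfl fun i _ => by
      conv_lhs => rw [← α_mul_e, mul_assoc, e_mul_y]
  have h2 : y k n * x k n = ∑ i, αs k i * α k i := by
    conv_lhs => rw [y, Finset.sum_mul]
    exact Finset.sum_congr rfl fun i _ => by
      conv_lhs => rw [← αs_mul_e, mul_assoc, e_mul_x]
  rw [h1, h2, ← sub_eq_zero, ← Finset.sum_sub_distrib, relation]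

theorem adjoin_eq_top :
    Algebra.adjoin k (Set.range (e k (n := n)) ∪ Set.range ![x k n, y k n]) = ⊤ := by
  rw [eq_top_iff]
  rintro z -
  obtain ⟨z, rfl⟩ := RingQuot.mkAlgHom_surjective k (PreprojectiveRel k (CyclicQuiver n)) z
  set S := Algebra.adjoin k (Set.range (e k (n := n)) ∪ Set.range ![x k n, y k n])
  have he : ∀ i, e k i ∈ S := fun i => Algebra.subset_adjoin (.inl ⟨i, rfl⟩)
  have hx : x k n ∈ S := Algebra.subset_adjoin (.inr ⟨0, rfl⟩)
  have hy : y k n ∈ S := Algebra.subset_adjoin (.inr ⟨1, rfl⟩)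
  have hα : ∀ i, α k i ∈ S := fun i => by
    rw [← e_mul_x]
    exact mul_mem (he i) hx
  have hαs : ∀ i, αs k i ∈ S := fun i => by
    rw [← e_mul_y]
    exact mul_mem (he (i + 1)) hy
  refine PathAlgebra.map_mem_of_forall (PreprojectiveAlgebra.mk k (CyclicQuiver n)) _ he ?_ z
  rintro i j (a | a)
  · obtain rfl : j = ((show ZMod n from i) + 1 : ZMod n) := a.down
    exact hα i
  · obtain rfl : i = ((show ZMod n from j) + 1 : ZMod n) := a.down
    exact hαs j

variable (n) in
/-- The action of the preprojective algebra on tuples of polynomials. -/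
def actHom : PiA k n →ₐ[k] Module.End k (CyclicQuiver n → MvPolynomial (Fin 2) k) :=
  lift k (projOp k _) (fun i => projOp k _ i * opX k) (fun i => projOp k _ (i + 1) * opY k)
    (projOp_mul_self k) (projOp_mul_of_ne k) (sum_projOp k)
    (fun i => by rw [← mul_assoc, projOp_mul_self])
    (fun i => by rw [projOp_mul_opX, mul_assoc, projOp_mul_self])
    (fun i => by rw [← mul_assoc, projOp_mul_self])
    (fun i => by rw [projOp_mul_opY, mul_assoc, projOp_mul_self])
    (by
      have h1 : ∀ i : CyclicQuiver n, projOp k (MvPolynomial (Fin 2) k) i * opX k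
          * (projOp k _ (i + 1) * opY k) = projOp k _ i * (opX k * opY k) := fun i => by
        rw [← mul_assoc, mul_assoc _ (opX k), ← projOp_mul_opX, ← mul_assoc, projOp_mul_self,
          mul_assoc]
      have h2 : ∀ i : CyclicQuiver n, projOp k (MvPolynomial (Fin 2) k) (i + 1) * opY k
          * (projOp k _ i * opX k) = projOp k _ (i + 1) * (opX k * opY k) := fun i => by
        rw [← mul_assoc, mul_assoc _ (opY k), ← projOp_mul_opY, ← mul_assoc, projOp_mul_self,
          mul_assoc, opX_mul_opY]
      simp only [h1, h2, Finset.sum_sub_distrib, ← Finset.sum_mul]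
      rw [sub_eq_zero]
      congr 1
      exact (Equiv.sum_comp (Equiv.addRight (1 : CyclicQuiver n))
        (projOp k (MvPolynomial (Fin 2) k))).symm)

theorem actHom_e (i : CyclicQuiver n) : actHom k n (e k i) = projOp k _ i := lift_e ..

theorem actHom_x : actHom k n (x k n) = opX k := by
  rw [x, map_sum, ← one_mul (opX k), ← sum_projOp k, Finset.sum_mul]
  exact Finset.sum_congr rfl fun i _ => lift_α ..

theorem actHom_y : actHom k n (y k n) = opY k := by
  rw [y, map_sum, ← one_mul (opY k), ← sum_projOp k, Finset.sum_mul,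
    ← Equiv.sum_comp (Equiv.addRight (1 : CyclicQuiver n)) fun i => projOp k _ i * opY k]
  exact Finset.sum_congr rfl fun i _ => lift_αs ..

variable (n) in
/-- The standard monomials of the preprojective algebra. -/
def pbw : PBWData k (PiA k n) (CyclicQuiver n) (Fin 2) where
  e := e k
  x := ![x k n, y k n]
  σ := ![Equiv.addRight 1, Equiv.subRight 1]
  e_mul_self := e_mul_self k
  e_mul_of_ne _ _ h := e_mul_of_ne k h
  sum_e := sum_e k
  x_comm i j := by
    fin_cases i <;> fin_cases j
    · rfl
    · exact x_mul_y k
    · exact (x_mul_y k).symm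
    · rfl
  e_mul_x i j := by
    fin_cases j
    · exact (e_mul_x k i).trans (x_mul_e k i).symm
    · have h1 := e_mul_y k (i - 1)
      rw [sub_add_cancel] at h1
      exact h1.trans (y_mul_e k (i - 1)).symm
  adjoin_eq_top := adjoin_eq_top k
  act := actHom k n
  act_e i w := by rw [actHom_e, projOp_apply]
  act_x j w i := by
    fin_cases j
    · exact congrArg (fun F : Module.End k (CyclicQuiver n → MvPolynomial (Fin 2) k) => F w i)
        (actHom_x k)
    · exact congrArg (fun F : Module.End k (CyclicQuiver n → MvPolynomial (Fin 2) k) => F w i)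
        (actHom_y k)

variable {k}

theorem coord_e_mul (i : CyclicQuiver n) (r : PiA k n) :
    (pbw k n).coord (e k i * r) = Pi.single i ((pbw k n).coord r i) := (pbw k n).coord_e_mul i r

theorem coord_α_mul (i : CyclicQuiver n) (r : PiA k n) :
    (pbw k n).coord (α k i * r) = Pi.single i (X 0 * (pbw k n).coord r (i + 1)) := by
  rw [← e_mul_x, mul_assoc, coord_e_mul]
  exact congrArg _ ((pbw k n).coord_x_mul 0 r i)

/-- The exchange of the two variables. -/
def swapVars : MvPolynomial (Fin 2) k →ₐ[k] MvPolynomial (Fin 2) k := rename (Equiv.swap 0 1)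

@[simp] theorem swapVars_X_zero : swapVars (X 0 : MvPolynomial (Fin 2) k) = X 1 := by
  simp [swapVars]
@[simp] theorem swapVars_X_one : swapVars (X 1 : MvPolynomial (Fin 2) k) = X 0 := by
  simp [swapVars]

theorem rotHom_x (c : CyclicQuiver n) : rotHom k c (x k n) = x k n := by
  simp only [x, map_sum, rotHom_α]
  exact Equiv.sum_comp (Equiv.addRight c) (α k)

theorem rotHom_y (c : CyclicQuiver n) : rotHom k c (y k n) = y k n := by
  simp only [y, map_sum, rotHom_αs]
  exact Equiv.sum_comp (Equiv.addRight c) (αs k)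

theorem reflHom_x : reflHom k (x k n) = y k n := by
  simp only [x, map_sum, reflHom_α]
  exact Equiv.sum_comp ((Equiv.neg (CyclicQuiver n)).trans (Equiv.subRight 1)) (αs k)

theorem reflHom_y : reflHom k (y k n) = x k n := by
  simp only [y, map_sum, reflHom_αs]
  exact Equiv.sum_comp ((Equiv.neg (CyclicQuiver n)).trans (Equiv.subRight 1)) (α k)

theorem rotHom_ev (c : CyclicQuiver n) (p : MvPolynomial (Fin 2) k) :
    rotHom k c ((pbw k n).ev p) = (pbw k n).ev p := by
  have : (rotHom k c).comp (pbw k n).ev = (pbw k n).ev := MvPolynomial.algHom_ext fun j => by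
    rw [AlgHom.comp_apply, PBWData.ev_X]
    fin_cases j
    · exact rotHom_x c
    · exact rotHom_y c
  exact DFunLike.congr_fun this p

theorem reflHom_ev (p : MvPolynomial (Fin 2) k) :
    reflHom k ((pbw k n).ev p) = (pbw k n).ev (swapVars p) := by
  have : (reflHom k).comp (pbw k n).ev = (pbw k n).ev.comp swapVars :=
      MvPolynomial.algHom_ext fun j => by
    rw [AlgHom.comp_apply, AlgHom.comp_apply, PBWData.ev_X]
    fin_cases j
    · change reflHom k (x k n) = (pbw k n).ev (swapVars (X 0))
      rw [swapVars_X_zero, PBWData.ev_X]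
      exact reflHom_x
    · change reflHom k (y k n) = (pbw k n).ev (swapVars (X 1))
      rw [swapVars_X_one, PBWData.ev_X]
      exact reflHom_y
  exact DFunLike.congr_fun this p

theorem coord_e_mul_ev (i : CyclicQuiver n) (p : MvPolynomial (Fin 2) k) :
    (pbw k n).coord (e k i * (pbw k n).ev p) = Pi.single i p := by
  rw [coord_e_mul, PBWData.coord_ev]

/-- A rotation fixes `x` and `y`, hence every polynomial in them, and moves only the idempotents. -/
theorem coord_rotHom (c : CyclicQuiver n) (r : PiA k n) (i : CyclicQuiver n) :
    (pbw k n).coord (rotHom k c r) i = (pbw k n).coord r (i - c) := by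
  induction r using PBWData.induction_on (P := pbw k n) with
  | h0 => simp
  | hadd r s hr hs => simp only [map_add, Pi.add_apply, hr, hs]
  | h j p =>
    change (pbw k n).coord (rotHom k c (e k j * _)) i = (pbw k n).coord (e k j * _) _
    rw [map_mul, rotHom_e, rotHom_ev, coord_e_mul_ev, coord_e_mul_ev, Pi.single_apply,
      Pi.single_apply]
    exact if_congr sub_eq_iff_eq_add.symm rfl rfl

/-- The reflection exchanges `x` and `y` and negates the index of the idempotents. -/
theorem coord_reflHom (r : PiA k n) (i : CyclicQuiver n) :
    (pbw k n).coord (reflHom k r) i = swapVars ((pbw k n).coord r (-i)) := by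
  induction r using PBWData.induction_on (P := pbw k n) with
  | h0 => simp
  | hadd r s hr hs => simp only [map_add, Pi.add_apply, hr, hs]
  | h j p =>
    change (pbw k n).coord (reflHom k (e k j * _)) i = swapVars ((pbw k n).coord (e k j * _) _)
    rw [map_mul, reflHom_e, reflHom_ev, coord_e_mul_ev, coord_e_mul_ev, Pi.single_apply,
      Pi.single_apply, apply_ite swapVars, map_zero]
    exact if_congr (by rw [neg_eq_iff_eq_neg]) rfl rfl

/-! ### The group and the fixed ring -/

/-- The elements `ρ^c` and `ρ^c r` are closed under products and inverses because `r ρ^d = ρ^{-d} r`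
and `r² = 1`. -/
theorem dihedral_cases {τ : PiA k n ≃ₐ[k] PiA k n} (hτ : τ ∈ dihedral k n) :
    ∃ c : CyclicQuiver n, (∀ r, τ r = rotHom k c r) ∨ ∀ r, τ r = rotHom k c (reflHom k r) := by
  have hrot : ∀ (c d : CyclicQuiver n) (r : PiA k n),
      rotHom k c (rotHom k d r) = rotHom k (c + d) r := fun c d r => by
    refine (pbw k n).coord_injective (funext fun i => ?_)
    simp only [coord_rotHom]
    rw [sub_sub]
  have hrefl : ∀ (d : CyclicQuiver n) (r : PiA k n),
      reflHom k (rotHom k d r) = rotHom k (-d) (reflHom k r) := fun d r => by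
    refine (pbw k n).coord_injective (funext fun i => ?_)
    simp only [coord_rotHom, coord_reflHom]
    rw [show -i - d = -(i - -d) by ring]
  have hrr : ∀ r : PiA k n, reflHom k (reflHom k r) = r := (refl k n).left_inv
  have h0 : ∀ r : PiA k n, rotHom k 0 r = r := fun r =>
    (pbw k n).coord_injective (funext fun i => by rw [coord_rotHom, sub_zero])
  induction hτ using Subgroup.closure_induction with
  | mem τ hτ =>
    obtain rfl | rfl := hτ
    · exact ⟨1, .inl fun r => rfl⟩
    · exact ⟨0, .inr fun r => (h0 _).symm⟩
  | one => exact ⟨0, .inl fun r => (h0 r).symm⟩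
  | mul σ τ _ _ hσ hτ =>
    obtain ⟨c, hc | hc⟩ := hσ <;> obtain ⟨d, hd | hd⟩ := hτ
    · exact ⟨c + d, .inl fun r => by rw [AlgEquiv.mul_apply, hc, hd, hrot]⟩
    · exact ⟨c + d, .inr fun r => by rw [AlgEquiv.mul_apply, hc, hd, hrot]⟩
    · exact ⟨c + -d, .inr fun r => by rw [AlgEquiv.mul_apply, hc, hd, hrefl, hrot]⟩
    · exact ⟨c + -d, .inl fun r => by rw [AlgEquiv.mul_apply, hc, hd, hrefl, hrot, hrr]⟩
  | inv τ _ hτ =>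
    obtain ⟨c, hc | hc⟩ := hτ
    · refine ⟨-c, .inl fun r => τ.injective ?_⟩
      rw [hc (rotHom k (-c) r), hrot, add_neg_cancel, h0]
      exact τ.apply_symm_apply r
    · refine ⟨c, .inr fun r => τ.injective ?_⟩
      rw [hc (rotHom k c _), hrefl, hrot, add_neg_cancel, h0, hrr]
      exact τ.apply_symm_apply r

theorem e_injective : Function.Injective (e k : CyclicQuiver n → PiA k n) := fun i j h => by
  have h1 : (pbw k n).coord (e k i) i = (pbw k n).coord (e k j) i := by rw [h]
  by_contra hij
  rw [show (pbw k n).coord (e k i) = Pi.single i 1 from (pbw k n).coord_e i,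
    show (pbw k n).coord (e k j) = Pi.single j 1 from (pbw k n).coord_e j, Pi.single_eq_same,
    Pi.single_eq_of_ne hij] at h1
  exact one_ne_zero h1

theorem apply_add_two_mul {T : Type*} {w : CyclicQuiver n → T} (h : ∀ i, w (i + 2) = w i)
    (m i : CyclicQuiver n) : w (i + 2 * m) = w i := by
  rw [← ZMod.natCast_zmod_val m]
  induction m.val with
  | zero => simp
  | succ m ih => rw [← ih, ← h (i + 2 * m), Nat.cast_succ, mul_add, mul_one, add_assoc]

/-- The group contains `r` and `ρ² r`, hence `ρ²`, which forces period two. Invariance under `r`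
then forces symmetry, since `-i` and `i` differ by a multiple of two. Conversely these conditions
suffice for every generator, the nontrivial ones being the `ρ^{2j} r`. -/
theorem mem_fixedRing_iff (r : PiA k n) : r ∈ fixedRing k (PiA k n) (W k n) ↔
    ∀ i, (pbw k n).coord r (i + 2) = (pbw k n).coord r i ∧
      swapVars ((pbw k n).coord r i) = (pbw k n).coord r i := by
  have hmem : r ∈ fixedRing k (PiA k n) (W k n) ↔ ∀ τ ∈ W k n, τ r = r :=
    ⟨fun h τ hτ => h ⟨τ, hτ⟩, fun h g => h g.1 g.2⟩
  rw [hmem]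
  have hrefl_mem : refl k n ∈ dihedral k n := Subgroup.subset_closure (.inr rfl)
  have hrho_mem : rho k n ∈ dihedral k n := Subgroup.subset_closure (.inl rfl)
  constructor
  · intro h
    have h1 : refl k n r = r := h _ (Subgroup.subset_closure ⟨hrefl_mem, 0, by simp⟩)
    -- The reflection `ρ² r` fixes `e_1`, because `-1 + 2 = 1`.
    have h2 : rho k n (rho k n (refl k n r)) = r :=
      h (rho k n * rho k n * refl k n) (Subgroup.subset_closure
        ⟨mul_mem (mul_mem hrho_mem hrho_mem) hrefl_mem, 1, by
          simp only [AlgEquiv.mul_apply, refl_e, rho_e]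
          congr 1
          ring⟩)
    rw [h1] at h2
    have h3 : ∀ i, (pbw k n).coord r (i + 2) = (pbw k n).coord r i := fun i => by
      have h4 : (pbw k n).coord (rotHom k 1 (rotHom k 1 r)) (i + 2) = _ :=
        congrArg (fun s => (pbw k n).coord s (i + 2)) h2
      rw [coord_rotHom, coord_rotHom, show i + 2 - 1 - 1 = i by ring] at h4
      exact h4.symm
    refine fun i => ⟨h3 i, ?_⟩
    have h4 : (pbw k n).coord (reflHom k r) i = (pbw k n).coord r i :=
      congrArg (fun s => (pbw k n).coord s i) h1
    rw [coord_reflHom, ← apply_add_two_mul h3 i (-i), show -i + 2 * i = i by ring] at h4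
    exact h4
  · intro h τ hτ
    induction hτ using Subgroup.closure_induction with
    | one => rfl
    | mul σ τ _ _ hσ hτ => rw [AlgEquiv.mul_apply, hτ, hσ]
    | inv τ _ hτ =>
      conv_lhs => rw [← hτ]
      exact τ.symm_apply_apply r
    | mem τ hτ =>
      obtain ⟨hτ, j, hj⟩ := hτ
      refine (pbw k n).coord_injective (funext fun i => ?_)
      obtain ⟨c, hc | hc⟩ := dihedral_cases hτ
      · rw [hc, rotHom_e] at hj
        obtain rfl : c = 0 := by simpa using e_injective hj
        rw [hc, coord_rotHom, sub_zero]
      · rw [hc, reflHom_e, rotHom_e] at hj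
        -- A reflection `ρ^c r` sends `e_j` to `e_{c-j}`, so fixing `e_j` makes `c` twice a vertex,
        -- and period two applies.
        obtain rfl : c = 2 * j := by linear_combination e_injective hj
        rw [hc, coord_rotHom, coord_reflHom, (h _).2,
          ← apply_add_two_mul (fun i => (h i).1) (j - i) i,
          show -(i - 2 * j) = i + 2 * (j - i) by ring]

end PiA

/-! ### The grading of an algebra with a basis of monomials -/

namespace MvPolynomial

/-- If an algebra map sends the variables to elements of degrees `w`, then it sends weighted
homogeneous polynomials to homogeneous elements. -/
theorem map_mem_of_isWeightedHomogeneous {k ι B : Type*} [Field k] [Ring B] [Algebra k B]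
    {w : ι → ℕ} (F : MvPolynomial ι k →ₐ[k] B) (𝓐 : ℕ → Submodule k B) [SetLike.GradedMonoid 𝓐]
    (h : ∀ j, F (X j) ∈ 𝓐 (w j)) {p : MvPolynomial ι k} {d : ℕ}
    (hp : IsWeightedHomogeneous w p d) : F p ∈ 𝓐 d := by
  have hmon : ∀ s : ι →₀ ℕ, F (monomial s 1) ∈ 𝓐 (Finsupp.weight w s) := fun s => by
    induction s using Finsupp.induction_linear with
    | zero =>
      rw [map_zero, monomial_zero', C_1, map_one]
      exact SetLike.GradedOne.one_mem
    | add s t hs ht =>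
      rw [map_add, ← mul_one (1 : k), ← monomial_mul, map_mul]
      exact SetLike.mul_mem_graded hs ht
    | single j m =>
      rw [Finsupp.weight_single, ← X_pow_eq_monomial, map_pow]
      exact SetLike.pow_mem_graded m (h j)
  induction hp using IsWeightedHomogeneous.induction_on with
  | zero => rw [map_zero]; exact Submodule.zero_mem _
  | add p q _ _ hp hq => rw [map_add]; exact Submodule.add_mem _ hp hq
  | monomial s r hs =>
    rw [← mul_one r, ← smul_eq_mul, ← smul_monomial, map_smul]
    exact Submodule.smul_mem _ _ (hs ▸ hmon s)

end MvPolynomial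

namespace PBWData

open MvPolynomial

section Tuples

variable {k V ι : Type*} [Field k] (w : ι → ℕ)

variable (k V) in
/-- The tuples of weighted homogeneous polynomials of degree `d`. -/
def homogTuples (d : ℕ) : Submodule k (V → MvPolynomial ι k) :=
  Submodule.pi Set.univ fun _ => weightedHomogeneousSubmodule k w d

variable {w}

theorem mem_homogTuples {d : ℕ} {m : V → MvPolynomial ι k} :
    m ∈ homogTuples k V w d ↔ ∀ i, IsWeightedHomogeneous w (m i) d := by
  simp [homogTuples, Submodule.mem_pi]

variable (k V w) in
theorem one_mem_homogTuples : (fun _ => 1) ∈ homogTuples k V w 0 :=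
  mem_homogTuples.2 fun _ => isWeightedHomogeneous_one ..

end Tuples

variable {k R V ι : Type*} [Field k] [Ring R] [Algebra k R] [Fintype V] [DecidableEq V]
  (P : PBWData k R V ι) (w : ι → ℕ)

/-- The elements that are homogeneous of degree `d` when `x j` has degree `w j`. -/
def homog (d : ℕ) : Submodule k R := (homogTuples k V w d).comap P.coord

variable {P w}

theorem mem_homog {d : ℕ} {r : R} :
    r ∈ P.homog w d ↔ ∀ i, IsWeightedHomogeneous w (P.coord r i) d := mem_homogTuples

theorem act_e_mem_homogTuples (i : V) {d : ℕ} {m : V → MvPolynomial ι k}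
    (hm : m ∈ homogTuples k V w d) : P.act (P.e i) m ∈ homogTuples k V w d := by
  rw [mem_homogTuples] at hm ⊢
  intro j
  rw [P.act_e, Pi.single_apply]
  split_ifs
  · exact hm i
  · exact isWeightedHomogeneous_zero ..

theorem act_e_mul_x_mem_homogTuples (i : V) (j : ι) {d : ℕ} {m : V → MvPolynomial ι k}
    (hm : m ∈ homogTuples k V w d) : P.act (P.e i * P.x j) m ∈ homogTuples k V w (w j + d) := by
  rw [map_mul, Module.End.mul_apply]
  refine act_e_mem_homogTuples i (mem_homogTuples.2 fun l => ?_)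
  rw [P.act_x]
  exact (isWeightedHomogeneous_X k w j).mul (mem_homogTuples.1 hm _)

theorem e_mul_ev_mem_homog (i : V) {d : ℕ} {p : MvPolynomial ι k}
    (hp : IsWeightedHomogeneous w p d) : P.e i * P.ev p ∈ P.homog w d := by
  refine mem_homog.2 fun j => ?_
  rw [coord_e_mul, coord_ev, Pi.single_apply]
  split_ifs
  · exact hp
  · exact isWeightedHomogeneous_zero ..

/-- One half of the comparison between the degree of paths and the degree of coordinates; it needs
only the degrees of the generators. -/
theorem homog_le (𝓐 : ℕ → Submodule k R) [SetLike.GradedMonoid 𝓐] (he : ∀ i, P.e i ∈ 𝓐 0)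
    (hx : ∀ j, P.x j ∈ 𝓐 (w j)) (d : ℕ) : P.homog w d ≤ 𝓐 d := fun r hr => by
  rw [← P.ofCoord_coord r, ofCoord_apply]
  refine Submodule.sum_mem _ fun i _ => ?_
  rw [← zero_add d]
  refine SetLike.mul_mem_graded (he i) (map_mem_of_isWeightedHomogeneous P.ev 𝓐 (fun j => ?_)
    (mem_homog.1 hr i))
  rw [ev_X]
  exact hx j

variable (P w) in
theorem iSup_homog : ⨆ d, P.homog w d = ⊤ := by
  rw [eq_top_iff]
  rintro r -
  induction r using PBWData.induction_on (P := P) with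
  | h0 => exact Submodule.zero_mem _
  | hadd r s hr hs => exact Submodule.add_mem _ hr hs
  | h i p =>
    induction p using MvPolynomial.induction_on' with
    | add p q hp hq => rw [map_add, mul_add]; exact Submodule.add_mem _ hp hq
    | monomial s c =>
      exact Submodule.mem_iSup_of_mem _
        (e_mul_ev_mem_homog i (isWeightedHomogeneous_monomial w s c rfl))

variable (P w) in
theorem isInternal_homog : DirectSum.IsInternal (P.homog w) := by
  refine DirectSum.isInternal_submodule_of_iSupIndep_of_iSup_eq_top ?_ (P.iSup_homog w)
  refine iSupIndep_of_dfinsupp_lsum_injective _ ?_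
  -- The weighted component of degree `d` of the coordinates recovers the summand of degree `d`, so
  -- the sum map is injective.
  have key : ∀ (d : ℕ) (i : V) (g : Π₀ d, P.homog w d),
      weightedHomogeneousComponent w d
        (P.coord (DFinsupp.lsum ℕ (fun d => (P.homog w d).subtype) g) i) = P.coord (g d) i := by
    intro d i g
    induction g using DFinsupp.induction with
    | h0 => simp
    | ha e r g _ _ hg =>
      rw [map_add, map_add, Pi.add_apply, map_add, hg, DFinsupp.add_apply, Submodule.coe_add,
        map_add, Pi.add_apply, DFinsupp.lsum_single, Submodule.subtype_apply]
      congr 1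
      by_cases h : e = d
      · subst h
        rw [DFinsupp.single_eq_same]
        exact weightedHomogeneousComponent_eq_self (mem_homog.1 r.2 i)
      · rw [DFinsupp.single_eq_of_ne (Ne.symm h),
          (mem_homog.1 r.2 i).weightedHomogeneousComponent_ne _ (Ne.symm h), ZeroMemClass.coe_zero,
          map_zero, Pi.zero_apply]
  rw [injective_iff_map_eq_zero]
  intro g hg
  ext d
  refine P.coord_injective (funext fun i => ?_)
  rw [← key, hg]
  simp

end PBWData

/-! ### The grading of the two-vertex algebra -/

namespace TwoVertexAlgebra

open MvPolynomial

variable (k : Type*) [Field k]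

theorem mul_mem_piece {a b : ℕ} {x y : TwoVertexAlgebra k} (hx : x ∈ piece k a)
    (hy : y ∈ piece k b) : x * y ∈ piece k (a + b) := by
  obtain ⟨x, hx, rfl⟩ := hx
  obtain ⟨y, hy, rfl⟩ := hy
  exact ⟨x * y, PathAlgebra.mul_mem_piece _ hx hy, map_mul (mk k) x y⟩

theorem f_mem_piece (i : TwoVertex) : f k i ∈ piece k 0 :=
  ⟨_, PathAlgebra.vertex_mem_piece _ i, rfl⟩

instance gradedMonoid_piece : SetLike.GradedMonoid (piece k) where
  one_mem := by
    rw [← sum_f]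
    exact Submodule.sum_mem _ fun i _ => f_mem_piece k i
  mul_mem _ _ _ _ := mul_mem_piece k

theorem u₁_mem_piece : u₁ k ∈ piece k 1 :=
  ⟨pathU₁ k, PathAlgebra.arrow_mem_piece TwoVertexArrow.degree (k := k) (V := TwoVertex)
    TwoVertexArrow.u₁, rfl⟩

theorem u₂_mem_piece : u₂ k ∈ piece k 1 :=
  ⟨pathU₂ k, PathAlgebra.arrow_mem_piece TwoVertexArrow.degree (k := k) (V := TwoVertex)
    TwoVertexArrow.u₂, rfl⟩

theorem v₁_mem_piece : v₁ k ∈ piece k 2 :=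
  ⟨pathV₁ k, PathAlgebra.arrow_mem_piece TwoVertexArrow.degree (k := k) (V := TwoVertex)
    TwoVertexArrow.v₁, rfl⟩

theorem v₂_mem_piece : v₂ k ∈ piece k 2 :=
  ⟨pathV₂ k, PathAlgebra.arrow_mem_piece TwoVertexArrow.degree (k := k) (V := TwoVertex)
    TwoVertexArrow.v₂, rfl⟩

/-- A path of degree `d` raises the degree of a tuple by `d`; applied to the constant tuple `1` this
makes its coordinates homogeneous. The reverse inclusion follows from the degrees of the generators.
-/
theorem piece_eq_homog (d : ℕ) : piece k d = (pbw k).homog ![1, 2] d := by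
  apply le_antisymm
  · rintro _ ⟨x, hx, rfl⟩
    refine PathAlgebra.map_apply_mem_of_mem_piece (d := 0) _ ((pbw k).act.comp (mk k))
      (PBWData.homogTuples k TwoVertex ![1, 2])
      (fun i d m hm => PBWData.act_e_mem_homogTuples (P := pbw k) i hm) ?_ hx
      (PBWData.one_mem_homogTuples k TwoVertex ![1, 2])
    rintro _ _ (_ | _ | _ | _) d m hm
    · have := PBWData.act_e_mul_x_mem_homogTuples (P := pbw k) .one 0 hm
      rwa [show (pbw k).e .one * (pbw k).x 0 = u₁ k from f_one_mul_u k] at this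
    · have := PBWData.act_e_mul_x_mem_homogTuples (P := pbw k) .two 0 hm
      rwa [show (pbw k).e .two * (pbw k).x 0 = u₂ k from f_two_mul_u k] at this
    · have := PBWData.act_e_mul_x_mem_homogTuples (P := pbw k) .one 1 hm
      rwa [show (pbw k).e .one * (pbw k).x 1 = v₁ k from f_one_mul_v k] at this
    · have := PBWData.act_e_mul_x_mem_homogTuples (P := pbw k) .two 1 hm
      rwa [show (pbw k).e .two * (pbw k).x 1 = v₂ k from f_two_mul_v k] at this
  · refine PBWData.homog_le _ (f_mem_piece k) (fun j => ?_) d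
    fin_cases j
    · exact Submodule.add_mem _ (u₁_mem_piece k) (u₂_mem_piece k)
    · exact Submodule.add_mem _ (v₁_mem_piece k) (v₂_mem_piece k)

theorem mem_piece_iff {d : ℕ} {x : TwoVertexAlgebra k} :
    x ∈ piece k d ↔ ∀ i, IsWeightedHomogeneous ![1, 2] ((pbw k).coord x i) d := by
  rw [piece_eq_homog, PBWData.mem_homog]

theorem nonempty_gradedAlgebra_piece : Nonempty (GradedAlgebra (piece k)) := by
  have h : DirectSum.IsInternal (piece k) := by
    rw [funext (piece_eq_homog k)]
    exact (pbw k).isInternal_homog _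
  exact ⟨{ gradedMonoid_piece k, h.chooseDecomposition with }⟩

end TwoVertexAlgebra

/-! ### Symmetric polynomials in two variables -/

namespace PiA

open MvPolynomial

variable {k : Type*} [Field k]

/-- The map that sends the variables to the first two power sums. -/
def powerSums : MvPolynomial (Fin 2) k →ₐ[k] MvPolynomial (Fin 2) k :=
  aeval ![X 0 + X 1, X 0 ^ 2 + X 1 ^ 2]

@[simp] theorem powerSums_X_zero : powerSums (X 0 : MvPolynomial (Fin 2) k) = X 0 + X 1 := by
  simp [powerSums]

@[simp] theorem powerSums_X_one : powerSums (X 1 : MvPolynomial (Fin 2) k) = X 0 ^ 2 + X 1 ^ 2 := by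
  simp [powerSums]

theorem swapVars_powerSums (a : MvPolynomial (Fin 2) k) :
    swapVars (powerSums a) = powerSums a := by
  have : (swapVars.comp powerSums : MvPolynomial (Fin 2) k →ₐ[k] _) = powerSums :=
    MvPolynomial.algHom_ext fun j => by
      fin_cases j
      · simp [add_comm]
      · simp [add_comm]
  exact DFunLike.congr_fun this a

/-- Symmetric coefficients of `1` and `X 0` are determined by the polynomial they represent. -/
theorem eq_zero_of_add_X_mul_eq_zero {p q : MvPolynomial (Fin 2) k} (hp : swapVars p = p)
    (hq : swapVars q = q) (h : p + X 0 * q = 0) : p = 0 ∧ q = 0 := by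
  have h' := congrArg swapVars h
  rw [map_add, map_mul, hp, hq, swapVars_X_zero, map_zero] at h'
  have h2 : (X 0 - X 1 : MvPolynomial (Fin 2) k) * q = 0 := by linear_combination h - h'
  have hq0 : q = 0 := (mul_eq_zero.1 h2).resolve_left fun h3 =>
    absurd (X_injective (sub_eq_zero.1 h3)) (by decide)
  exact ⟨by simpa [hq0] using h, hq0⟩

theorem eq_and_eq_of_add_X_mul_eq {p q p' q' : MvPolynomial (Fin 2) k} (hp : swapVars p = p)
    (hq : swapVars q = q) (hp' : swapVars p' = p') (hq' : swapVars q' = q')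
    (h : p + X 0 * q = p' + X 0 * q') : p = p' ∧ q = q' := by
  have := eq_zero_of_add_X_mul_eq_zero (p := p - p') (q := q - q') (by rw [map_sub, hp, hp'])
    (by rw [map_sub, hq, hq']) (by linear_combination h)
  exact ⟨sub_eq_zero.1 this.1, sub_eq_zero.1 this.2⟩

/-- The elementary symmetric polynomial `X 0 * X 1` in terms of the power sums. -/
def elemTwo (k : Type*) [Field k] : MvPolynomial (Fin 2) k := C 2⁻¹ * (X 0 ^ 2 - X 1)

theorem two_mul_elemTwo [CharZero k] : 2 * elemTwo k = X 0 ^ 2 - X 1 := by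
  rw [elemTwo, ← mul_assoc, show (2 : MvPolynomial (Fin 2) k) = C 2 from (map_ofNat C 2).symm,
    ← C_mul, mul_inv_cancel₀ two_ne_zero, C_1, one_mul]

theorem powerSums_elemTwo [CharZero k] : powerSums (elemTwo k) = X 0 * X 1 := by
  have h := congrArg powerSums (two_mul_elemTwo (k := k))
  rw [map_mul, map_ofNat, map_sub, map_pow, powerSums_X_zero, powerSums_X_one] at h
  refine mul_left_cancel₀ (two_ne_zero : (2 : MvPolynomial (Fin 2) k) ≠ 0) ?_
  linear_combination h

/-- Over the polynomial ring in the prospective power sums `p₁`, `p₂`, adjoin a root `t` of `T² - p₁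
T + (p₁² - p₂) / 2`. Substituting `t` and `p₁ - t` for the variables turns `powerSums` into the
structure map of this extension, which is injective. -/
theorem powerSums_injective [CharZero k] :
    Function.Injective (powerSums : MvPolynomial (Fin 2) k →ₐ[k] _) := by
  let f : Polynomial (MvPolynomial (Fin 2) k) :=
    Polynomial.X ^ 2 - Polynomial.C (X 0) * Polynomial.X + Polynomial.C (elemTwo k)
  have hf : f.degree ≠ 0 := by
    have : f.degree = 2 := by
      simp only [f]
      compute_degree!
    rw [this]
    decide
  let ψ : MvPolynomial (Fin 2) k →ₐ[k] AdjoinRoot f :=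
    aeval ![AdjoinRoot.root f, AdjoinRoot.of f (X 0) - AdjoinRoot.root f]
  have hroot : AdjoinRoot.root f ^ 2 - AdjoinRoot.of f (X 0) * AdjoinRoot.root f
      + AdjoinRoot.of f (elemTwo k) = 0 := by
    have := AdjoinRoot.eval₂_root f
    simpa [f] using this
  have hψ : ∀ a, ψ (powerSums a) = AdjoinRoot.of f a := fun a => by
    have h0 : ψ (X 0) = AdjoinRoot.root f := by simp [ψ]
    have h1 : ψ (X 1) = AdjoinRoot.of f (X 0) - AdjoinRoot.root f := by simp [ψ]
    have : ψ.comp powerSums =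
        (Algebra.ofId (MvPolynomial (Fin 2) k) (AdjoinRoot f)).restrictScalars k := by
      refine MvPolynomial.algHom_ext fun j => ?_
      fin_cases j
      · change ψ (powerSums (X 0)) = AdjoinRoot.of f (X 0)
        rw [powerSums_X_zero, map_add, h0, h1]
        ring
      · change ψ (powerSums (X 1)) = AdjoinRoot.of f (X 1)
        rw [powerSums_X_one, map_add, map_pow, map_pow, h0, h1]
        have h2 := congrArg (AdjoinRoot.of f) (two_mul_elemTwo (k := k))
        rw [map_mul, map_ofNat, map_sub, map_pow] at h2
        linear_combination 2 * hroot - h2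
    exact DFunLike.congr_fun this a
  intro a b h
  refine AdjoinRoot.of.injective_of_degree_ne_zero hf ?_
  rw [← hψ, ← hψ, h]

/-- With `s` the sum and `m` the product of the variables, `X 0 ^ 2 = s * X 0 - m` and `X 1 = s - X
0`. Hence the polynomials of this form are closed under multiplication by both variables, and the
witnesses below are read off from these identities. -/
theorem exists_eq_powerSums_add [CharZero k] (p : MvPolynomial (Fin 2) k) :
    ∃ a b, p = powerSums a + X 0 * powerSums b := by
  induction p using MvPolynomial.induction_on with
  | C c => exact ⟨C c, 0, by rw [map_zero, mul_zero, add_zero]; exact (powerSums.commutes c).symm⟩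
  | add p q hp hq =>
    obtain ⟨a, b, rfl⟩ := hp
    obtain ⟨a', b', rfl⟩ := hq
    exact ⟨a + a', b + b', by rw [map_add, map_add]; ring⟩
  | mul_X p j hp =>
    obtain ⟨a, b, rfl⟩ := hp
    fin_cases j
    · refine ⟨-(elemTwo k * b), a + X 0 * b, ?_⟩
      simp only [map_add, map_neg, map_mul, powerSums_elemTwo, powerSums_X_zero, Fin.zero_eta]
      ring
    · refine ⟨X 0 * a + elemTwo k * b, -a, ?_⟩
      simp only [map_add, map_neg, map_mul, powerSums_elemTwo, powerSums_X_zero, Fin.mk_one]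
      ring

/-- A symmetric polynomial also has the decomposition `p + X 0 * 0`, so by uniqueness its `X 0` part
vanishes. -/
theorem exists_powerSums_eq [CharZero k] {p : MvPolynomial (Fin 2) k} (hp : swapVars p = p) :
    ∃ a, powerSums a = p := by
  obtain ⟨a, b, h⟩ := exists_eq_powerSums_add p
  refine ⟨a, ?_⟩
  exact (eq_and_eq_of_add_X_mul_eq (swapVars_powerSums a) (swapVars_powerSums b) hp (map_zero _)
    (by rw [← h, mul_zero, add_zero])).1

/-! #### Degrees -/

theorem isHomogeneous_powerSums {a : MvPolynomial (Fin 2) k} {d : ℕ}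
    (ha : IsWeightedHomogeneous ![1, 2] a d) : (powerSums a).IsHomogeneous d := by
  have : SetLike.GradedMonoid (homogeneousSubmodule (Fin 2) k) := HomogeneousSubmodule.gradedMonoid
  refine map_mem_of_isWeightedHomogeneous powerSums (homogeneousSubmodule (Fin 2) k) (fun j => ?_) ha
  fin_cases j
  · exact powerSums_X_zero (k := k) ▸ (isHomogeneous_X k 0).add (isHomogeneous_X k 1)
  · exact powerSums_X_one (k := k) ▸ (isHomogeneous_X_pow 0 2).add (isHomogeneous_X_pow 1 2)

/-- The coefficients of `1` and `X 0` of a homogeneous polynomial of degree `d` are homogeneous of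
degrees `d` and `d - 1`. -/
theorem exists_homogeneous_eq_powerSums_add [CharZero k] {p : MvPolynomial (Fin 2) k} {d : ℕ}
    (hp : p.IsHomogeneous d) : ∃ a b, p = powerSums a + X 0 * powerSums b ∧
      IsWeightedHomogeneous ![1, 2] a d ∧
      (d = 0 ∧ b = 0 ∨ ∃ e, d = e + 1 ∧ IsWeightedHomogeneous ![1, 2] b e) := by
  -- The decomposition is followed through multiplication by each variable, now with degrees. The
  -- alternative `d = 0 ∧ b = 0` stands for the degree `-1`, which natural numbers lack.
  set P : ℕ → MvPolynomial (Fin 2) k → Prop := fun d p =>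
    ∃ a b, p = powerSums a + X 0 * powerSums b ∧ IsWeightedHomogeneous ![1, 2] a d ∧
      (d = 0 ∧ b = 0 ∨ ∃ e, d = e + 1 ∧ IsWeightedHomogeneous ![1, 2] b e)
  have hX0 : IsWeightedHomogeneous ![1, 2] (X 0 : MvPolynomial (Fin 2) k) 1 :=
    isWeightedHomogeneous_X k _ 0
  have hX1 : IsWeightedHomogeneous ![1, 2] (X 1 : MvPolynomial (Fin 2) k) 2 :=
    isWeightedHomogeneous_X k _ 1
  have hE : IsWeightedHomogeneous ![1, 2] (elemTwo k) 2 :=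
    ((hX0.pow 2).sub hX1).C_mul _
  have hEb : ∀ (d : ℕ) (b : MvPolynomial (Fin 2) k),
      (d = 0 ∧ b = 0 ∨ ∃ e, d = e + 1 ∧ IsWeightedHomogeneous ![1, 2] b e) →
      IsWeightedHomogeneous ![1, 2] (elemTwo k * b) (d + 1) ∧
        IsWeightedHomogeneous ![1, 2] (X 0 * b) d := by
    rintro _ b (⟨rfl, rfl⟩ | ⟨e, rfl, hb⟩)
    · rw [mul_zero, mul_zero]
      exact ⟨isWeightedHomogeneous_zero .., isWeightedHomogeneous_zero ..⟩
    · exact ⟨by rw [show e + 1 + 1 = 2 + e by omega]; exact hE.mul hb,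
        by rw [add_comm e]; exact hX0.mul hb⟩
  have h0 : ∀ d, ∀ p, P d p → P (d + 1) (p * X 0) := by
    rintro d _ ⟨a, b, rfl, ha, hb⟩
    refine ⟨-(elemTwo k * b), a + X 0 * b, ?_, (hEb d b hb).1.neg, .inr ⟨d, rfl,
      ha.add (hEb d b hb).2⟩⟩
    simp only [map_add, map_neg, map_mul, powerSums_elemTwo, powerSums_X_zero]
    ring
  have h1 : ∀ d, ∀ p, P d p → P (d + 1) (p * X 1) := by
    rintro d _ ⟨a, b, rfl, ha, hb⟩
    refine ⟨X 0 * a + elemTwo k * b, -a, ?_, ?_, .inr ⟨d, rfl, ha.neg⟩⟩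
    · simp only [map_add, map_neg, map_mul, powerSums_elemTwo, powerSums_X_zero]
      ring
    · refine IsWeightedHomogeneous.add ?_ (hEb d b hb).1
      rw [add_comm]
      exact hX0.mul ha
  have hmon : ∀ (c : k) (i j : ℕ), P (i + j) (C c * X 0 ^ i * X 1 ^ j) := fun c i j => by
    induction j with
    | zero =>
      rw [pow_zero, mul_one, add_zero]
      induction i with
      | zero =>
        refine ⟨C c, 0, ?_, isWeightedHomogeneous_C _ c, .inl ⟨rfl, rfl⟩⟩
        rw [pow_zero, mul_one, map_zero, mul_zero, add_zero]
        exact (powerSums.commutes c).symm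
      | succ i ih =>
        rw [pow_succ, ← mul_assoc]
        exact h0 _ _ ih
    | succ j ih =>
      rw [pow_succ, ← mul_assoc]
      exact h1 _ _ ih
  change P d p
  have hp' : IsWeightedHomogeneous 1 p d := hp
  induction hp' using IsWeightedHomogeneous.induction_on with
  | zero =>
    refine ⟨0, 0, by simp, isWeightedHomogeneous_zero .., ?_⟩
    cases d
    · exact .inl ⟨rfl, rfl⟩
    · exact .inr ⟨_, rfl, isWeightedHomogeneous_zero ..⟩
  | add p q hp' hq' ihp ihq =>
    obtain ⟨a, b, rfl, ha, hb⟩ := ihp hp'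
    obtain ⟨a', b', rfl, ha', hb'⟩ := ihq hq'
    refine ⟨a + a', b + b', by rw [map_add, map_add]; ring, ha.add ha', ?_⟩
    obtain ⟨rfl, rfl⟩ | ⟨e, rfl, hb⟩ := hb <;> obtain ⟨h, rfl⟩ | ⟨e', h, hb'⟩ := hb'
    · exact .inl ⟨rfl, add_zero 0⟩
    · omega
    · omega
    · obtain rfl : e = e' := by omega
      exact .inr ⟨e, rfl, hb.add hb'⟩
  | monomial s r hs =>
    have hs' : d = s 0 + s 1 := by
      rw [← hs, Finsupp.weight_apply, Finsupp.sum_fintype _ _ (by simp)]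
      simp
    rw [monomial_eq, Finsupp.prod_fintype _ _ (by simp), Fin.prod_univ_two, ← mul_assoc, hs']
    exact hmon r _ _

/-- The graded decomposition provides a weighted homogeneous `a'`; uniqueness of decompositions and
injectivity of `powerSums` force `a = a'`. -/
theorem isWeightedHomogeneous_of_isHomogeneous_powerSums [CharZero k]
    {a : MvPolynomial (Fin 2) k} {d : ℕ} (ha : (powerSums a).IsHomogeneous d) :
    IsWeightedHomogeneous ![1, 2] a d := by
  obtain ⟨a', b, h, ha', -⟩ := exists_homogeneous_eq_powerSums_add ha
  have h1 := (eq_and_eq_of_add_X_mul_eq (swapVars_powerSums a) (map_zero _) (swapVars_powerSums a')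
    (swapVars_powerSums b) (by rwa [mul_zero, add_zero])).1
  rwa [powerSums_injective h1]

/-- If `p + X 0 * q` is homogeneous of degree `d`, where `p` and `q` are symmetric, then `q` is
homogeneous of degree `d - 1`. -/
theorem isHomogeneous_of_isHomogeneous_add_X_mul [CharZero k] {p q : MvPolynomial (Fin 2) k}
    (hp : swapVars p = p) (hq : swapVars q = q) {d : ℕ} (h : (p + X 0 * q).IsHomogeneous d) :
    d = 0 ∧ q = 0 ∨ ∃ e, d = e + 1 ∧ q.IsHomogeneous e := by
  obtain ⟨a, b, hab, -, hb⟩ := exists_homogeneous_eq_powerSums_add h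
  obtain ⟨-, rfl⟩ := eq_and_eq_of_add_X_mul_eq hp hq (swapVars_powerSums a)
    (swapVars_powerSums b) hab
  obtain ⟨rfl, rfl⟩ | ⟨e, rfl, hb⟩ := hb
  · exact .inl ⟨rfl, map_zero _⟩
  · exact .inr ⟨e, rfl, isHomogeneous_powerSums hb⟩

end PiA

/-! ### Parity -/

namespace PiA

/-- The parity of a vertex. -/
def parity {n : ℕ} (i : CyclicQuiver n) : TwoVertex := if Even i.val then .one else .two

theorem parity_eq_one {n : ℕ} {i : CyclicQuiver n} : parity i = .one ↔ Even i.val := by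
  rw [parity]
  split_ifs with h <;> simp [h]

theorem parity_eq_two {n : ℕ} {i : CyclicQuiver n} : parity i = .two ↔ Odd i.val := by
  rw [parity, ← Nat.not_even_iff_odd]
  split_ifs with h <;> simp [h]

theorem parity_zero {n : ℕ} : parity (0 : CyclicQuiver n) = .one := by
  rw [parity_eq_one, ZMod.val_zero]
  exact Even.zero

end PiA

/-! ### The grading of the preprojective algebra -/

namespace PiA

open MvPolynomial

variable {k : Type*} [Field k] {n : ℕ} [NeZero n]

local notation "𝓡" => PreprojectiveAlgebra.piece k (CyclicQuiver n)

theorem e_mem_piece (i : CyclicQuiver n) : e k i ∈ 𝓡 0 :=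
  ⟨_, PathAlgebra.vertex_mem_piece (V := Quiver.Symmetrify (CyclicQuiver n)) (fun _ => 1) i, rfl⟩

instance gradedMonoid_piece : SetLike.GradedMonoid 𝓡 where
  one_mem := by
    rw [← sum_e]
    exact Submodule.sum_mem _ fun i _ => e_mem_piece i
  mul_mem := by
    rintro a b _ _ ⟨x, hx, rfl⟩ ⟨y, hy, rfl⟩
    exact ⟨x * y, PathAlgebra.mul_mem_piece _ hx hy,
      map_mul (PreprojectiveAlgebra.mk k (CyclicQuiver n)) x y⟩

theorem α_mem_piece (i : CyclicQuiver n) : α k i ∈ 𝓡 1 :=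
  ⟨nonstarArrow k (CyclicQuiver.arrow n i),
    PathAlgebra.arrow_mem_piece (V := Quiver.Symmetrify (CyclicQuiver n)) (fun _ => 1) _, rfl⟩

theorem αs_mem_piece (i : CyclicQuiver n) : αs k i ∈ 𝓡 1 :=
  ⟨starArrow k (CyclicQuiver.arrow n i),
    PathAlgebra.arrow_mem_piece (V := Quiver.Symmetrify (CyclicQuiver n)) (fun _ => 1) _, rfl⟩

theorem piece_eq_homog (d : ℕ) : 𝓡 d = (pbw k n).homog 1 d := by
  apply le_antisymm
  · rintro _ ⟨x, hx, rfl⟩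
    refine PathAlgebra.map_apply_mem_of_mem_piece (d := 0) _
      ((pbw k n).act.comp (PreprojectiveAlgebra.mk k (CyclicQuiver n)))
      (PBWData.homogTuples k (CyclicQuiver n) 1)
      (fun i d m hm => PBWData.act_e_mem_homogTuples (P := pbw k n) i hm) ?_ hx
      (PBWData.one_mem_homogTuples k (CyclicQuiver n) 1)
    rintro i j (a | a) d m hm
    · obtain rfl : j = ((show ZMod n from i) + 1 : ZMod n) := a.down
      have := PBWData.act_e_mul_x_mem_homogTuples (P := pbw k n) i 0 hm
      rwa [show (pbw k n).e i * (pbw k n).x 0 = α k i from e_mul_x k i] at this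
    · obtain rfl : i = ((show ZMod n from j) + 1 : ZMod n) := a.down
      have := PBWData.act_e_mul_x_mem_homogTuples (P := pbw k n) ((show ZMod n from j) + 1) 1 hm
      rwa [show (pbw k n).e ((show ZMod n from j) + 1) * (pbw k n).x 1 = αs k j
        from e_mul_y k j] at this
  · refine PBWData.homog_le _ e_mem_piece (fun j => ?_) d
    fin_cases j
    · exact Submodule.sum_mem _ fun i _ => α_mem_piece i
    · exact Submodule.sum_mem _ fun i _ => αs_mem_piece i

theorem mem_piece_iff {d : ℕ} {r : PiA k n} :
    r ∈ 𝓡 d ↔ ∀ i, ((pbw k n).coord r i).IsHomogeneous d := by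
  rw [piece_eq_homog, PBWData.mem_homog]
  rfl

theorem iSup_piece : ⨆ d, 𝓡 d = ⊤ := by
  simp only [piece_eq_homog]
  exact (pbw k n).iSup_homog 1

/-! ### The vertices of given parity -/

/-- Reduction modulo `n` preserves parity because `n` is even, so the wrap-around at the last vertex
does no harm. -/
theorem parity_add_one (hn : Even n) (i : CyclicQuiver n) :
    parity (i + 1) = TwoVertex.swap (parity i) := by
  have h : Even (i + 1).val ↔ ¬ Even i.val := by
    rw [ZMod.val_add, ZMod.val_one_eq_one_mod, Nat.add_mod_mod, Nat.even_iff,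
      Nat.mod_mod_of_dvd _ hn.two_dvd, ← Nat.even_iff, Nat.even_add_one]
  rw [parity, parity, if_congr h rfl rfl]
  split_ifs <;> rfl

theorem parity_sub_one (hn : Even n) (i : CyclicQuiver n) :
    parity (i - 1) = TwoVertex.swap (parity i) := by
  have := parity_add_one hn (i - 1)
  rw [sub_add_cancel] at this
  rw [this, TwoVertex.swap_swap]

theorem parity_one (hn : Even n) : parity (1 : CyclicQuiver n) = .two := by
  have := parity_add_one hn (0 : CyclicQuiver n)
  rwa [zero_add, parity_zero] at this

theorem parity_surjective (hn : Even n) : Function.Surjective (parity (n := n)) := by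
  rintro (_ | _)
  · exact ⟨0, parity_zero⟩
  · exact ⟨1, parity_one hn⟩

/-- A function of period two depends only on the parity. -/
theorem apply_eq_of_parity_eq {T : Type*} {w : CyclicQuiver n → T}
    (h : ∀ i, w (i + 2) = w i) {i j : CyclicQuiver n} (hij : parity i = parity j) : w i = w j := by
  have key : ∀ i, w i = if parity i = .one then w 0 else w 1 := fun i => by
    split_ifs with hi
    · obtain ⟨m, hm⟩ := (parity_eq_one.1 hi).two_dvd
      rw [← apply_add_two_mul h m 0, ← ZMod.natCast_zmod_val i, hm, zero_add, Nat.cast_mul,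
        Nat.cast_ofNat]
    · obtain ⟨m, hm⟩ := Nat.not_even_iff_odd.1 (mt parity_eq_one.2 hi)
      rw [← apply_add_two_mul h m 1, ← ZMod.natCast_zmod_val i, hm, Nat.cast_add, Nat.cast_mul,
        Nat.cast_ofNat, Nat.cast_one, add_comm]
  rw [key, key j, hij]

variable (n) in
/-- The vertices of a given parity. -/
def verticesOf (t : TwoVertex) : Finset (CyclicQuiver n) := Finset.univ.filter (parity · = t)

theorem mem_verticesOf {t : TwoVertex} {i : CyclicQuiver n} :
    i ∈ verticesOf n t ↔ parity i = t := by
  simp [verticesOf]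

variable (n) in
theorem verticesOf_one : verticesOf n .one = CyclicQuiver.evenVertices n := by
  ext i
  simp [mem_verticesOf, CyclicQuiver.evenVertices, parity_eq_one]

variable (n) in
theorem verticesOf_two : verticesOf n .two = CyclicQuiver.oddVertices n := by
  ext i
  simp [mem_verticesOf, CyclicQuiver.oddVertices, parity_eq_two]

theorem verticesOf_parity (i : CyclicQuiver n) :
    verticesOf n (parity i) = CyclicQuiver.parityClass n i := by
  rw [CyclicQuiver.parityClass, parity]
  split_ifs
  · exact verticesOf_one n
  · exact verticesOf_two n

/-! ### The isomorphism with the fixed ring -/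

theorem coord_sumZero_mul (S : Finset (CyclicQuiver n)) (r : PiA k n) (i : CyclicQuiver n) :
    (pbw k n).coord (sumZero k S * r) i = if i ∈ S then (pbw k n).coord r i else 0 := by
  rw [sumZero, Finset.sum_mul, map_sum, Finset.sum_apply]
  simp only [coord_e_mul, Pi.single_apply, Finset.sum_ite_eq]

theorem coord_sumZero_verticesOf_mul (t : TwoVertex) (r : PiA k n) (i : CyclicQuiver n) :
    (pbw k n).coord (sumZero k (verticesOf n t) * r) i
      = if parity i = t then (pbw k n).coord r i else 0 :=
  (coord_sumZero_mul _ r i).trans (if_congr mem_verticesOf rfl rfl)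

theorem coord_sumZero_verticesOf (t : TwoVertex) (i : CyclicQuiver n) :
    (pbw k n).coord (sumZero k (verticesOf n t)) i = if parity i = t then 1 else 0 := by
  have h := coord_sumZero_verticesOf_mul t (1 : PiA k n) i
  rwa [mul_one, ← map_one (pbw k n).ev, PBWData.coord_ev] at h

theorem coord_x_mul (r : PiA k n) (i : CyclicQuiver n) :
    (pbw k n).coord (x k n * r) i = X 0 * (pbw k n).coord r (i + 1) := (pbw k n).coord_x_mul 0 r i

theorem coord_y_mul (r : PiA k n) (i : CyclicQuiver n) :
    (pbw k n).coord (y k n * r) i = X 1 * (pbw k n).coord r (i - 1) := (pbw k n).coord_x_mul 1 r i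

theorem ev_powerSums_X_zero : (pbw k n).ev (powerSums (X 0)) = x k n + y k n := by
  rw [powerSums_X_zero, map_add, PBWData.ev_X, PBWData.ev_X]
  rfl

theorem ev_powerSums_X_one : (pbw k n).ev (powerSums (X 1)) = x k n * x k n + y k n * y k n := by
  rw [powerSums_X_one, map_add, map_pow, map_pow, PBWData.ev_X, PBWData.ev_X, pow_two, pow_two]
  rfl

variable (k) in
/-- The map from the two-vertex algebra to the preprojective algebra. -/
def fromTwoVertex (hn : Even n) : TwoVertexAlgebra k →ₐ[k] PiA k n :=
  TwoVertexAlgebra.lift (fun t => sumZero k (verticesOf n t)) ((pbw k n).ev (powerSums (X 0)))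
    ((pbw k n).ev (powerSums (X 1)))
    (fun t => (pbw k n).coord_injective <| funext fun i => by
      rw [coord_sumZero_verticesOf_mul, coord_sumZero_verticesOf]
      split_ifs <;> rfl)
    (fun s t h => (pbw k n).coord_injective <| funext fun i => by
      rw [coord_sumZero_verticesOf_mul, coord_sumZero_verticesOf, map_zero]
      split_ifs with h1 h2
      · exact absurd (h1.symm.trans h2) h
      · rfl
      · rfl)
    (by
      rw [TwoVertex.sum_eq]
      refine (pbw k n).coord_injective <| funext fun i => ?_
      rw [map_add, Pi.add_apply, coord_sumZero_verticesOf, coord_sumZero_verticesOf,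
        ← map_one (pbw k n).ev, PBWData.coord_ev]
      cases parity i <;> simp)
    (fun t => (pbw k n).coord_injective <| funext fun i => by
      rw [coord_sumZero_verticesOf_mul, PBWData.coord_ev, ev_powerSums_X_zero, powerSums_X_zero,
        add_mul, map_add, Pi.add_apply, coord_x_mul, coord_y_mul, coord_sumZero_verticesOf,
        coord_sumZero_verticesOf, parity_add_one hn, parity_sub_one hn]
      cases parity i <;> cases t <;> simp)
    (fun t => (pbw k n).coord_injective <| funext fun i => by
      rw [coord_sumZero_verticesOf_mul, PBWData.coord_ev, ev_powerSums_X_one, powerSums_X_one,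
        add_mul, map_add, Pi.add_apply, mul_assoc, mul_assoc, coord_x_mul, coord_x_mul, coord_y_mul, coord_y_mul,
        coord_sumZero_verticesOf, coord_sumZero_verticesOf, parity_add_one hn, parity_add_one hn,
        parity_sub_one hn, parity_sub_one hn, TwoVertex.swap_swap]
      split_ifs
      · ring
      · ring)
    (by rw [← map_mul, ← map_mul, mul_comm, map_mul, map_mul])

theorem fromTwoVertex_f (hn : Even n) (t : TwoVertex) :
    fromTwoVertex k hn (TwoVertexAlgebra.f k t) = sumZero k (verticesOf n t) :=
  TwoVertexAlgebra.lift_f ..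

theorem fromTwoVertex_u (hn : Even n) :
    fromTwoVertex k hn (TwoVertexAlgebra.u k) = (pbw k n).ev (powerSums (X 0)) :=
  TwoVertexAlgebra.lift_u ..

theorem fromTwoVertex_v (hn : Even n) :
    fromTwoVertex k hn (TwoVertexAlgebra.v k) = (pbw k n).ev (powerSums (X 1)) :=
  TwoVertexAlgebra.lift_v ..

theorem fromTwoVertex_ev (hn : Even n) (p : MvPolynomial (Fin 2) k) :
    fromTwoVertex k hn ((TwoVertexAlgebra.pbw k).ev p) = (pbw k n).ev (powerSums p) := by
  have : (fromTwoVertex k hn).comp (TwoVertexAlgebra.pbw k).ev = (pbw k n).ev.comp powerSums :=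
    MvPolynomial.algHom_ext fun j => by
      rw [AlgHom.comp_apply, PBWData.ev_X]
      fin_cases j
      · exact fromTwoVertex_u hn
      · exact fromTwoVertex_v hn
  exact DFunLike.congr_fun this p

/-- In coordinates the map is `powerSums`, repeated along each parity class. Injectivity, image and
degrees are thereby reduced to symmetric polynomials in two variables. -/
theorem coord_fromTwoVertex (hn : Even n) (a : TwoVertexAlgebra k) (i : CyclicQuiver n) :
    (pbw k n).coord (fromTwoVertex k hn a) i
      = powerSums ((TwoVertexAlgebra.pbw k).coord a (parity i)) := by
  induction a using PBWData.induction_on (P := TwoVertexAlgebra.pbw k) with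
  | h0 => simp
  | hadd a b ha hb => simp only [map_add, Pi.add_apply, ha, hb]
  | h t p =>
    rw [map_mul, PBWData.coord_e_mul, PBWData.coord_ev, fromTwoVertex_ev]
    rw [show fromTwoVertex k hn ((TwoVertexAlgebra.pbw k).e t) = _ from fromTwoVertex_f hn t,
      coord_sumZero_verticesOf_mul, PBWData.coord_ev, Pi.single_apply]
    split_ifs
    · rfl
    · exact (map_zero _).symm

theorem fromTwoVertex_mem (hn : Even n) (a : TwoVertexAlgebra k) :
    fromTwoVertex k hn a ∈ fixedRing k (PiA k n) (W k n) := by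
  rw [mem_fixedRing_iff]
  intro i
  rw [coord_fromTwoVertex, coord_fromTwoVertex, swapVars_powerSums, show i + 2 = i + 1 + 1 by ring,
    parity_add_one hn, parity_add_one hn, TwoVertex.swap_swap]
  exact ⟨rfl, rfl⟩

variable [CharZero k]

theorem fromTwoVertex_injective (hn : Even n) : Function.Injective (fromTwoVertex k hn) := by
  intro a b h
  refine (TwoVertexAlgebra.pbw k).coord_injective (funext fun t => ?_)
  obtain ⟨i, rfl⟩ := parity_surjective hn t
  refine powerSums_injective ?_
  rw [← coord_fromTwoVertex hn, ← coord_fromTwoVertex hn, h]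

theorem exists_fromTwoVertex_eq (hn : Even n) {r : PiA k n}
    (hr : r ∈ fixedRing k (PiA k n) (W k n)) : ∃ a, fromTwoVertex k hn a = r := by
  rw [mem_fixedRing_iff] at hr
  choose c hc using fun t => parity_surjective (n := n) hn t
  choose a ha using fun t => exists_powerSums_eq (hr (c t)).2
  refine ⟨(TwoVertexAlgebra.pbw k).ofCoord a, (pbw k n).coord_injective (funext fun i => ?_)⟩
  rw [coord_fromTwoVertex, PBWData.coord_ofCoord, ha]
  exact apply_eq_of_parity_eq (fun i => (hr i).1) (hc _)

variable (k) in
/-- The isomorphism of the two-vertex algebra with the fixed ring. -/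
def fixedRingEquiv (hn : Even n) : TwoVertexAlgebra k ≃ₐ[k] fixedRing k (PiA k n) (W k n) :=
  AlgEquiv.ofBijective ((fromTwoVertex k hn).codRestrict _ (fromTwoVertex_mem hn))
    ⟨fun _ _ h => fromTwoVertex_injective hn (congrArg Subtype.val h),
      fun r => (exists_fromTwoVertex_eq hn r.2).imp fun _ h => Subtype.ext h⟩

theorem coe_fixedRingEquiv (hn : Even n) (a : TwoVertexAlgebra k) :
    (fixedRingEquiv k hn a : PiA k n) = fromTwoVertex k hn a := rfl

theorem mem_piece_iff_fromTwoVertex_mem (hn : Even n) (d : ℕ) (a : TwoVertexAlgebra k) :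
    a ∈ TwoVertexAlgebra.piece k d ↔ fromTwoVertex k hn a ∈ 𝓡 d := by
  rw [TwoVertexAlgebra.mem_piece_iff, mem_piece_iff, (parity_surjective (n := n) hn).forall]
  simp only [coord_fromTwoVertex]
  exact forall_congr' fun i =>
    ⟨isHomogeneous_powerSums, isWeightedHomogeneous_of_isHomogeneous_powerSums⟩

end PiA

/-! ### Orbit sums in terms of `x` and `y` -/

namespace PiA

variable (k : Type*) [Field k] {n : ℕ} [NeZero n]

theorem sumOne_eq (S : Finset (CyclicQuiver n)) :
    sumOne k S = sumZero k S * (x k n + y k n) := by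
  rw [sumOne, sumZero, Finset.sum_mul]
  refine Finset.sum_congr rfl fun i _ => ?_
  have := e_mul_y k (i - 1)
  rw [sub_add_cancel] at this
  rw [mul_add, e_mul_x, this]

theorem sumTwo_eq (S : Finset (CyclicQuiver n)) :
    sumTwo k S = sumZero k S * (x k n * x k n + y k n * y k n) := by
  rw [sumTwo, sumZero, Finset.sum_mul]
  refine Finset.sum_congr rfl fun i _ => ?_
  have h1 := e_mul_y k (i - 1)
  rw [sub_add_cancel] at h1
  have h2 := e_mul_y k (i - 2)
  rw [show i - 2 + 1 = i - 1 by ring] at h2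
  rw [mul_add, ← mul_assoc, ← mul_assoc, e_mul_x, h1, ← e_mul_x k (i + 1), ← h2, ← mul_assoc,
    ← mul_assoc, α_mul_e, αs_mul_e]

end PiA

/-! ### The preprojective algebra as a module over the fixed ring -/

namespace PiA

open MvPolynomial

variable {k : Type*} [Field k] {n : ℕ} [NeZero n]

local notation "𝓡" => PreprojectiveAlgebra.piece k (CyclicQuiver n)

theorem coord_apply_eq_of_parity_eq {r : PiA k n} (hr : r ∈ fixedRing k (PiA k n) (W k n))
    {i j : CyclicQuiver n} (h : parity i = parity j) :
    (pbw k n).coord r i = (pbw k n).coord r j :=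
  apply_eq_of_parity_eq (fun i => ((mem_fixedRing_iff r).1 hr i).1) h

theorem swapVars_coord {r : PiA k n} (hr : r ∈ fixedRing k (PiA k n) (W k n))
    (i : CyclicQuiver n) : swapVars ((pbw k n).coord r i) = (pbw k n).coord r i :=
  ((mem_fixedRing_iff r).1 hr i).2

/-- A property of the coordinates of a fixed element can be checked at two consecutive vertices. -/
theorem forall_coord_of_consecutive (hn : Even n) {motive : MvPolynomial (Fin 2) k → Prop}
    {r : PiA k n} (hr : r ∈ fixedRing k (PiA k n) (W k n)) (i : CyclicQuiver n)
    (h : motive ((pbw k n).coord r i)) (h' : motive ((pbw k n).coord r (i + 1)))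
    (j : CyclicQuiver n) : motive ((pbw k n).coord r j) := by
  by_cases hj : parity j = parity i
  · rwa [coord_apply_eq_of_parity_eq hr hj]
  · have : parity j = parity (i + 1) := by
      rw [parity_add_one hn]
      revert hj
      cases parity j <;> cases parity i <;> decide
    rwa [coord_apply_eq_of_parity_eq hr this]

/-! #### Decomposition -/

theorem coord_sum_e_mul_add_α_mul (a b : CyclicQuiver n → PiA k n) (j : CyclicQuiver n) :
    (pbw k n).coord (∑ i, (e k i * a i + α k i * b i)) j
      = (pbw k n).coord (a j) j + X 0 * (pbw k n).coord (b j) (j + 1) := by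
  simp only [map_sum, map_add, coord_e_mul, coord_α_mul, Finset.sum_apply, Pi.add_apply,
    Finset.sum_add_distrib, Pi.single_apply, Finset.sum_ite_eq, Finset.mem_univ, if_true]

/-- An element of the fixed ring that is supported on one parity class is determined by one
coordinate. -/
theorem eq_of_coord_eq {r s : PiA k n} {i : CyclicQuiver n}
    (hr : r ∈ fixedRing k (PiA k n) (W k n))
    (hr' : sumZero k (CyclicQuiver.parityClass n i) * r = r)
    (hs : s ∈ fixedRing k (PiA k n) (W k n))
    (hs' : sumZero k (CyclicQuiver.parityClass n i) * s = s)
    (h : (pbw k n).coord r i = (pbw k n).coord s i) : r = s := by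
  refine (pbw k n).coord_injective (funext fun j => ?_)
  by_cases hj : parity j = parity i
  · rw [coord_apply_eq_of_parity_eq hr hj, coord_apply_eq_of_parity_eq hs hj, h]
  · rw [← hr', ← hs', ← verticesOf_parity, coord_sumZero_verticesOf_mul,
      coord_sumZero_verticesOf_mul, if_neg hj, if_neg hj]

theorem coord_fromTwoVertex_f_mul_ev (hn : Even n) (t : TwoVertex) (p : MvPolynomial (Fin 2) k)
    {i : CyclicQuiver n} (hi : parity i = t) :
    (pbw k n).coord (fromTwoVertex k hn
      (TwoVertexAlgebra.f k t * (TwoVertexAlgebra.pbw k).ev p)) i = powerSums p := by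
  rw [coord_fromTwoVertex, hi]
  congr 1
  change (TwoVertexAlgebra.pbw k).coord ((TwoVertexAlgebra.pbw k).e t * _) t = p
  rw [PBWData.coord_e_mul, PBWData.coord_ev, Pi.single_eq_same]

theorem sumZero_mul_fromTwoVertex (hn : Even n) (i : CyclicQuiver n) (a : TwoVertexAlgebra k) :
    sumZero k (CyclicQuiver.parityClass n i)
        * fromTwoVertex k hn (TwoVertexAlgebra.f k (parity i) * a)
      = fromTwoVertex k hn (TwoVertexAlgebra.f k (parity i) * a) := by
  rw [← verticesOf_parity, ← fromTwoVertex_f hn, ← map_mul, ← mul_assoc,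
    TwoVertexAlgebra.f_mul_self]

/-- At each vertex this is the unique splitting of a polynomial as `p + X 0 * q` with `p` and `q`
symmetric. A fixed element supported on one parity class amounts to a single symmetric polynomial;
for `b_i` it is read at `i + 1`, where `α_i` ends. -/
theorem existsUnique_decomposition [CharZero k] (hn : Even n) (x : PiA k n) :
    ∃! c : (CyclicQuiver n → PiA k n) × (CyclicQuiver n → PiA k n),
      (∀ i, c.1 i ∈ fixedRing k (PiA k n) (W k n) ∧
        sumZero k (CyclicQuiver.parityClass n i) * c.1 i = c.1 i) ∧
      (∀ i, c.2 i ∈ fixedRing k (PiA k n) (W k n) ∧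
        sumZero k (CyclicQuiver.parityClass n (i + 1)) * c.2 i = c.2 i) ∧
      x = ∑ i, (e k i * c.1 i + α k i * c.2 i) := by
  choose a b hab using fun i => exists_eq_powerSums_add ((pbw k n).coord x i)
  refine ⟨(fun i => fromTwoVertex k hn
      (TwoVertexAlgebra.f k (parity i) * (TwoVertexAlgebra.pbw k).ev (a i)),
    fun i => fromTwoVertex k hn
      (TwoVertexAlgebra.f k (parity (i + 1)) * (TwoVertexAlgebra.pbw k).ev (b i))),
    ⟨fun i => ⟨fromTwoVertex_mem hn _, sumZero_mul_fromTwoVertex hn i _⟩,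
      fun i => ⟨fromTwoVertex_mem hn _, sumZero_mul_fromTwoVertex hn (i + 1) _⟩, ?_⟩, ?_⟩
  · refine (pbw k n).coord_injective (funext fun j => ?_)
    rw [coord_sum_e_mul_add_α_mul, coord_fromTwoVertex_f_mul_ev hn _ _ rfl,
      coord_fromTwoVertex_f_mul_ev hn _ _ rfl, hab j]
  · rintro ⟨c, d⟩ ⟨hc, hd, hx⟩
    have key : ∀ i, (pbw k n).coord (c i) i = powerSums (a i) ∧
        (pbw k n).coord (d i) (i + 1) = powerSums (b i) := fun i =>
      eq_and_eq_of_add_X_mul_eq (swapVars_coord (hc i).1 i) (swapVars_coord (hd i).1 (i + 1))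
        (swapVars_powerSums _) (swapVars_powerSums _)
        (by rw [← hab i, hx, coord_sum_e_mul_add_α_mul])
    refine Prod.ext (funext fun i => ?_) (funext fun i => ?_)
    · refine eq_of_coord_eq (i := i) (hc i).1 (hc i).2 (fromTwoVertex_mem hn _)
        (sumZero_mul_fromTwoVertex hn i _) ?_
      rw [coord_fromTwoVertex_f_mul_ev hn _ _ rfl]
      exact (key i).1
    · refine eq_of_coord_eq (i := i + 1) (hd i).1 (hd i).2 (fromTwoVertex_mem hn _)
        (sumZero_mul_fromTwoVertex hn (i + 1) _) ?_
      rw [coord_fromTwoVertex_f_mul_ev hn _ _ rfl]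
      exact (key i).2

/-! #### A basis -/

/-- The even vertex among `l` and `l - 1`. -/
def evenRep (hn : Even n) (l : CyclicQuiver n) : CyclicQuiver.evenVertices n :=
  if h : parity l = .one then ⟨l, verticesOf_one n ▸ mem_verticesOf.2 h⟩
  else ⟨l - 1, verticesOf_one n ▸ mem_verticesOf.2 (by
    rw [parity_sub_one hn]
    revert h
    cases parity l <;> decide)⟩

theorem parity_of_mem_evenVertices (i : CyclicQuiver.evenVertices n) :
    parity (i : CyclicQuiver n) = .one :=
  mem_verticesOf.1 ((verticesOf_one n).symm ▸ i.2)

theorem evenRep_coe (hn : Even n) (i : CyclicQuiver.evenVertices n) : evenRep hn i = i := by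
  rw [evenRep, dif_pos (parity_of_mem_evenVertices i)]

theorem evenRep_coe_add_one (hn : Even n) (i : CyclicQuiver.evenVertices n) :
    evenRep hn ((i : CyclicQuiver n) + 1) = i := by
  have h : ¬ parity ((i : CyclicQuiver n) + 1) = .one := by
    rw [parity_add_one hn, parity_of_mem_evenVertices i]
    decide
  rw [evenRep, dif_neg h]
  exact Subtype.ext (add_sub_cancel_right _ _)

theorem eq_or_eq_evenRep_add_one (hn : Even n) (l : CyclicQuiver n) :
    l = evenRep hn l ∨ l = (evenRep hn l : CyclicQuiver n) + 1 := by
  rw [evenRep]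
  split_ifs
  · exact .inl rfl
  · exact .inr (sub_add_cancel l 1).symm

/-- The pairs `{i, i + 1}` with `i` even partition the vertices, and `evenRep` names the pair that
contains `l`. -/
theorem e_mul_e_add_e (hn : Even n) (l : CyclicQuiver n) (i : CyclicQuiver.evenVertices n) :
    e k l * (e k (i : CyclicQuiver n) + e k ((i : CyclicQuiver n) + 1))
      = if evenRep hn l = i then e k l else 0 := by
  rw [mul_add]
  split_ifs with h
  · subst h
    have hne : (evenRep hn l : CyclicQuiver n) ≠ (evenRep hn l : CyclicQuiver n) + 1 := fun h => by
      have h1 := parity_add_one hn (evenRep hn l : CyclicQuiver n)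
      rw [← h, parity_of_mem_evenVertices] at h1
      exact absurd h1 (by decide)
    obtain h | h := eq_or_eq_evenRep_add_one hn l
    · generalize (evenRep hn l : CyclicQuiver n) = m at h hne
      subst h
      rw [e_mul_self, e_mul_of_ne k hne, add_zero]
    · generalize (evenRep hn l : CyclicQuiver n) = m at h hne
      subst h
      rw [e_mul_self, e_mul_of_ne k hne.symm, zero_add]
  · rw [e_mul_of_ne, e_mul_of_ne, add_zero]
    · rintro rfl
      exact h (evenRep_coe_add_one hn i)
    · rintro rfl
      exact h (evenRep_coe hn i)

variable (k n) in
/-- The elements `e_i + e_{i+1}` and `α_i + α_{i+1}` for `i` even. -/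
def evenBasis : CyclicQuiver.evenVertices n ⊕ CyclicQuiver.evenVertices n → PiA k n :=
  Sum.elim (fun i => e k (i : CyclicQuiver n) + e k ((i : CyclicQuiver n) + 1))
    (fun i => α k (i : CyclicQuiver n) + α k ((i : CyclicQuiver n) + 1))

/-- The element of the preprojective algebra given by a scalar of the right module. -/
def unopScalar (s : (fixedRing k (PiA k n) (W k n)).op) : PiA k n := MulOpposite.unop s.1

theorem unopScalar_mem (s : (fixedRing k (PiA k n) (W k n)).op) :
    unopScalar s ∈ fixedRing k (PiA k n) (W k n) := s.2

theorem smul_eq_mul_unopScalar (s : (fixedRing k (PiA k n) (W k n)).op) (x : PiA k n) :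
    s • x = x * unopScalar s := rfl

theorem coord_smul_e_add_e (hn : Even n) (s : (fixedRing k (PiA k n) (W k n)).op)
    (i : CyclicQuiver.evenVertices n) (l : CyclicQuiver n) :
    (pbw k n).coord (s • (e k (i : CyclicQuiver n) + e k ((i : CyclicQuiver n) + 1))) l
      = if evenRep hn l = i then (pbw k n).coord (unopScalar s) l else 0 := by
  have h : (pbw k n).coord (e k l *
      (s • (e k (i : CyclicQuiver n) + e k ((i : CyclicQuiver n) + 1)))) l = _ :=
    congrArg (fun r => (pbw k n).coord r l) (by
      rw [smul_eq_mul_unopScalar, ← mul_assoc, e_mul_e_add_e hn, ite_mul, zero_mul])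
  rw [coord_e_mul, Pi.single_eq_same] at h
  rw [h]
  split_ifs
  · rw [coord_e_mul, Pi.single_eq_same]
  · rw [map_zero]; rfl

theorem coord_smul_α_add_α (hn : Even n) (s : (fixedRing k (PiA k n) (W k n)).op)
    (i : CyclicQuiver.evenVertices n) (l : CyclicQuiver n) :
    (pbw k n).coord (s • (α k (i : CyclicQuiver n) + α k ((i : CyclicQuiver n) + 1))) l
      = if evenRep hn l = i then X 0 * (pbw k n).coord (unopScalar s) (l + 1) else 0 := by
  have h : (pbw k n).coord (e k l *
      (s • (α k (i : CyclicQuiver n) + α k ((i : CyclicQuiver n) + 1)))) l = _ :=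
    congrArg (fun r => (pbw k n).coord r l) (by
      rw [smul_eq_mul_unopScalar, ← e_mul_x, ← e_mul_x, ← add_mul, ← mul_assoc, ← mul_assoc,
        e_mul_e_add_e hn, ite_mul, ite_mul, zero_mul, zero_mul])
  rw [coord_e_mul, Pi.single_eq_same] at h
  rw [h]
  split_ifs
  · rw [e_mul_x, coord_α_mul, Pi.single_eq_same]
  · rw [map_zero]; rfl

/-- Only the pair containing `l` contributes at `l`. The coefficient of the `α` element is read at
`l + 1`, since passing `α_l` moves the vertex. -/
theorem coord_sum_smul_evenBasis (hn : Even n)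
    (c : CyclicQuiver.evenVertices n ⊕ CyclicQuiver.evenVertices n →
      (fixedRing k (PiA k n) (W k n)).op) (l : CyclicQuiver n) :
    (pbw k n).coord (∑ j, c j • evenBasis k n j) l
      = (pbw k n).coord (unopScalar (c (.inl (evenRep hn l)))) l
        + X 0 * (pbw k n).coord (unopScalar (c (.inr (evenRep hn l)))) (l + 1) := by
  rw [Fintype.sum_sum_type, map_add, map_sum, map_sum, Pi.add_apply, Finset.sum_apply,
    Finset.sum_apply]
  simp only [evenBasis, Sum.elim_inl, Sum.elim_inr, coord_smul_e_add_e hn, coord_smul_α_add_α hn,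
    Finset.sum_ite_eq, Finset.mem_univ, if_true]

/-- A scalar is determined by one even and one odd coordinate. The two vertices of a pair test one
each, through the uniqueness of `p + X 0 * q`. -/
theorem linearIndependent_evenBasis (hn : Even n) :
    LinearIndependent (fixedRing k (PiA k n) (W k n)).op (evenBasis k n) := by
  rw [Fintype.linearIndependent_iff]
  intro c hc
  have key : ∀ l, (pbw k n).coord (unopScalar (c (.inl (evenRep hn l)))) l = 0 ∧
      (pbw k n).coord (unopScalar (c (.inr (evenRep hn l)))) (l + 1) = 0 := fun l =>
    eq_zero_of_add_X_mul_eq_zero (swapVars_coord (unopScalar_mem _) _)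
      (swapVars_coord (unopScalar_mem _) _)
      (by rw [← coord_sum_smul_evenBasis hn, hc, map_zero]; rfl)
  have hzero : ∀ (s : (fixedRing k (PiA k n) (W k n)).op) (i : CyclicQuiver n),
      (pbw k n).coord (unopScalar s) i = 0 → (pbw k n).coord (unopScalar s) (i + 1) = 0 →
        s = 0 := fun s i h h' => by
    have : unopScalar s = 0 := (pbw k n).coord_injective (funext fun j => by
      rw [map_zero]
      exact forall_coord_of_consecutive hn (motive := (· = 0)) (unopScalar_mem s) i h h' j)
    exact Subtype.ext (MulOpposite.unop_injective this)
  rintro (i | i)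
  · have h1 := (key i).1
    have h2 := (key (i + 1)).1
    rw [evenRep_coe] at h1
    rw [evenRep_coe_add_one] at h2
    exact hzero _ _ h1 h2
  · have h1 := (key i).2
    have h2 := (key (i + 1)).2
    rw [evenRep_coe] at h1
    rw [evenRep_coe_add_one] at h2
    exact hzero _ _ h1 h2

/-- The scalar with prescribed coordinates at the even and at the odd vertices. -/
def scalarOf (hn : Even n) (a : TwoVertex → MvPolynomial (Fin 2) k) :
    (fixedRing k (PiA k n) (W k n)).op :=
  ⟨MulOpposite.op (fromTwoVertex k hn ((TwoVertexAlgebra.pbw k).ofCoord a)),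
    fromTwoVertex_mem hn _⟩

theorem coord_scalarOf (hn : Even n) (a : TwoVertex → MvPolynomial (Fin 2) k)
    (i : CyclicQuiver n) :
    (pbw k n).coord (unopScalar (scalarOf hn a)) i = powerSums (a (parity i)) := by
  change (pbw k n).coord (fromTwoVertex k hn _) i = _
  rw [coord_fromTwoVertex, PBWData.coord_ofCoord]

theorem span_evenBasis [CharZero k] (hn : Even n) :
    ⊤ ≤ Submodule.span (fixedRing k (PiA k n) (W k n)).op (Set.range (evenBasis k n)) := by
  rintro x -
  choose a b hab using fun i => exists_eq_powerSums_add ((pbw k n).coord x i)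
  let c : CyclicQuiver.evenVertices n ⊕ CyclicQuiver.evenVertices n →
      (fixedRing k (PiA k n) (W k n)).op :=
    Sum.elim
      (fun i => scalarOf hn fun t => TwoVertex.casesOn t (a i) (a (i + 1)))
      -- The order is interchanged because the coefficient of an `α` element is read one vertex
      -- further: its odd coordinate serves `i` and its even coordinate serves `i + 1`.
      (fun i => scalarOf hn fun t => TwoVertex.casesOn t (b (i + 1)) (b i))
  have hx : x = ∑ j, c j • evenBasis k n j := by
    refine (pbw k n).coord_injective (funext fun l => ?_)
    rw [coord_sum_smul_evenBasis hn, hab l]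
    simp only [c, Sum.elim_inl, Sum.elim_inr, coord_scalarOf, parity_add_one hn]
    obtain ⟨i, hi⟩ : ∃ i, evenRep hn l = i := ⟨_, rfl⟩
    have hl := eq_or_eq_evenRep_add_one hn l
    rw [hi] at hl ⊢
    obtain rfl | rfl := hl
    · rw [parity_of_mem_evenVertices]
      rfl
    · rw [parity_add_one hn, parity_of_mem_evenVertices]
      rfl
  rw [hx]
  exact Submodule.sum_mem _ fun j _ => Submodule.smul_mem _ _ (Submodule.subset_span ⟨j, rfl⟩)

variable (k n) in
/-- The basis of the preprojective algebra as a right module over the fixed ring. -/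
def basis [CharZero k] (hn : Even n) :
    Module.Basis (CyclicQuiver.evenVertices n ⊕ CyclicQuiver.evenVertices n)
      (fixedRing k (PiA k n) (W k n)).op (PiA k n) :=
  Module.Basis.mk (linearIndependent_evenBasis hn) (span_evenBasis hn)

theorem basis_apply [CharZero k] (hn : Even n)
    (j : CyclicQuiver.evenVertices n ⊕ CyclicQuiver.evenVertices n) :
    basis k n hn j = evenBasis k n j :=
  Module.Basis.mk_apply ..

/-! #### An endomorphism of degree `-1` -/

variable (k n) in
/-- The endomorphism that kills `e_i + e_{i+1}` and sends `α_i + α_{i+1}` to `e_i + e_{i+1}`. -/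
def lowering [CharZero k] (hn : Even n) : RightEnd k (PiA k n) (W k n) :=
  (basis k n hn).constr ℕ (Sum.elim (fun _ => 0) fun i => evenBasis k n (.inl i))

theorem lowering_evenBasis_inr [CharZero k] (hn : Even n) (i : CyclicQuiver.evenVertices n) :
    lowering k n hn (evenBasis k n (.inr i)) = evenBasis k n (.inl i) := by
  rw [← basis_apply hn, lowering, Module.Basis.constr_basis]
  rfl

theorem coord_lowering [CharZero k] (hn : Even n) (x : PiA k n) (l : CyclicQuiver n) :
    (pbw k n).coord (lowering k n hn x) l
      = (pbw k n).coord (unopScalar ((basis k n hn).repr x (.inr (evenRep hn l)))) l := by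
  rw [lowering, Module.Basis.constr_apply_fintype, Fintype.sum_sum_type]
  simp only [Sum.elim_inl, Sum.elim_inr, smul_zero, Finset.sum_const_zero, zero_add, evenBasis,
    map_sum, Finset.sum_apply, coord_smul_e_add_e hn, Finset.sum_ite_eq, Finset.mem_univ, if_true,
    Module.Basis.equivFun_apply]

/-- The basis coefficient at an `α` element is the `q` in a splitting `p + X 0 * q` of a coordinate
of `x`, so homogeneity passes to it with the degree lowered by one. -/
theorem isHomogeneous_of_mem_piece [CharZero k] (hn : Even n) {x : PiA k n} {d : ℕ}
    (hx : x ∈ 𝓡 d) (l : CyclicQuiver n) :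
    d = 0 ∧ (pbw k n).coord (unopScalar ((basis k n hn).repr x (.inr (evenRep hn l)))) (l + 1) = 0
      ∨ ∃ e, d = e + 1 ∧ ((pbw k n).coord
        (unopScalar ((basis k n hn).repr x (.inr (evenRep hn l)))) (l + 1)).IsHomogeneous e := by
  have h := mem_piece_iff.1 hx l
  rw [← (basis k n hn).sum_repr x] at h
  simp only [basis_apply] at h
  rw [coord_sum_smul_evenBasis hn] at h
  exact isHomogeneous_of_isHomogeneous_add_X_mul (swapVars_coord (unopScalar_mem _) _)
    (swapVars_coord (unopScalar_mem _) _) h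

/-- A property of all the coordinates that enter into `lowering`. -/
theorem forall_coord_lowering [CharZero k] (hn : Even n)
    {motive : MvPolynomial (Fin 2) k → Prop} {x : PiA k n}
    (h : ∀ l, motive ((pbw k n).coord
      (unopScalar ((basis k n hn).repr x (.inr (evenRep hn l)))) (l + 1))) (l : CyclicQuiver n) :
    motive ((pbw k n).coord (lowering k n hn x) l) := by
  rw [coord_lowering]
  have h1 := h (evenRep hn l)
  have h2 := h ((evenRep hn l : CyclicQuiver n) + 1)
  rw [evenRep_coe] at h1
  rw [evenRep_coe_add_one] at h2
  exact forall_coord_of_consecutive hn (unopScalar_mem _) _ h1 h2 l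

theorem lowering_eq_zero_of_mem_piece_zero [CharZero k] (hn : Even n) {x : PiA k n}
    (hx : x ∈ 𝓡 0) : lowering k n hn x = 0 := by
  refine (pbw k n).coord_injective (funext fun l => ?_)
  rw [map_zero]
  refine forall_coord_lowering hn (motive := (· = 0)) (fun l => ?_) l
  obtain ⟨-, h⟩ | ⟨e, h, -⟩ := isHomogeneous_of_mem_piece hn hx l
  · exact h
  · omega

theorem lowering_mem_piece [CharZero k] (hn : Even n) {x : PiA k n} {d : ℕ}
    (hx : x ∈ 𝓡 (d + 1)) : lowering k n hn x ∈ 𝓡 d := by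
  refine mem_piece_iff.2 (forall_coord_lowering hn (motive := (IsHomogeneous · d)) fun l => ?_)
  obtain ⟨h, -⟩ | ⟨e, h, h'⟩ := isHomogeneous_of_mem_piece hn hx l
  · omega
  · obtain rfl : d = e := by omega
    exact h'

theorem e_ne_zero (i : CyclicQuiver n) : e k i ≠ 0 := fun h => by
  have := congrArg (fun r => (pbw k n).coord r i) h
  rw [show e k i = (pbw k n).e i from rfl] at this
  simp only [PBWData.coord_e, Pi.single_eq_same, map_zero, Pi.zero_apply] at this
  exact one_ne_zero this

theorem lowering_ne_zero [CharZero k] (hn : Even n) : lowering k n hn ≠ 0 := fun h => by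
  have h1 := lowering_evenBasis_inr (k := k) hn (evenRep hn 0)
  rw [h, LinearMap.zero_apply] at h1
  have h2 := e_mul_e_add_e (k := k) hn 0 (evenRep hn 0)
  rw [if_pos rfl] at h2
  refine e_ne_zero (0 : CyclicQuiver n) (h2.symm.trans ?_)
  exact (congrArg (e k 0 * ·) h1.symm).trans (mul_zero _)

/-! ### The Auslander map -/

/-- Permuting the coordinates and exchanging the two variables both preserve homogeneity. -/
theorem dihedral_apply_mem_piece {τ : PiA k n ≃ₐ[k] PiA k n} (hτ : τ ∈ dihedral k n) {d : ℕ}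
    {x : PiA k n} (hx : x ∈ 𝓡 d) : τ x ∈ 𝓡 d := by
  rw [mem_piece_iff] at hx ⊢
  intro i
  obtain ⟨c, h | h⟩ := dihedral_cases hτ
  · rw [h, coord_rotHom]
    exact hx _
  · rw [h, coord_rotHom, coord_reflHom]
    exact (hx _).rename_isHomogeneous

variable (k n) in
theorem W_le_dihedral : W k n ≤ dihedral k n :=
  (Subgroup.closure_le _).2 fun _ h => h.1

theorem mul_mem_iSup_piece (a : PiA k n) {m : ℕ} {y : PiA k n} (hy : y ∈ 𝓡 m) :
    a * y ∈ ⨆ d, 𝓡 (d + m) := by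
  have ha : a ∈ ⨆ d, 𝓡 d := iSup_piece (k := k) (n := n) ▸ Submodule.mem_top
  induction ha using Submodule.iSup_induction' with
  | mem d a ha => exact Submodule.mem_iSup_of_mem d (SetLike.mul_mem_graded ha hy)
  | zero => rw [zero_mul]; exact Submodule.zero_mem _
  | add a b _ _ ha hb => rw [add_mul]; exact Submodule.add_mem _ ha hb

/-- The image of the Auslander map does not lower degrees. -/
theorem auslanderMap_apply_mem (z : SkewMonoidAlgebra (PiA k n) (W k n)) {m : ℕ} {x : PiA k n}
    (hx : x ∈ 𝓡 m) : auslanderMap k (PiA k n) (W k n) z x ∈ ⨆ d, 𝓡 (d + m) := by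
  induction z using SkewMonoidAlgebra.induction_on with
  | zero => rw [map_zero]; exact Submodule.zero_mem _
  | add z z' hz hz' => rw [map_add]; exact Submodule.add_mem _ hz hz'
  | single g a =>
    rw [auslanderMap_single]
    exact mul_mem_iSup_piece a (dihedral_apply_mem_piece (W_le_dihedral k n g.2) hx)

theorem eq_zero_of_mem_piece_of_mem_iSup {d : ℕ} {y : PiA k n} (hy : y ∈ 𝓡 d)
    (hy' : y ∈ ⨆ e, 𝓡 (e + (d + 1))) : y = 0 := by
  have h : iSupIndep 𝓡 := by
    rw [funext piece_eq_homog]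
    exact ((pbw k n).isInternal_homog 1).submodule_iSupIndep
  have hle : ⨆ e, 𝓡 (e + (d + 1)) ≤ ⨆ j, ⨆ _ : j ≠ d, 𝓡 j :=
    iSup_le fun e => le_iSup₂_of_le (e + (d + 1)) (by omega) le_rfl
  exact Submodule.disjoint_def.1 (h d) y hy (hle hy')

/-- If `lowering` were in the image, it would send degree `d + 1` both into degree `d` and into
degrees at least `d + 1`, hence to zero. As it also kills degree zero, it would vanish. -/
theorem not_surjective_auslanderMap [CharZero k] (hn : Even n) :
    ¬ Function.Surjective (auslanderMap k (PiA k n) (W k n)) := fun hsurj => by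
  obtain ⟨z, hz⟩ := hsurj (lowering k n hn)
  refine lowering_ne_zero (k := k) hn (LinearMap.ext fun x => ?_)
  rw [LinearMap.zero_apply]
  have hx : x ∈ ⨆ d, 𝓡 d := iSup_piece (k := k) (n := n) ▸ Submodule.mem_top
  induction hx using Submodule.iSup_induction' with
  | zero => rw [map_zero]
  | add x y _ _ hx hy => rw [map_add, hx, hy, add_zero]
  | mem d x hx =>
    cases d with
    | zero => exact lowering_eq_zero_of_mem_piece_zero hn hx
    | succ d =>
      refine eq_zero_of_mem_piece_of_mem_iSup (lowering_mem_piece hn hx) ?_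
      rw [← hz]
      exact auslanderMap_apply_mem z hx

end PiA

end

theorem theorem3 (k : Type*) [Field k] [IsAlgClosed k] [CharZero k]
    (n : ℕ) [NeZero n] (hn : 3 ≤ n) (heven : Even n) :
    -- the Auslander map of `(R, W_n)` is not an isomorphism
    ¬ Function.Bijective (auslanderMap k (PiA k n) (PiA.W k n)) ∧
    -- the graded isomorphism of the two-vertex algebra with `R^{W_n}`
    (∃ Φ : TwoVertexAlgebra k ≃ₐ[k] fixedRing k (PiA k n) (PiA.W k n),
      (Φ (TwoVertexAlgebra.f₁ k) : PiA k n) = PiA.sumZero k (CyclicQuiver.evenVertices n) ∧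
      (Φ (TwoVertexAlgebra.f₂ k) : PiA k n) = PiA.sumZero k (CyclicQuiver.oddVertices n) ∧
      (Φ (TwoVertexAlgebra.u₁ k) : PiA k n) = PiA.sumOne k (CyclicQuiver.evenVertices n) ∧
      (Φ (TwoVertexAlgebra.u₂ k) : PiA k n) = PiA.sumOne k (CyclicQuiver.oddVertices n) ∧
      (Φ (TwoVertexAlgebra.v₁ k) : PiA k n) = PiA.sumTwo k (CyclicQuiver.evenVertices n) ∧
      (Φ (TwoVertexAlgebra.v₂ k) : PiA k n) = PiA.sumTwo k (CyclicQuiver.oddVertices n) ∧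
      ∀ (d : ℕ) (x : TwoVertexAlgebra k), x ∈ TwoVertexAlgebra.piece k d ↔
        (Φ x : PiA k n) ∈ PreprojectiveAlgebra.piece k (CyclicQuiver n) d) ∧
    -- the two-vertex algebra is graded and twisted Calabi–Yau of dimension two, and its Nakayama
    -- automorphism exchanges the two vertices
    Nonempty (GradedAlgebra (TwoVertexAlgebra.piece k)) ∧
    (∃ μ : TwoVertexAlgebra k ≃ₐ[k] TwoVertexAlgebra k,
      μ (TwoVertexAlgebra.f₁ k) = TwoVertexAlgebra.f₂ k ∧
      μ (TwoVertexAlgebra.f₂ k) = TwoVertexAlgebra.f₁ k ∧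
      μ (TwoVertexAlgebra.u₁ k) = TwoVertexAlgebra.u₂ k ∧
      μ (TwoVertexAlgebra.u₂ k) = TwoVertexAlgebra.u₁ k ∧
      μ (TwoVertexAlgebra.v₁ k) = TwoVertexAlgebra.v₂ k ∧
      μ (TwoVertexAlgebra.v₂ k) = TwoVertexAlgebra.v₁ k ∧
      IsTwistedCalabiYau k (TwoVertexAlgebra k) 2 μ) ∧
    -- every element of `R` is uniquely `∑ e_i a_i + α_i b_i`, with `a_i` and `b_i` in `R^{W_n}`
    -- supported at the target of `e_i` and of `α_i`
    (∀ x : PiA k n, ∃! c : (CyclicQuiver n → PiA k n) × (CyclicQuiver n → PiA k n),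
      (∀ i, c.1 i ∈ fixedRing k (PiA k n) (PiA.W k n) ∧
        PiA.sumZero k (CyclicQuiver.parityClass n i) * c.1 i = c.1 i) ∧
      (∀ i, c.2 i ∈ fixedRing k (PiA k n) (PiA.W k n) ∧
        PiA.sumZero k (CyclicQuiver.parityClass n (i + 1)) * c.2 i = c.2 i) ∧
      x = ∑ i, (PiA.e k i * c.1 i + PiA.α k i * c.2 i)) ∧
    -- `R` is a free right `R^{W_n}`-module
    (∃ b : Module.Basis (CyclicQuiver.evenVertices n ⊕ CyclicQuiver.evenVertices n)
        (fixedRing k (PiA k n) (PiA.W k n)).op (PiA k n),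
      (∀ i : CyclicQuiver.evenVertices n,
        b (Sum.inl i) = PiA.e k (i : CyclicQuiver n) + PiA.e k ((i : CyclicQuiver n) + 1)) ∧
      (∀ i : CyclicQuiver.evenVertices n,
        b (Sum.inr i) = PiA.α k (i : CyclicQuiver n) + PiA.α k ((i : CyclicQuiver n) + 1))) ∧
    -- a nonzero endomorphism of degree `-1` of the right `R^{W_n}`-module `R`
    (∃ f : RightEnd k (PiA k n) (PiA.W k n), f ≠ 0 ∧
      (∀ x ∈ PreprojectiveAlgebra.piece k (CyclicQuiver n) 0, f x = 0) ∧
      ∀ d : ℕ, ∀ x ∈ PreprojectiveAlgebra.piece k (CyclicQuiver n) (d + 1),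
        f x ∈ PreprojectiveAlgebra.piece k (CyclicQuiver n) d) := by
  refine ⟨fun h => PiA.not_surjective_auslanderMap heven h.2,
    ⟨PiA.fixedRingEquiv k heven, ?_, ?_, ?_, ?_, ?_, ?_,
      PiA.mem_piece_iff_fromTwoVertex_mem heven⟩,
    TwoVertexAlgebra.nonempty_gradedAlgebra_piece k,
    ⟨TwoVertexAlgebra.exchange k, TwoVertexAlgebra.exchange_f k .one,
      TwoVertexAlgebra.exchange_f k .two, TwoVertexAlgebra.exchange_u₁ k,
      TwoVertexAlgebra.exchange_u₂ k, TwoVertexAlgebra.exchange_v₁ k,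
      TwoVertexAlgebra.exchange_v₂ k, TwoVertexAlgebra.isTwistedCalabiYau k⟩,
    PiA.existsUnique_decomposition heven,
    ⟨PiA.basis k n heven, fun i => PiA.basis_apply heven (.inl i),
      fun i => PiA.basis_apply heven (.inr i)⟩,
    ⟨PiA.lowering k n heven, PiA.lowering_ne_zero heven,
      fun _ => PiA.lowering_eq_zero_of_mem_piece_zero heven,
      fun _ _ => PiA.lowering_mem_piece heven⟩⟩
  · rw [PiA.coe_fixedRingEquiv, ← PiA.verticesOf_one]
    exact PiA.fromTwoVertex_f heven .one
  · rw [PiA.coe_fixedRingEquiv, ← PiA.verticesOf_two]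
    exact PiA.fromTwoVertex_f heven .two
  · rw [PiA.coe_fixedRingEquiv, ← PiA.verticesOf_one, ← TwoVertexAlgebra.f_one_mul_u, map_mul,
      PiA.fromTwoVertex_f, PiA.fromTwoVertex_u, PiA.ev_powerSums_X_zero, PiA.sumOne_eq]
  · rw [PiA.coe_fixedRingEquiv, ← PiA.verticesOf_two, ← TwoVertexAlgebra.f_two_mul_u, map_mul,
      PiA.fromTwoVertex_f, PiA.fromTwoVertex_u, PiA.ev_powerSums_X_zero, PiA.sumOne_eq]
  · rw [PiA.coe_fixedRingEquiv, ← PiA.verticesOf_one, ← TwoVertexAlgebra.f_one_mul_v, map_mul,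
      PiA.fromTwoVertex_f, PiA.fromTwoVertex_v, PiA.ev_powerSums_X_one, PiA.sumTwo_eq]
  · rw [PiA.coe_fixedRingEquiv, ← PiA.verticesOf_two, ← TwoVertexAlgebra.f_two_mul_v, map_mul,
      PiA.fromTwoVertex_f, PiA.fromTwoVertex_v, PiA.ev_powerSums_X_one, PiA.sumTwo_eq]
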